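/- **Setting.** Let $M$ be a smooth manifold (Hausdorff, $\sigma$-compact), let $\pi,\alpha_1$ be smooth vector bundles of finite rank over $M$, and let $\mathcal U$ be an open subset of the infinite jet space $\pi_\infty\colon J^\infty(\pi)\to M$. Functions on $\mathcal U$ are the smooth functions of finite order (that is, depending on jets of some finite order $k$), and $\mathcal F$ is their algebra. For a vector bundle $\alpha$ over $M$ the *horizontal module* $\Gamma(\pi_\infty^*\alpha)$ consists of the smooth finite-order sections of $\pi_\infty^*\alpha$ over $\mathcal U$. Put $P_1=\Gamma(\pi_\infty^*\alpha_1)$ and $\kappa=\Gamma(\pi_\infty^*\pi)$; $P_2$ and $Q$ denote arbitrary horizontal modules. For horizontal modules $P,Q$, $\mathcal C\mathrm{Diff}(P,Q)$ is the set of $\mathcal C$-differential operators, i.e. of the linear maps $\nabla\colon P\to Q$ for which there is a $k$ such that, for every section $s$ of $\pi$ and every point $x$ with $j_\infty(s)(x)\in\mathcal U$, the value of $\nabla(p)$ at $j_\infty(s)(x)$ depends only on the $k$-jet at $x$ of $j_\infty(s)^*p$ (in coordinates, $\nabla=\sum_{|\sigma|\le k}a_\sigma D_\sigma$). Let $F\in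 P_1$, let $\mathcal E^\infty\subset\mathcal U$ be the infinite prolongation of the equation $F=0$ (the set where all total derivatives of $F$ vanish), and let $\ell_F\colon\kappa\to P_1$ be the linearization of $F$, i.e. $\ell_F(\varphi)$ at $j_\infty(s)(x)$ is $\frac{d}{dt}\big|_{t=0}F\bigl(j_\infty(s+tw)(x)\bigr)$, where $w=j_\infty(s)^*\varphi$ near $x$. Elements of $P|_{\mathcal E^\infty}$ are the restrictions to $\mathcal E^\infty$ of elements of $P$, and $\mathcal C\mathrm{Diff}(P|_{\mathcal E^\infty},Q|_{\mathcal E^\infty})$ consists of the restrictions to $\mathcal E^\infty$ of the operators in $\mathcal C\mathrm{Diff}(P,Q)$. *Regularity condition.* Assume that there is an isomorphism $\nu\colon\mathcal U\to\mathcal E^\infty\times\mathcal V$ of inverse limits of manifolds (coordinates of each finite order are, in both directions, smooth functions of coordinates of some finite order), where $\mathcal V$ is an open star-shaped neighbourhood of zero in the space of (finite or infinite) real sequences, such that $\nu(\theta)=(\theta,0)$ for $\theta\in\mathcal E^\infty$ and the components of the composition $v=(v_1,v_2,\dots)\colon\mathcal U\to\mathcal V$ of $\nu$ with the projection have the form $v_s=\nabla_s(F)$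 with $\nabla_s\in\mathcal C\mathrm{Diff}(P_1,\mathcal F)$ (for example, $v_s=D_{\sigma_s}(F_{i_s})$ in coordinates). An operator $\Delta\in\mathcal C\mathrm{Diff}(P_1|_{\mathcal E^\infty},P_2|_{\mathcal E^\infty})$ is the *compatibility operator* for $\ell_F|_{\mathcal E^\infty}$ if $\Delta\circ\ell_F|_{\mathcal E^\infty}=0$ and for every $Q$ each $\nabla\in\mathcal C\mathrm{Diff}(P_1|_{\mathcal E^\infty},Q|_{\mathcal E^\infty})$ with $\nabla\circ\ell_F|_{\mathcal E^\infty}=0$ has the form $\nabla=\square\circ\Delta$ with $\square\in\mathcal C\mathrm{Diff}(P_2|_{\mathcal E^\infty},Q|_{\mathcal E^\infty})$. The equation is *normal* if the zero operator (into some $P_2|_{\mathcal E^\infty}$) is the compatibility operator for $\ell_F|_{\mathcal E^\infty}$. **Statement.** The linearization is well defined (for each $\varphi\in\kappa$ there is exactly one element $\ell_F(\varphi)\in P_1$ as above), and: 1. An operator $\Delta\in\mathcal C\mathrm{Diff}(P_1|_{\mathcal E^\infty},P_2|_{\mathcal E^\infty})$ is the compatibility operator for $\ell_F|_{\mathcal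 E^\infty}$ if and only if $\Delta\circ\ell_F|_{\mathcal E^\infty}=0$ and for every $Q$ and every $\nabla\in\mathcal C\mathrm{Diff}(P_1,Q)$ with $\nabla(F)=0$ there is $\square\in\mathcal C\mathrm{Diff}(P_2|_{\mathcal E^\infty},Q|_{\mathcal E^\infty})$ with $\nabla|_{\mathcal E^\infty}=\square\circ\Delta$. 2. The equation is normal if and only if for every $Q$ and every $\nabla\in\mathcal C\mathrm{Diff}(P_1,Q)$ the equality $\nabla(F)=0$ implies $\nabla|_{\mathcal E^\infty}=0$. 3. If $\Delta\in\mathcal C\mathrm{Diff}(P_1|_{\mathcal E^\infty},P_2|_{\mathcal E^\infty})$ is the compatibility operator for $\ell_F|_{\mathcal E^\infty}$, then there is $\tilde\Delta\in\mathcal C\mathrm{Diff}(P_1,P_2)$ with $\tilde\Delta|_{\mathcal E^\infty}=\Delta$ and $\tilde\Delta(F)=0$. -/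

import Mathlib

open scoped Manifold ContDiff Topology

noncomputable section

namespace JetGeom

/-- A smooth real vector bundle of finite rank over the smooth manifold `M`. -/
structure VBundle (n : ℕ) (M : Type*) [TopologicalSpace M]
    [ChartedSpace (EuclideanSpace ℝ (Fin n)) M] where
  /-- the model fibre -/
  Model : Type
  [normed : NormedAddCommGroup Model]
  [space : NormedSpace ℝ Model]
  [finite : FiniteDimensional ℝ Model]
  /-- the fibres -/
  Fib : M → Type
  [add : ∀ x, AddCommGroup (Fib x)]
  [module : ∀ x, Module ℝ (Fib x)]
  [topFib : ∀ x, TopologicalSpace (Fib x)]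
  [topTotal : TopologicalSpace (Bundle.TotalSpace Model Fib)]
  [fiberBundle : FiberBundle Model Fib]
  [vectorBundle : VectorBundle ℝ Model Fib]
  [smooth : ContMDiffVectorBundle ∞ Model Fib 𝓘(ℝ, EuclideanSpace ℝ (Fin n))]

attribute [instance] VBundle.normed VBundle.space VBundle.finite VBundle.add VBundle.module
  VBundle.topFib VBundle.topTotal VBundle.fiberBundle VBundle.vectorBundle VBundle.smooth

section

variable {n : ℕ} {M : Type*} [TopologicalSpace M] [ChartedSpace (EuclideanSpace ℝ (Fin n)) M]

/-- The trivial line bundle; sections of its pullback are functions. -/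
def lineBundle (n : ℕ) (M : Type*) [TopologicalSpace M]
    [ChartedSpace (EuclideanSpace ℝ (Fin n)) M] : VBundle n M where
  Model := ℝ
  Fib := Bundle.Trivial M ℝ

/-- Smooth sections over `M` of a bundle. -/
abbrev Sec (π : VBundle n M) : Type _ :=
  ContMDiffSection 𝓘(ℝ, EuclideanSpace ℝ (Fin n)) π.Model ∞ π.Fib

/-- The fibre of `π` over `x` expressed in the preferred trivialization around `p`
(zero if `x` is outside of its domain). -/
def triv (π : VBundle n M) (p x : M) : π.Fib x →ₗ[ℝ] π.Model :=
  (trivializationAt π.Model π.Fib p).linearMapAt ℝ x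

/-- The local representative, in the preferred chart and trivialization around `p`, of a
(not necessarily smooth) section. -/
def localRep (π : VBundle n M) (p : M) (s : ∀ x, π.Fib x) :
    EuclideanSpace ℝ (Fin n) → π.Model :=
  fun z => triv π p ((chartAt (EuclideanSpace ℝ (Fin n)) p).symm z)
    (s ((chartAt (EuclideanSpace ℝ (Fin n)) p).symm z))

/-- The `i`-th derivative at the point `x` of the representative of `s` in the chart and
trivialization around `p`. -/
def derivRep (π : VBundle n M) (p : M) (i : ℕ) (s : ∀ x, π.Fib x) (x : M) :
    ContinuousMultilinearMap ℝ (fun _ : Fin i => EuclideanSpace ℝ (Fin n)) π.Model :=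
  iteratedFDeriv ℝ i (localRep π p s) (chartAt (EuclideanSpace ℝ (Fin n)) p x)

/-- The `k`-jet of the section `s` at `x` is zero. -/
def FlatAt (π : VBundle n M) (k : ℕ) (s : ∀ x, π.Fib x) (x : M) : Prop :=
  ∀ i ≤ k, derivRep π x i s x = 0

/-- Two sections have the same infinite jet at `x`. -/
def jetSetoid (π : VBundle n M) (x : M) : Setoid (Sec π) :=
  Setoid.ker fun s : Sec π => fun i : ℕ => derivRep π x i (fun y => s y) x

/-- The space of infinite jets of sections of `π`. -/
structure Jet (π : VBundle n M) where
  /-- the projection to `M` -/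
  base : M
  /-- the class of sections with this jet -/
  cls : Quotient (jetSetoid π base)

/-- The infinite jet of `s` at `x`; the section `x ↦ jet s x` is the infinite prolongation
of `s`. -/
def jet {π : VBundle n M} (s : Sec π) (x : M) : Jet π :=
  ⟨x, Quotient.mk (jetSetoid π x) s⟩

/-- The values of the coordinates `x_i`, `u^j_σ`, `|σ| ≤ k`. -/
abbrev Coord (π : VBundle n M) (k : ℕ) : Type :=
  EuclideanSpace ℝ (Fin n) ×
    ((i : Fin (k + 1)) →
      ContinuousMultilinearMap ℝ (fun _ : Fin (i : ℕ) => EuclideanSpace ℝ (Fin n)) π.Model)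

/-- The standard coordinates of order at most `k` on infinite jets, in the chart and
trivialization around `p`: the base point and the derivatives of order at most `k`. -/
def coord {π : VBundle n M} (p : M) (k : ℕ) (θ : Jet π) : Coord π k :=
  (chartAt (EuclideanSpace ℝ (Fin n)) p θ.base,
    fun i => derivRep π p i (fun y => (Quotient.out θ.cls : Sec π) y) θ.base)

/-- The standard basis of neighbourhoods of `θ₀` in the space of infinite jets. -/
def Near {π : VBundle n M} (k : ℕ) (ε : ℝ) (θ₀ θ : Jet π) : Prop :=
  θ.base ∈ (chartAt (EuclideanSpace ℝ (Fin n)) θ₀.base).source ∧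
    dist (coord θ₀.base k θ) (coord θ₀.base k θ₀) < ε

/-- Open subsets of the space of infinite jets (inverse limit topology). -/
def IsOpenJet {π : VBundle n M} (U : Set (Jet π)) : Prop :=
  ∀ θ₀ ∈ U, ∃ k : ℕ, ∃ ε > 0, ∀ θ, Near k ε θ₀ θ → θ ∈ U

/-- A section `φ` over `U` of the pullback of the bundle `α` to infinite jets is smooth and of
order at most `k`: around each point it is a smooth function of the coordinates of order at
most `k`. -/
def SmoothOrd {π : VBundle n M} (α : VBundle n M) (U : Set (Jet π)) (k : ℕ)
    (φ : ∀ θ : Jet π, α.Fib θ.base) : Prop :=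
  ∀ θ₀ ∈ U, ∃ ε > 0, ∃ G : Coord π k → α.Model, ContDiff ℝ ∞ G ∧
    ∀ θ ∈ U, Near k ε θ₀ θ → triv α θ₀.base θ.base (φ θ) = G (coord θ₀.base k θ)

/-- Coordinates of lower order are part of those of higher order. -/
def Coord.trunc {π : VBundle n M} {k l : ℕ} (h : k ≤ l) : Coord π l → Coord π k :=
  fun c => (c.1, fun i => c.2 (Fin.castLE (Nat.succ_le_succ h) i))

theorem Coord.contDiff_trunc {π : VBundle n M} {k l : ℕ} (h : k ≤ l) :
    ContDiff ℝ ∞ (Coord.trunc h : Coord π l → Coord π k) := by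
  unfold Coord.trunc
  refine contDiff_fst.prodMk ?_
  rw [contDiff_pi]
  intro i
  exact (contDiff_pi.1 (contDiff_snd (𝕜 := ℝ)) (Fin.castLE (Nat.succ_le_succ h) i))

theorem Near.mono {π : VBundle n M} {k l : ℕ} (h : k ≤ l) {ε δ : ℝ} (hε : ε ≤ δ)
    {θ₀ θ : Jet π} (hN : Near l ε θ₀ θ) : Near k δ θ₀ θ := by
  refine ⟨hN.1, lt_of_le_of_lt ?_ (lt_of_lt_of_le hN.2 hε)⟩
  rw [Prod.dist_eq, Prod.dist_eq]
  refine max_le_max le_rfl ?_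
  rw [dist_pi_le_iff dist_nonneg]
  intro i
  exact dist_le_pi_dist (coord θ₀.base l θ).2 (coord θ₀.base l θ₀).2
    (Fin.castLE (Nat.succ_le_succ h) i)

theorem SmoothOrd.mono {π α : VBundle n M} {U : Set (Jet π)} {k l : ℕ} (h : k ≤ l)
    {φ : ∀ θ : Jet π, α.Fib θ.base} (hφ : SmoothOrd α U k φ) : SmoothOrd α U l φ := by
  intro θ₀ h₀
  obtain ⟨ε, hε, G, hG, hφ⟩ := hφ θ₀ h₀
  exact ⟨ε, hε, G ∘ Coord.trunc h, hG.comp (Coord.contDiff_trunc h),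
    fun θ hθ hN => hφ θ hθ (hN.mono h le_rfl)⟩

/-- The horizontal module of sections over `U` of the pullback of the bundle `α` to infinite
jets. Sections over `U` are extended by zero outside of `U`. -/
def HSec {π : VBundle n M} (U : Set (Jet π)) (α : VBundle n M) :
    Submodule ℝ (∀ θ : Jet π, α.Fib θ.base) where
  carrier := {φ | (∃ k, SmoothOrd α U k φ) ∧ ∀ θ, θ ∉ U → φ θ = 0}
  zero_mem' := ⟨⟨0, fun _ _ => ⟨1, one_pos, fun _ => 0, contDiff_const, fun θ _ _ => by
    simp⟩⟩, fun _ _ => rfl⟩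
  add_mem' := by
    rintro φ ψ ⟨⟨k, hφ⟩, hφ0⟩ ⟨⟨l, hψ⟩, hψ0⟩
    refine ⟨⟨max k l, fun θ₀ h₀ => ?_⟩, fun θ hθ => ?_⟩
    · obtain ⟨ε, hε, G, hG, hφ⟩ := hφ.mono (le_max_left k l) θ₀ h₀
      obtain ⟨δ, hδ, H, hH, hψ⟩ := hψ.mono (le_max_right k l) θ₀ h₀
      refine ⟨min ε δ, lt_min hε hδ, fun c => G c + H c, hG.add hH, fun θ hθ hN => ?_⟩
      rw [Pi.add_apply, map_add, hφ θ hθ (hN.mono le_rfl (min_le_left _ _)),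
        hψ θ hθ (hN.mono le_rfl (min_le_right _ _))]
    · rw [Pi.add_apply, hφ0 θ hθ, hψ0 θ hθ, add_zero]
  smul_mem' := by
    rintro c φ ⟨⟨k, hφ⟩, hφ0⟩
    refine ⟨⟨k, fun θ₀ h₀ => ?_⟩, fun θ hθ => ?_⟩
    · obtain ⟨ε, hε, G, hG, hφ⟩ := hφ θ₀ h₀
      refine ⟨ε, hε, fun z => c • G z, contDiff_const.smul hG, fun θ hθ hN => ?_⟩
      rw [Pi.smul_apply, map_smul, hφ θ hθ hN]
    · rw [Pi.smul_apply, hφ0 θ hθ, smul_zero]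

variable {π : VBundle n M} {U : Set (Jet π)} {α β γ : VBundle n M}

/-- The restriction of a section `φ` of a horizontal module to the infinite prolongation of the
section `s` of `π`; it is a section of `α` near each `x` with `jet s x ∈ U`. -/
def pullback (φ : HSec U α) (s : Sec π) : ∀ x : M, α.Fib x :=
  fun x => φ.1 (jet s x)

/-- `𝓒`-differential operators: those differential operators that can be restricted to the
graphs of infinite jets. For some `k`, the value of `Δ φ` at `jet s x` is determined by the
`k`-jet at `x` of the restriction of `φ` to the infinite prolongation of `s`. In
coordinates these are the operators `∑ a_σ D_σ`, the sum being over `|σ| ≤ k`. -/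
def IsCDiff (Δ : HSec U α →ₗ[ℝ] HSec U β) : Prop :=
  ∃ k : ℕ, ∀ (φ : HSec U α) (s : Sec π) (x : M), jet s x ∈ U →
    FlatAt α k (pullback φ s) x → pullback (Δ φ) s x = 0

/-- The infinite prolongation of the equation `F = 0`: all total derivatives of `F`
vanish, that is, for `θ = jet s x` the section `F (jet s ·)` has zero infinite jet
at `x`. -/
def Prolongation (F : HSec U α) : Set (Jet π) :=
  {θ | θ ∈ U ∧ ∀ (s : Sec π) (x : M), jet s x = θ → ∀ k, FlatAt α k (pullback F s) x}

/-- `p` is the linearization of `F` along `φ`, where `φ` belongs to the module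
`κ = Γ(π_∞^* π)`: its value at `jet s x` is the derivative at `t = 0` of
`F (jet (s + t w) x)`, for a section `w` that coincides near `x` with the restriction
of `φ` to the infinite prolongation of `s`. -/
def IsLinearization (F : HSec U α) (φ : HSec U π) (p : HSec U α) : Prop :=
  ∀ (s w : Sec π) (x : M), jet s x ∈ U → (∀ᶠ y in 𝓝 x, w y = pullback φ s y) →
    HasDerivAt (fun t : ℝ => triv α x x (pullback F (s + t • w) x))
      (triv α x x (pullback p s x)) 0

/-- The linearization `ℓ_F(φ)`. -/
def lin (F : HSec U α) (φ : HSec U π) : HSec U α :=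
  Classical.epsilon (IsLinearization F φ)

/-- Restriction of sections to the infinite prolongation of `F = 0`. -/
def restrictMap (F : HSec U α) (β : VBundle n M) :
    HSec U β →ₗ[ℝ] (∀ θ : Prolongation F, β.Fib θ.1.base) where
  toFun φ := fun θ => φ.1 θ.1
  map_add' _ _ := rfl
  map_smul' _ _ := rfl

/-- The restriction of a horizontal module to the infinite prolongation of `F = 0`. -/
abbrev ESec (F : HSec U α) (β : VBundle n M) :
    Submodule ℝ (∀ θ : Prolongation F, β.Fib θ.1.base) :=
  LinearMap.range (restrictMap F β)

/-- The restriction homomorphism. -/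
def res (F : HSec U α) (β : VBundle n M) : HSec U β →ₗ[ℝ] ESec F β :=
  (restrictMap F β).rangeRestrict

/-- `Δ` is the restriction of `∇` to the infinite prolongation of `F = 0`. -/
def RestrictsTo (F : HSec U α) (D : HSec U β →ₗ[ℝ] HSec U γ)
    (Δ : ESec F β →ₗ[ℝ] ESec F γ) : Prop :=
  ∀ φ, Δ (res F β φ) = res F γ (D φ)

/-- `𝓒`-differential operators on the infinite prolongation of `F = 0`: in coordinates these
are operators `∑ a_σ D_σ` whose coefficients `a_σ` are functions on the prolongation, that
is, restrictions of functions on `U`. -/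
def IsCDiffE (F : HSec U α) (Δ : ESec F β →ₗ[ℝ] ESec F γ) : Prop :=
  ∃ D : HSec U β →ₗ[ℝ] HSec U γ, IsCDiff D ∧ RestrictsTo F D Δ

/-- On the infinite prolongation of `F = 0`, the composition of `Δ` with the linearization of
`F` is zero. -/
def KillsLin (F : HSec U α) (Δ : ESec F α →ₗ[ℝ] ESec F β) : Prop :=
  ∀ φ : HSec U π, Δ (res F α (lin F φ)) = 0

/-- `Δ` is the compatibility operator for the restriction of the linearization `ℓ_F` to the
infinite prolongation of `F = 0`. -/
def IsCompatibility (F : HSec U α) (Δ : ESec F α →ₗ[ℝ] ESec F β) : Prop :=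
  IsCDiffE F Δ ∧ KillsLin F Δ ∧
    ∀ (γ : VBundle n M) (N : ESec F α →ₗ[ℝ] ESec F γ), IsCDiffE F N → KillsLin F N →
      ∃ B : ESec F β →ₗ[ℝ] ESec F γ, IsCDiffE F B ∧ N = B ∘ₗ Δ

/-- The equation is normal: the compatibility operator for the linearization is trivial. -/
def IsNormal (F : HSec U α) : Prop :=
  ∃ β : VBundle n M, IsCompatibility F (0 : ESec F α →ₗ[ℝ] ESec F β)

/-- A function on the product of the infinite prolongation of `F = 0` with a set `V` of
families of reals is smooth and depends only on the jet coordinates of order at most `k` and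
on the `v_s`, `s ∈ T`. -/
def SmoothProd (F : HSec U α) {ι : Type} (V : Set (ι → ℝ)) (k : ℕ) (T : Finset ι)
    (g : Prolongation F × V → ℝ) : Prop :=
  ∀ q₀ : Prolongation F × V, ∃ ε > 0, ∃ G : Coord π k × (T → ℝ) → ℝ, ContDiff ℝ ∞ G ∧
    ∀ q : Prolongation F × V, Near k ε q₀.1.1 q.1.1 →
      (∀ s ∈ T, |q.2.1 s - q₀.2.1 s| < ε) →
      g q = G (coord q₀.1.1.base k q.1.1, fun s => q.2.1 s)

/-- The regularity condition: `U` is isomorphic to the product of the infinite prolongation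
with an open star-shaped neighbourhood `V` of zero in the space of (finite or infinite)
sequences, the prolongation being the zero section, and the components of the projection to
`V` have the form `v_s = D_s(F)` for some `𝓒`-differential operators `D_s` (such as
`F ↦ D_σ(F_i)` in coordinates). The last two clauses say that the isomorphism and its inverse
are smooth maps of inverse limits of manifolds: each coordinate level is pulled back into
some coordinate level. -/
def Regular (F : HSec U α) : Prop :=
  ∃ (ι : Type) (_ : Countable ι) (V : Set (ι → ℝ)) (ν : U ≃ Prolongation F × V)
    (D : ι → HSec U α →ₗ[ℝ] HSec U (lineBundle n M)),
    IsOpen V ∧ (0 : ι → ℝ) ∈ V ∧ StarConvex ℝ 0 V ∧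
    (∀ θ : Prolongation F, (ν ⟨θ.1, θ.2.1⟩).1 = θ ∧ (ν ⟨θ.1, θ.2.1⟩).2.1 = 0) ∧
    (∀ s, IsCDiff (D s)) ∧
    (∀ (θ : U) (s : ι), (ν θ).2.1 s = (D s F).1 θ.1) ∧
    (∀ k : ℕ, ∃ (l : ℕ) (T : Finset ι), ∀ f : Jet π → ℝ,
      SmoothOrd (lineBundle n M) U k f → SmoothProd F V l T fun q => f (ν.symm q).1) ∧
    (∀ (k : ℕ) (T : Finset ι), ∃ l : ℕ, ∀ f : Jet π → ℝ,
      (SmoothProd F V k T fun q => f (ν.symm q).1) → SmoothOrd (lineBundle n M) U l f)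

end

end JetGeom

end

/-!
The prolongation `𝓔` of `F = 0` is the zero set of the transversal coordinates `v_s = D_s F`.
Everything follows from three facts about a `𝓒`-differential operator `∇` and a prolonged section
`j(s)` that meets `𝓔` at `θ = j(s)(x)`.

* The restriction of `∇ F` to `j(s)` is flat at `x` (`IsCDiff.flat_of_mem_prolongation`). Indeed, in
  coordinates the value of `∇ φ` depends linearly on the derivatives of `φ` along `j(s)`; to avoid
  coefficients of `∇`, the `k`-jet of a section is expanded in a moving frame of jets
  (`exists_jet_frame`, `IsCDiff.exists_local_form`).
* The derivative of `∇ F` along `j(s + t w)` at `t = 0` is the value of `∇ (ℓ_F w)` at `θ`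
  (`IsCDiff.hasDerivAt_apply`): derivatives in `t` and in `x` commute, and the derivatives of the
  coefficients of `∇` do not contribute because `F` is flat along `j(s)` at `x`.
* Elements of horizontal modules that vanish on `𝓔` are combinations `∑ v_s g_s`
  (`Splitting.exists_division`). For functions this is Hadamard's lemma on the star-shaped
  fibres of `ν`; sections are divided component by component, with a partition of
  unity on `M`.

By the third fact and the first, `∇ φ` restricted to `𝓔` depends only on `φ` restricted to
`𝓔`, so that every `∇` restricts to `𝓔` (`IsCDiff.exists_restrictsTo`). If `∇ F = 0`, then
`∇ ∘ ℓ_F = 0` on `𝓔` by the second fact. Conversely, let `∇ ∘ ℓ_F = 0` on `𝓔`. Since `∇ F`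
vanishes on `𝓔`, it equals `∑ v_s g_s`. The jet coordinates are differentiable along the curve
`τ ↦ ν⁻¹(θ, τ e_r)`, and its velocity is the sum of a vector tangent to `j(s)` and a vertical
one, so that the first two facts show that `∇ F` has derivative zero along it
(`IsCDiff.hasDerivAt_curve`). On the other hand this derivative is `g_r(θ)`, so that all `g_r`
vanish on `𝓔`, and `∇ - ∑ g_s D_s` is an operator with the same restriction to `𝓔` that annihilates
`F` (`IsCDiff.exists_apply_eq_zero`). Hence the operators on `𝓔` annihilating `ℓ_F` are precisely
the restrictions of operators annihilating `F`, and the claims about compatibility operators are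
reformulations of this.
-/

noncomputable section

namespace JetGeom

set_option linter.unusedSectionVars false

/-! ### Smooth germs in normed spaces -/

section Analysis

variable {X Y Z W' : Type*} [NormedAddCommGroup X] [NormedSpace ℝ X] [NormedAddCommGroup Y]
  [NormedSpace ℝ Y] [NormedAddCommGroup Z] [NormedSpace ℝ Z] [NormedAddCommGroup W']
  [NormedSpace ℝ W']

/-- `f` is smooth on a neighbourhood of `x`. This is stronger than `ContDiffAt ℝ ∞ f x`, which
allows the neighbourhood to shrink with the order of differentiability. -/
def SmoothNear (f : X → Y) (x : X) : Prop := ∀ᶠ y in 𝓝 x, ContDiffAt ℝ ∞ f y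

theorem SmoothNear.contDiffAt {f : X → Y} {x : X} (h : SmoothNear f x) : ContDiffAt ℝ ∞ f x :=
  h.self_of_nhds

theorem SmoothNear.eventually {f : X → Y} {x : X} (h : SmoothNear f x) :
    ∀ᶠ y in 𝓝 x, SmoothNear f y := eventually_eventually_nhds.2 h

theorem SmoothNear.of_contDiff {f : X → Y} (h : ContDiff ℝ ∞ f) (x : X) : SmoothNear f x :=
  Filter.Eventually.of_forall fun _ => h.contDiffAt

theorem SmoothNear.congr {f g : X → Y} {x : X} (h : SmoothNear f x) (hg : g =ᶠ[𝓝 x] f) :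
    SmoothNear g x := by
  filter_upwards [h, hg.eventuallyEq_nhds] with y hy hy'
  exact hy.congr_of_eventuallyEq hy'

theorem SmoothNear.comp {f : X → Y} {g : Y → Z} {x : X} (hg : SmoothNear g (f x))
    (hf : SmoothNear f x) : SmoothNear (fun y => g (f y)) x := by
  filter_upwards [hf, hf.contDiffAt.continuousAt.eventually hg] with y hy hy'
  exact ContDiffAt.comp y hy' hy

theorem SmoothNear.of_contDiffOn {f : X → Y} {s : Set X} (h : ContDiffOn ℝ ∞ f s) (hs : IsOpen s)
    {x : X} (hx : x ∈ s) : SmoothNear f x := by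
  filter_upwards [hs.mem_nhds hx] with y hy
  exact h.contDiffAt (hs.mem_nhds hy)

/-- A smooth germ is the germ of a globally smooth map. -/
theorem SmoothNear.exists_contDiff [FiniteDimensional ℝ X] {f : X → Y} {x : X}
    (h : SmoothNear f x) : ∃ g : X → Y, ContDiff ℝ ∞ g ∧ g =ᶠ[𝓝 x] f := by
  obtain ⟨r, hr, hb⟩ := Metric.eventually_nhds_iff_ball.1 h
  let b : ContDiffBump x := ⟨r / 3, r / 2, by positivity, by linarith⟩
  refine ⟨fun y => b y • f y, ?_, ?_⟩
  · rw [contDiff_iff_contDiffAt]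
    intro y
    by_cases hy : y ∈ Metric.ball x r
    · exact b.contDiffAt.smul (hb y hy)
    · refine (contDiffAt_const (c := (0 : Y))).congr_of_eventuallyEq ?_
      have : y ∉ tsupport b := by
        rw [b.tsupport_eq]
        intro h'
        refine hy (Metric.closedBall_subset_ball ?_ h')
        change r / 2 < r
        linarith
      filter_upwards [notMem_tsupport_iff_eventuallyEq.1 this] with z hz
      simp [hz]
  · filter_upwards [b.eventuallyEq_one] with y hy
    simp [hy]

theorem hasDerivAt_smul_of_eq_zero {a : ℝ → ℝ} {a' : ℝ} {b : ℝ → Y} {t : ℝ}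
    (ha : HasDerivAt a a' t) (h0 : a t = 0) (hb : ContinuousAt b t) :
    HasDerivAt (fun t => a t • b t) (a' • b t) t := by
  rw [hasDerivAt_iff_tendsto_slope] at ha ⊢
  have := ha.smul (hb.tendsto.mono_left nhdsWithin_le_nhds)
  refine this.congr fun u => ?_
  simp [slope_def_module, h0, smul_smul]

/-- The derivatives of order at most `k` of `f` vanish at `x`. -/
def Flat (k : ℕ) (f : X → Y) (x : X) : Prop := ∀ i ≤ k, iteratedFDeriv ℝ i f x = 0

theorem Flat.congr {k : ℕ} {f g : X → Y} {x : X} (h : Flat k f x) (hg : g =ᶠ[𝓝 x] f) :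
    Flat k g x := fun i hi => by
  rw [(hg.iteratedFDeriv ℝ i).self_of_nhds, h i hi]

theorem Flat.comp [FiniteDimensional ℝ X] [FiniteDimensional ℝ Y] {k : ℕ} {f : X → Y}
    {g : Y → Z} {x : X} (h : Flat k g (f x))
    (hg : SmoothNear g (f x)) (hf : SmoothNear f x) : Flat k (fun y => g (f y)) x := by
  obtain ⟨g', hg', hgg⟩ := hg.exists_contDiff
  obtain ⟨f', hf', hff⟩ := hf.exists_contDiff
  have hx : f' x = f x := hff.self_of_nhds
  have h' : Flat k g' (f x) := h.congr hgg
  have hc : Flat k (g' ∘ f') x := by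
    intro i hi
    set D : ℝ := 1 + ∑ j ∈ Finset.range (k + 1), ‖iteratedFDeriv ℝ j f' x‖ with hD
    have hD1 : 1 ≤ D := by
      have : 0 ≤ ∑ j ∈ Finset.range (k + 1), ‖iteratedFDeriv ℝ j f' x‖ := by positivity
      linarith
    have := norm_iteratedFDeriv_comp_le (n := i) hg' hf' (by exact_mod_cast le_top) x
      (C := 0) (D := D) (fun j hj => by rw [hx, h' j (hj.trans hi), norm_zero])
      (fun j hj hj' => by
        calc ‖iteratedFDeriv ℝ j f' x‖ ≤ D := by
              have : ‖iteratedFDeriv ℝ j f' x‖ ≤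
                  ∑ j ∈ Finset.range (k + 1), ‖iteratedFDeriv ℝ j f' x‖ :=
                Finset.single_le_sum (f := fun j => ‖iteratedFDeriv ℝ j f' x‖)
                  (fun _ _ => norm_nonneg _) (Finset.mem_range.2 (show j < k + 1 by omega))
              linarith
          _ ≤ D ^ j := le_self_pow₀ hD1 (by omega))
    simpa using this
  refine hc.congr ?_
  filter_upwards [hff, hf.contDiffAt.continuousAt.eventually hgg] with y hy hy'
  simp [hy, hy']

theorem Flat.bilin [FiniteDimensional ℝ X] (B : Y →L[ℝ] Z →L[ℝ] W') {k : ℕ} {f : X → Y}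
    {g : X → Z} {x : X} (h : Flat k f x) (hf : SmoothNear f x) (hg : SmoothNear g x) :
    Flat k (fun y => B (f y) (g y)) x := by
  obtain ⟨g', hg', hgg⟩ := hg.exists_contDiff
  obtain ⟨f', hf', hff⟩ := hf.exists_contDiff
  have h' : Flat k f' x := h.congr hff
  have hc : Flat k (fun y => B (f' y) (g' y)) x := by
    intro i hi
    have := B.norm_iteratedFDeriv_le_of_bilinear hf' hg' x (n := i) (by exact_mod_cast le_top)
    rw [Finset.sum_eq_zero, mul_zero] at this
    · simpa using this
    · intro j hj
      rw [h' j (by simp at hj; omega)]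
      simp
  refine hc.congr ?_
  filter_upwards [hff, hgg] with y hy hy'
  simp [hy, hy']

theorem Flat.isometry_comp {k : ℕ} {f : X → Y} {x : X} (h : Flat k f x) (L : Y ≃ₗᵢ[ℝ] Z) :
    Flat k (fun y => L (f y)) x := fun i hi => by
  rw [← norm_eq_zero]
  exact (L.norm_iteratedFDeriv_comp_left f x i).trans (by rw [h i hi, norm_zero])

theorem Flat.fderiv {k : ℕ} {f : X → Y} {x : X} (h : Flat (k + 1) f x) :
    Flat k (fderiv ℝ f) x := fun i hi => by
  rw [← norm_eq_zero, norm_iteratedFDeriv_fderiv, h (i + 1) (by omega), norm_zero]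

theorem Flat.iteratedFDeriv {f : X → Y} {x : X} (h : ∀ k, Flat k f x) (i k : ℕ) :
    Flat k (iteratedFDeriv ℝ i f) x := by
  induction i generalizing k with
  | zero => exact (h k).isometry_comp (continuousMultilinearCurryFin0 ℝ X Y).symm
  | succ i ih =>
    exact (ih (k + 1)).fderiv.isometry_comp
      (continuousMultilinearCurryLeftEquiv ℝ (fun _ : Fin (i + 1) => X) Y).symm

end Analysis

/-! ### Jets of maps between normed spaces -/

section JetSpaces

variable {E W Y : Type*} [NormedAddCommGroup E] [NormedSpace ℝ E] [FiniteDimensional ℝ E]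
  [NormedAddCommGroup W] [NormedSpace ℝ W] [NormedAddCommGroup Y] [NormedSpace ℝ Y]

/-- The derivative part of a jet of order `k` of a map `E → W`. -/
abbrev JetFib (E W : Type*) [NormedAddCommGroup E] [NormedSpace ℝ E] [NormedAddCommGroup W]
    [NormedSpace ℝ W] (k : ℕ) : Type _ :=
  (i : Fin (k + 1)) → ContinuousMultilinearMap ℝ (fun _ : Fin (i : ℕ) => E) W

/-- The space of jets of order `k` of maps `E → W`. -/
abbrev JetSp (E W : Type*) [NormedAddCommGroup E] [NormedSpace ℝ E] [NormedAddCommGroup W]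
    [NormedSpace ℝ W] (k : ℕ) : Type _ :=
  E × JetFib E W k

/-- The derivatives of order at most `k` of `g` at `z`. -/
def derivs (k : ℕ) (g : E → W) (z : E) : JetFib E W k := fun i => iteratedFDeriv ℝ i g z

/-- The jet of order `k` of `g` at `z`. -/
def jetAt (k : ℕ) (g : E → W) (z : E) : JetSp E W k := (z, derivs k g z)

/-- Jets of lower order are determined by those of higher order. -/
def truncJet {k l : ℕ} (h : k ≤ l) : JetSp E W l → JetSp E W k :=
  fun c => (c.1, fun i => c.2 (Fin.castLE (Nat.succ_le_succ h) i))

theorem contDiff_truncJet {k l : ℕ} (h : k ≤ l) :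
    ContDiff ℝ ∞ (truncJet h : JetSp E W l → JetSp E W k) := by
  unfold truncJet
  refine contDiff_fst.prodMk ?_
  rw [contDiff_pi]
  intro i
  exact (contDiff_pi.1 (contDiff_snd (𝕜 := ℝ)) (Fin.castLE (Nat.succ_le_succ h) i))

theorem truncJet_jetAt {k l : ℕ} (h : k ≤ l) (g : E → W) (z : E) :
    truncJet h (jetAt l g z) = jetAt k g z := rfl

instance finiteDimensional_multilinear [FiniteDimensional ℝ W] (i : ℕ) :
    FiniteDimensional ℝ (ContinuousMultilinearMap ℝ (fun _ : Fin i => E) W) :=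
  FiniteDimensional.of_injective
    ((ContinuousMultilinearMap.toMultilinearMapLinear :
      ContinuousMultilinearMap ℝ (fun _ : Fin i => E) W →ₗ[ℝ] _))
    ContinuousMultilinearMap.toMultilinearMap_injective

theorem derivs_congr {k : ℕ} {f g : E → W} {z : E} (h : f =ᶠ[𝓝 z] g) :
    derivs k f z = derivs k g z := funext fun i => (h.iteratedFDeriv ℝ i).self_of_nhds

theorem derivs_eq_zero_iff {k : ℕ} {f : E → W} {z : E} : derivs k f z = 0 ↔ Flat k f z := by
  constructor
  · intro h i hi
    exact congrFun h ⟨i, by omega⟩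
  · intro h
    exact funext fun i => h i (by omega)

theorem derivs_add {k : ℕ} {f g : E → W} {z : E} (hf : ContDiffAt ℝ ∞ f z)
    (hg : ContDiffAt ℝ ∞ g z) : derivs k (fun y => f y + g y) z = derivs k f z + derivs k g z :=
  funext fun i => iteratedFDeriv_add_apply (hf.of_le (by exact_mod_cast le_top))
    (hg.of_le (by exact_mod_cast le_top))

theorem derivs_smul {k : ℕ} {f : E → W} {z : E} (hf : ContDiffAt ℝ ∞ f z) (t : ℝ) :
    derivs k (fun y => t • f y) z = t • derivs k f z :=
  funext fun i => iteratedFDeriv_const_smul_apply (hf.of_le (by exact_mod_cast le_top))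

theorem derivs_sub {k : ℕ} {f g : E → W} {z : E} (hf : ContDiffAt ℝ ∞ f z)
    (hg : ContDiffAt ℝ ∞ g z) : derivs k (fun y => f y - g y) z = derivs k f z - derivs k g z := by
  have := derivs_add (k := k) hf (hg.const_smul (-1 : ℝ))
  have h2 := derivs_smul (k := k) hg (-1)
  simp only [h2] at this
  simpa [sub_eq_add_neg] using this

theorem derivs_sum {k : ℕ} {ι : Type*} (s : Finset ι) {f : ι → E → W} {z : E}
    (hf : ∀ b ∈ s, ContDiffAt ℝ ∞ (f b) z) :
    derivs k (fun y => ∑ b ∈ s, f b y) z = ∑ b ∈ s, derivs k (f b) z := by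
  classical
  induction s using Finset.induction_on with
  | empty => simp [derivs_eq_zero_iff, Flat]
  | insert b s hb ih =>
    simp only [Finset.sum_insert hb]
    rw [derivs_add (hf b (by simp)) (ContDiffAt.sum fun c hc => hf c (by simp [hc])),
      ih fun c hc => hf c (by simp [hc])]

theorem SmoothNear.derivs {g : E → W} {z : E} (h : SmoothNear g z) (k : ℕ) :
    SmoothNear (derivs k g) z := by
  filter_upwards [h] with y hy
  exact contDiffAt_pi.2 fun i => hy.iteratedFDeriv_right (by exact_mod_cast le_top)

/-! ### Total derivatives -/

/-- The first derivative at `z` of the jet of order `k` of a map, as a function of the jet of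
order `k + 1` at `z`. -/
def shiftJet (k : ℕ) (c : JetSp E W (k + 1)) : E →L[ℝ] JetSp E W k :=
  (ContinuousLinearMap.id ℝ E).prod (ContinuousLinearMap.pi fun i =>
    ContinuousMultilinearMap.curryLeft (c.2 i.succ))

theorem hasFDerivAt_jetAt {k : ℕ} {g : E → W} {z : E} (hg : ContDiffAt ℝ ∞ g z) :
    HasFDerivAt (jetAt k g) (shiftJet k (jetAt (k + 1) g z)) z := by
  refine (hasFDerivAt_id z).prodMk (hasFDerivAt_pi.2 fun i => ?_)
  have h1 : DifferentiableAt ℝ (iteratedFDeriv ℝ i g) z :=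
    (hg.iteratedFDeriv_right (m := 1) (by exact_mod_cast le_top)).differentiableAt (by simp)
  refine h1.hasFDerivAt.congr_fderiv ?_
  ext u m
  rfl

/-- The total derivative of a function of jets. -/
def totalD {k : ℕ} (H : JetSp E W k → Y) (c : JetSp E W (k + 1)) : E →L[ℝ] Y :=
  (fderiv ℝ H (truncJet (Nat.le_succ k) c)).comp (shiftJet k c)

theorem contDiff_totalD {k : ℕ} {H : JetSp E W k → Y} (hH : ContDiff ℝ ∞ H) :
    ContDiff ℝ ∞ (totalD H) := by
  rw [contDiff_clm_apply_iff]
  intro u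
  change ContDiff ℝ ∞ fun c : JetSp E W (k + 1) =>
    fderiv ℝ H (truncJet (Nat.le_succ k) c) (u, fun i => (c.2 i.succ).curryLeft u)
  refine ContDiff.clm_apply ((hH.fderiv_right (by simp)).comp (contDiff_truncJet _))
    (contDiff_const.prodMk (contDiff_pi.2 fun i => ?_))
  have : ContDiff ℝ ∞ fun c : JetSp E W (k + 1) => (continuousMultilinearCurryLeftEquiv ℝ
      (fun _ : Fin (i + 1) => E) W (c.2 i.succ)) :=
    (LinearIsometryEquiv.contDiff _).comp ((contDiff_pi.1 contDiff_snd) i.succ)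
  exact this.clm_apply contDiff_const

theorem fderiv_comp_jetAt {k : ℕ} {H : JetSp E W k → Y} (hH : ContDiff ℝ ∞ H) {g : E → W} {z : E}
    (hg : ContDiffAt ℝ ∞ g z) :
    fderiv ℝ (fun y => H (jetAt k g y)) z = totalD H (jetAt (k + 1) g z) :=
  (((hH.differentiable (by simp)) _).hasFDerivAt.comp z (hasFDerivAt_jetAt hg)).fderiv

/-- The derivatives of order `i`, in another coordinate system of the source, of a
function `H` of jets; `B` is the inverse of the Jacobian matrix of the new coordinates, so that the
new partial derivatives are the old total derivatives composed with `B`. -/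
def iterD {m : ℕ} (H : JetSp E W m → Y) (B : E → E →L[ℝ] E) :
    (i : ℕ) → JetSp E W (m + i) → ContinuousMultilinearMap ℝ (fun _ : Fin i => E) Y
  | 0 => fun c => (continuousMultilinearCurryFin0 ℝ E Y).symm (H c)
  | i + 1 => fun c => (continuousMultilinearCurryLeftEquiv ℝ (fun _ : Fin (i + 1) => E) Y).symm
      ((totalD (iterD H B i) c).comp (B c.1))

theorem contDiff_iterD {m : ℕ} {H : JetSp E W m → Y} {B : E → E →L[ℝ] E} (hH : ContDiff ℝ ∞ H)
    (hB : ContDiff ℝ ∞ B) (i : ℕ) : ContDiff ℝ ∞ (iterD H B i) := by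
  induction i with
  | zero => exact (LinearIsometryEquiv.contDiff _).comp hH
  | succ i ih =>
    exact (LinearIsometryEquiv.contDiff _).comp
      ((contDiff_totalD ih).clm_comp (hB.comp contDiff_fst))

/-- If, in the coordinates `σ`, the map `g'` is the function `H` of the jet of `g`, then the
derivatives of `g'` are smooth functions of the jet of `g`, the same ones for all `g`. -/
theorem iteratedFDeriv_eq_iterD {m : ℕ} {H : JetSp E W m → Y} {B : E → E →L[ℝ] E}
    (hH : ContDiff ℝ ∞ H) (hB : ContDiff ℝ ∞ B) {σ : E → E} {g : E → W} {g' : E → Y} {z : E}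
    (hσ : SmoothNear σ z) (hg : SmoothNear g z) (hg' : SmoothNear g' (σ z))
    (hH' : ∀ᶠ y in 𝓝 z, g' (σ y) = H (jetAt m g y))
    (hB' : ∀ᶠ y in 𝓝 z, (fderiv ℝ σ y).comp (B y) = ContinuousLinearMap.id ℝ E) (i : ℕ) :
    iteratedFDeriv ℝ i g' (σ z) = iterD H B i (jetAt (m + i) g z) := by
  induction i generalizing z with
  | zero =>
    rw [iteratedFDeriv_zero_eq_comp]
    simp only [Function.comp_apply, iterD, hH'.self_of_nhds]
    rfl
  | succ i ih =>
    have h1 : (fun y => iteratedFDeriv ℝ i g' (σ y)) =ᶠ[𝓝 z]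
        fun y => iterD H B i (jetAt (m + i) g y) := by
      filter_upwards [hσ.eventually, hg.eventually,
        hσ.contDiffAt.continuousAt.eventually hg'.eventually, hH'.eventually_nhds,
        hB'.eventually_nhds] with y h1 h2 h3 h4 h5
      exact ih h1 h2 h3 h4 h5
    have h2 := h1.fderiv_eq (𝕜 := ℝ)
    rw [fderiv_comp_jetAt (contDiff_iterD hH hB i) hg.contDiffAt] at h2
    have h3 : DifferentiableAt ℝ (iteratedFDeriv ℝ i g') (σ z) :=
      (hg'.contDiffAt.iteratedFDeriv_right (m := 1)
        (by exact_mod_cast le_top)).differentiableAt (by simp)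
    have h4 := (h3.hasFDerivAt.comp z
      (hσ.contDiffAt.differentiableAt (by simp)).hasFDerivAt).fderiv
    have h5 : (iteratedFDeriv ℝ i g') ∘ σ = fun y => iteratedFDeriv ℝ i g' (σ y) := rfl
    rw [h5, h2] at h4
    rw [iteratedFDeriv_succ_eq_comp_left]
    simp only [Function.comp_apply, iterD]
    congr 1
    change _ = (totalD (iterD H B i) (jetAt (m + i + 1) g z)).comp (B z)
    rw [h4, ContinuousLinearMap.comp_assoc, hB'.self_of_nhds, ContinuousLinearMap.comp_id]

/-! ### Derivatives in a parameter -/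

theorem parametric_iteratedFDeriv {Φ : ℝ × E → Y} (hΦ : ContDiff ℝ ∞ Φ) (i : ℕ) :
    (ContDiff ℝ ∞ fun q : ℝ × E => iteratedFDeriv ℝ i (fun z => Φ (q.1, z)) q.2) ∧
    ∀ q : ℝ × E,
      fderiv ℝ (fun q : ℝ × E => iteratedFDeriv ℝ i (fun z => Φ (q.1, z)) q.2) q (1, 0) =
      iteratedFDeriv ℝ i (fun z => fderiv ℝ Φ (q.1, z) (1, 0)) q.2 := by
  induction i with
  | zero =>
    have h0 : (fun q : ℝ × E => iteratedFDeriv ℝ 0 (fun z => Φ (q.1, z)) q.2) =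
        fun q => (continuousMultilinearCurryFin0 ℝ E Y).symm (Φ q) := rfl
    rw [h0]
    refine ⟨(LinearIsometryEquiv.contDiff _).comp hΦ, fun q => ?_⟩
    have := ((continuousMultilinearCurryFin0 ℝ E Y).symm.hasFDerivAt.comp q
      ((hΦ.differentiable (by simp)) q).hasFDerivAt).fderiv
    rw [show (fun q => (continuousMultilinearCurryFin0 ℝ E Y).symm (Φ q)) =
      (continuousMultilinearCurryFin0 ℝ E Y).symm ∘ Φ from rfl, this]
    rfl
  | succ i ih =>
    obtain ⟨h1, h2⟩ := ih
    set Ψ := fun q : ℝ × E => iteratedFDeriv ℝ i (fun z => Φ (q.1, z)) q.2 with hΨ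
    have hd : ∀ q, HasFDerivAt Ψ (fderiv ℝ Ψ q) q := fun q =>
      ((h1.differentiable (by simp)) q).hasFDerivAt
    have hslice : ∀ q : ℝ × E, HasFDerivAt (fun z : E => ((q.1, z) : ℝ × E))
        (ContinuousLinearMap.inr ℝ ℝ E) q.2 := fun q => hasFDerivAt_prodMk_right q.1 q.2
    have h3 : ∀ q : ℝ × E, fderiv ℝ (iteratedFDeriv ℝ i (fun z => Φ (q.1, z))) q.2 =
        (fderiv ℝ Ψ q).comp (ContinuousLinearMap.inr ℝ ℝ E) := fun q =>
      (HasFDerivAt.comp (g := Ψ) q.2 (hd q) (hslice q)).fderiv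
    let C := (continuousMultilinearCurryLeftEquiv ℝ (fun _ : Fin (i + 1) => E) Y).symm
    have h4 : (fun q : ℝ × E => iteratedFDeriv ℝ (i + 1) (fun z => Φ (q.1, z)) q.2) =
        fun q => C ((fderiv ℝ Ψ q).comp (ContinuousLinearMap.inr ℝ ℝ E)) := by
      funext q
      rw [iteratedFDeriv_succ_eq_comp_left, Function.comp_apply, h3 q]
    have h5 : ContDiff ℝ ∞ (fderiv ℝ Ψ) := h1.fderiv_right (by simp)
    rw [h4]
    refine ⟨(LinearIsometryEquiv.contDiff _).comp (h5.clm_comp contDiff_const), fun q => ?_⟩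
    have hd2 : HasFDerivAt (fderiv ℝ Ψ) (fderiv ℝ (fderiv ℝ Ψ) q) q :=
      ((h5.differentiable (by simp)) q).hasFDerivAt
    have h6 := (C.hasFDerivAt.comp q (hd2.clm_comp
      (hasFDerivAt_const (ContinuousLinearMap.inr ℝ ℝ E) q))).fderiv
    rw [show (fun q => C ((fderiv ℝ Ψ q).comp (ContinuousLinearMap.inr ℝ ℝ E))) =
      C ∘ fun q => (fderiv ℝ Ψ q).comp (ContinuousLinearMap.inr ℝ ℝ E) from rfl, h6,
      iteratedFDeriv_succ_eq_comp_left, Function.comp_apply]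
    have h7 : (iteratedFDeriv ℝ i fun z => fderiv ℝ Φ (q.1, z) (1, 0)) =
        fun z => fderiv ℝ Ψ (q.1, z) (1, 0) := by
      funext z
      exact (h2 (q.1, z)).symm
    rw [h7]
    let A : (ℝ × E →L[ℝ] ContinuousMultilinearMap ℝ (fun _ : Fin i => E) Y) →L[ℝ]
      ContinuousMultilinearMap ℝ (fun _ : Fin i => E) Y :=
        ContinuousLinearMap.apply ℝ _ ((1, 0) : ℝ × E)
    have h8 : HasFDerivAt (fun z => fderiv ℝ Ψ (q.1, z) (1, 0))
        (A.comp ((fderiv ℝ (fderiv ℝ Ψ) q).comp (ContinuousLinearMap.inr ℝ ℝ E))) q.2 :=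
      HasFDerivAt.comp (g := A) q.2 A.hasFDerivAt
        (HasFDerivAt.comp (g := fderiv ℝ Ψ) q.2 hd2 (hslice q))
    rw [h8.fderiv]
    have hsymm : IsSymmSndFDerivAt ℝ Ψ q :=
      (h1.contDiffAt.of_le (m := 2) ENat.LEInfty.out).isSymmSndFDerivAt (by simp)
    change C _ = C _
    congr 1
    ext1 u
    simpa [A] using hsymm.eq (1, 0) (0, u)

/-- Derivatives in `z` commute with the derivative in the parameter. -/
theorem hasDerivAt_derivs_param {Φ : ℝ × E → Y} {t : ℝ} {z : E} (hΦ : SmoothNear Φ (t, z))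
    (k : ℕ) :
    HasDerivAt (fun t => derivs k (fun y => Φ (t, y)) z)
      (derivs k (fun y => deriv (fun t => Φ (t, y)) t) z) t := by
  obtain ⟨Φ', hΦ', he⟩ := hΦ.exists_contDiff
  have hc : ∀ i : ℕ, HasDerivAt (fun t => iteratedFDeriv ℝ i (fun z => Φ' (t, z)) z)
      (iteratedFDeriv ℝ i (fun z => fderiv ℝ Φ' (t, z) (1, 0)) z) t := by
    intro i
    obtain ⟨h1, h2⟩ := parametric_iteratedFDeriv hΦ' i
    have h3 := ((h1.differentiable (by simp)) (t, z)).hasFDerivAt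
    have h4 := HasFDerivAt.comp_hasDerivAt t h3
      ((hasDerivAt_id t).prodMk (hasDerivAt_const t z))
    rw [h2 (t, z)] at h4
    exact h4
  have hz : ∀ᶠ y in 𝓝 z, ∀ᶠ s in 𝓝 t, Φ' (s, y) = Φ (s, y) := by
    have : ∀ᶠ q in 𝓝 z ×ˢ 𝓝 t, Φ' (q.2, q.1) = Φ (q.2, q.1) := by
      rw [← nhds_prod_eq]
      exact (continuous_swap.tendsto (z, t)).eventually he
    exact this.curry
  have ht : ∀ᶠ s in 𝓝 t, ∀ᶠ y in 𝓝 z, Φ' (s, y) = Φ (s, y) := by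
    have : ∀ᶠ q in 𝓝 t ×ˢ 𝓝 z, Φ' q = Φ q := by
      rw [← nhds_prod_eq]
      exact he
    exact this.curry
  refine hasDerivAt_pi.2 fun i => ?_
  have h5 : (fun y => deriv (fun t => Φ (t, y)) t) =ᶠ[𝓝 z] fun y => fderiv ℝ Φ' (t, y) (1, 0) := by
    filter_upwards [hz] with y hy
    rw [(show (fun t => Φ (t, y)) =ᶠ[𝓝 t] fun t => Φ' (t, y) from
      hy.mono fun s hs => hs.symm).deriv_eq]
    exact (HasFDerivAt.comp_hasDerivAt t ((hΦ'.differentiable (by simp)) (t, y)).hasFDerivAt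
      ((hasDerivAt_id t).prodMk (hasDerivAt_const t y))).deriv
  rw [derivs_congr h5]
  refine (hc i).congr_of_eventuallyEq ?_
  filter_upwards [ht] with s hs
  exact ((show (fun y => Φ (s, y)) =ᶠ[𝓝 z] fun y => Φ' (s, y) from
    hs.mono fun y hy => hy.symm).iteratedFDeriv ℝ i).self_of_nhds

end JetSpaces

/-! ### Frames of jets -/

section Frames

variable {E W Y : Type*} [NormedAddCommGroup E] [NormedSpace ℝ E] [FiniteDimensional ℝ E]
  [NormedAddCommGroup W] [NormedSpace ℝ W] [FiniteDimensional ℝ W]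
  [NormedAddCommGroup Y] [NormedSpace ℝ Y]

variable (E W) in
/-- The families of multilinear maps which are the derivatives of a smooth map. -/
def jetSub (k : ℕ) : Submodule ℝ (JetFib E W k) where
  carrier := {c | ∃ f : E → W, ContDiff ℝ ∞ f ∧ derivs k f 0 = c}
  zero_mem' := ⟨fun _ => 0, contDiff_const, derivs_eq_zero_iff.2 fun i _ => by simp⟩
  add_mem' := by
    rintro _ _ ⟨f, hf, rfl⟩ ⟨g, hg, rfl⟩
    exact ⟨fun y => f y + g y, hf.add hg, derivs_add hf.contDiffAt hg.contDiffAt⟩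
  smul_mem' := by
    rintro t _ ⟨f, hf, rfl⟩
    exact ⟨fun y => t • f y, contDiff_const.smul hf, derivs_smul hf.contDiffAt t⟩

theorem derivs_comp_add (k : ℕ) (f : E → W) (a z : E) :
    derivs k (fun y => f (y + a)) z = derivs k f (z + a) :=
  funext fun i => iteratedFDeriv_comp_add_right i a z

theorem derivs_mem_jetSub {k : ℕ} {f : E → W} {z : E} (hf : SmoothNear f z) :
    derivs k f z ∈ jetSub E W k := by
  obtain ⟨g, hg, hgf⟩ := hf.exists_contDiff
  refine ⟨fun y => g (y + z), hg.comp (contDiff_id.add contDiff_const), ?_⟩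
  rw [derivs_comp_add, zero_add, derivs_congr hgf]

theorem exists_of_mem_jetSub {k : ℕ} {c : JetFib E W k} (hc : c ∈ jetSub E W k) (z : E) :
    ∃ f : E → W, ContDiff ℝ ∞ f ∧ derivs k f z = c := by
  obtain ⟨f, hf, rfl⟩ := hc
  refine ⟨fun y => f (y + -z), hf.comp (contDiff_id.add contDiff_const), ?_⟩
  rw [derivs_comp_add, add_neg_cancel]

/-- A basis of a subspace that moves smoothly inside the subspace stays a basis for a while: the
linear maps sending the basis at `z` to the vectors at `y` are invertible for `y = z`, hence for
`y` near `z`. -/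
theorem exists_moving_coordinates {K : Type*} [NormedAddCommGroup K] [NormedSpace ℝ K]
    [FiniteDimensional ℝ K] (S : Submodule ℝ K) {m : ℕ} (e : Module.Basis (Fin m) ℝ S)
    (d : Fin m → E → K) (hd : ∀ b, ContDiff ℝ ∞ (d b)) (hdS : ∀ b y, d b y ∈ S) (z : E)
    (hdz : ∀ b, d b z = e b) :
    ∃ c : Fin m → E → (K →L[ℝ] ℝ), (∀ b, SmoothNear (c b) z) ∧
      ∀ᶠ y in 𝓝 z, ∀ v ∈ S, v = ∑ b, c b y v • d b y := by
  have : CompleteSpace S := FiniteDimensional.complete ℝ S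
  obtain ⟨P, hP⟩ := S.subtype.exists_leftInverse_of_injective
    (LinearMap.ker_eq_bot.2 S.injective_subtype)
  let P' : K →L[ℝ] S := LinearMap.toContinuousLinearMap P
  have hP' : ∀ s : S, P' s.1 = s := fun s => LinearMap.congr_fun hP s
  let co : ∀ b, S →L[ℝ] ℝ := fun b => LinearMap.toContinuousLinearMap (e.coord b)
  have hco : ∀ s : S, s = ∑ b, co b s • e b := fun s => (e.sum_repr s).symm
  let T : E → (S →L[ℝ] S) := fun y => ∑ b, (co b).smulRight (P' (d b y))
  have hT : ContDiff ℝ ∞ T := by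
    refine ContDiff.sum fun b _ => ?_
    exact ((ContinuousLinearMap.smulRightL ℝ S S (co b)).contDiff).comp
      (P'.contDiff.comp (hd b))
  have hTz : T z = 1 := by
    ext1 s
    change (∑ b, (co b).smulRight (P' (d b z))) s = s
    rw [sum_apply]
    conv_rhs => rw [hco s]
    refine Finset.sum_congr rfl fun b _ => ?_
    rw [ContinuousLinearMap.smulRight_apply, hdz, hP']
  have hunit : ∀ᶠ y in 𝓝 z, IsUnit (T y) := by
    refine hT.continuous.continuousAt.eventually ?_
    rw [hTz]
    exact (Units.isOpen (R := S →L[ℝ] S)).mem_nhds isUnit_one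
  refine ⟨fun b y => ((co b).comp (Ring.inverse (T y))).comp P', fun b => ?_, ?_⟩
  · filter_upwards [hunit] with y ⟨u, hu⟩
    have h1 : ContDiffAt ℝ ∞ (fun y => Ring.inverse (T y)) y := by
      refine ContDiffAt.comp (g := Ring.inverse) y ?_ hT.contDiffAt
      rw [← hu]
      exact contDiffAt_ringInverse (R := S →L[ℝ] S) ℝ u
    exact (contDiffAt_const.clm_comp h1).clm_comp contDiffAt_const
  · filter_upwards [hunit] with y hy v hv
    have h1 : T y (Ring.inverse (T y) ⟨v, hv⟩) = ⟨v, hv⟩ :=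
      congrArg (fun A : S →L[ℝ] S => A ⟨v, hv⟩) (Ring.mul_inverse_cancel _ hy)
    have h2 : T y (Ring.inverse (T y) ⟨v, hv⟩) =
        ∑ b, co b (Ring.inverse (T y) ⟨v, hv⟩) • P' (d b y) := by
      simp only [T, sum_apply, ContinuousLinearMap.smulRight_apply]
    have h4 : ∀ b, (P' (d b y)).1 = d b y := fun b =>
      congrArg Subtype.val (hP' ⟨_, hdS b y⟩)
    have h5 : P' v = ⟨v, hv⟩ := hP' ⟨v, hv⟩
    have h3 := congrArg Subtype.val (h1.symm.trans h2)
    simpa only [ContinuousLinearMap.comp_apply, h5, Submodule.coe_sum, Submodule.coe_smul, h4]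
      using h3

/-- Near `z` the jets of order `k` of all smooth maps are linear combinations of the jets of
finitely many smooth maps, with coefficients linear in the jet and smooth in the point. -/
theorem exists_jet_frame (k : ℕ) (z : E) :
    ∃ (m : ℕ) (f : Fin m → E → W) (c : Fin m → E → (JetFib E W k →L[ℝ] ℝ)),
      (∀ b, ContDiff ℝ ∞ (f b)) ∧ (∀ b, SmoothNear (c b) z) ∧
      ∀ᶠ y in 𝓝 z, ∀ g : E → W, SmoothNear g y →
        derivs k g y = ∑ b, c b y (derivs k g y) • derivs k (f b) y := by
  let e := Module.finBasis ℝ (jetSub E W k)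
  choose f hf hfe using fun b => exists_of_mem_jetSub (e b).2 z
  obtain ⟨c, hc, hcy⟩ := exists_moving_coordinates (jetSub E W k) e (fun b => derivs k (f b))
    (fun b => contDiff_pi.2 fun i => (hf b).iteratedFDeriv_right (by exact_mod_cast le_top))
    (fun b y => derivs_mem_jetSub (Filter.Eventually.of_forall fun _ => (hf b).contDiffAt)) z hfe
  refine ⟨_, f, c, hf, hc, ?_⟩
  filter_upwards [hcy] with y hy g hg
  exact hy _ (derivs_mem_jetSub hg)

end Frames

/-! ### Division by coordinates -/

section Hadamard

universe u

theorem hasFDerivAt_integral_param {X Y : Type u} [NormedAddCommGroup X] [NormedSpace ℝ X]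
    [FiniteDimensional ℝ X] [NormedAddCommGroup Y] [NormedSpace ℝ Y] [CompleteSpace Y]
    {A : ℝ × X → Y} (hA : ContDiff ℝ 1 A) (x : X) :
    HasFDerivAt (fun x => ∫ t in (0 : ℝ)..1, A (t, x))
      (∫ t in (0 : ℝ)..1, (fderiv ℝ A (t, x)).comp (ContinuousLinearMap.inr ℝ ℝ X)) x := by
  have hc : Continuous fun q : ℝ × X =>
      (fderiv ℝ A q).comp (ContinuousLinearMap.inr ℝ ℝ X) :=
    (hA.continuous_fderiv (by simp)).clm_comp continuous_const
  obtain ⟨C, hC⟩ := (isCompact_Icc (a := (0 : ℝ)) (b := 1)).prod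
    (isCompact_closedBall x 1) |>.exists_bound_of_continuousOn hc.continuousOn
  refine intervalIntegral.hasFDerivAt_integral_of_dominated_of_fderiv_le
    (F := fun x t => A (t, x))
    (F' := fun x t => (fderiv ℝ A (t, x)).comp (ContinuousLinearMap.inr ℝ ℝ X))
    (bound := fun _ => C) (Metric.closedBall_mem_nhds x one_pos) ?_ ?_ ?_ ?_ ?_ ?_
  · exact Filter.Eventually.of_forall fun y =>
      (hA.continuous.comp (by fun_prop : Continuous fun t : ℝ => (t, y))).aestronglyMeasurable
  · exact (hA.continuous.comp
      (by fun_prop : Continuous fun t : ℝ => (t, x))).intervalIntegrable _ _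
  · exact (hc.comp (by fun_prop : Continuous fun t : ℝ => (t, x))).aestronglyMeasurable
  · refine Filter.Eventually.of_forall fun t ht y hy => hC (t, y) ⟨?_, hy⟩
    rw [Set.uIoc_of_le zero_le_one] at ht
    exact ⟨ht.1.le, ht.2⟩
  · exact intervalIntegrable_const
  · refine Filter.Eventually.of_forall fun t _ y _ => ?_
    exact HasFDerivAt.comp (g := A) y ((hA.differentiable (by simp)) (t, y)).hasFDerivAt
      (hasFDerivAt_prodMk_right t y)

theorem contDiff_integral_param {X Y : Type u} [NormedAddCommGroup X] [NormedSpace ℝ X]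
    [FiniteDimensional ℝ X] [NormedAddCommGroup Y] [NormedSpace ℝ Y] [CompleteSpace Y]
    {A : ℝ × X → Y} (hA : ContDiff ℝ ∞ A) :
    ContDiff ℝ ∞ fun x => ∫ t in (0 : ℝ)..1, A (t, x) := by
  rw [contDiff_infty]
  intro m
  induction m generalizing Y with
  | zero =>
    exact contDiff_zero.2 (continuous_iff_continuousAt.2 fun x =>
      (hasFDerivAt_integral_param (hA.of_le (by exact_mod_cast le_top)) x).continuousAt)
  | succ m ih =>
    have h := fun x => hasFDerivAt_integral_param (hA.of_le (by exact_mod_cast le_top)) x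
    push_cast
    rw [contDiff_succ_iff_fderiv]
    refine ⟨fun x => (h x).differentiableAt, by simp, ?_⟩
    rw [show fderiv ℝ (fun x => ∫ t in (0 : ℝ)..1, A (t, x)) = _ from funext fun x =>
      (h x).fderiv]
    exact ih ((hA.fderiv_right (by simp)).clm_comp contDiff_const)

/-- A function `g` which near each point of a compact set `K` is a smooth function of the
coordinates `κ` is a smooth function of `κ` on a neighbourhood of `K`. -/
theorem exists_contDiff_near_compact {Q : Type*} {X : Type u} [NormedAddCommGroup X]
    [NormedSpace ℝ X] [FiniteDimensional ℝ X] (κ : Q → X) (g : Q → ℝ) {K : Set X}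
    (hK : IsCompact K)
    (h : ∀ x ∈ K, ∃ O ∈ 𝓝 x, ∃ G : X → ℝ, ContDiff ℝ ∞ G ∧ ∀ q, κ q ∈ O → g q = G (κ q)) :
    ∃ G : X → ℝ, ContDiff ℝ ∞ G ∧ ∃ O, IsOpen O ∧ K ⊆ O ∧ ∀ q, κ q ∈ O → g q = G (κ q) := by
  choose! N hN G hG hg using h
  obtain ⟨δ, hδ, hsub⟩ := hK.exists_cthickening_subset_open
    (t := ⋃ x ∈ K, interior (N x)) (isOpen_biUnion fun _ _ => isOpen_interior)
    (fun x hx => Set.mem_biUnion hx (mem_interior_iff_mem_nhds.2 (hN x hx)))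
  -- the condition that `y` is a possible value of `G` at `x` is convex, so that local solutions
  -- can be glued
  let t : X → Set ℝ := fun x => {y | x ∈ Metric.cthickening δ K → ∀ q, κ q = x → g q = y}
  have ht : ∀ x, Convex ℝ (t x) := by
    intro x y hy z hz a b _ _ hab hx q hq
    rw [← hy hx q hq, ← hz hx q hq, ← add_smul, hab, one_smul]
  obtain ⟨G', hG'⟩ := exists_contMDiffMap_forall_mem_convex_of_local 𝓘(ℝ, X) (n := (⊤ : ℕ∞)) ht
    (by
      intro x
      by_cases hx : x ∈ Metric.cthickening δ K
      · obtain ⟨x', hx', hxN⟩ := Set.mem_iUnion₂.1 (hsub hx)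
        refine ⟨_, isOpen_interior.mem_nhds hxN, G x', (hG x' hx').contMDiff.contMDiffOn, ?_⟩
        intro y hy _ q hq
        rw [← hq] at hy ⊢
        exact hg x' hx' q (interior_subset hy)
      · refine ⟨_, Metric.isClosed_cthickening.isOpen_compl.mem_nhds hx, fun _ => 0,
          contMDiffOn_const, fun y hy hy' => absurd hy' hy⟩)
  refine ⟨G', G'.contMDiff.contDiff, Metric.thickening δ K, Metric.isOpen_thickening,
    Metric.self_subset_thickening hδ K, fun q hq => ?_⟩
  exact hG' _ (Metric.thickening_subset_cthickening _ _ hq) q rfl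

/-- The fundamental theorem of calculus along a ray, for a function of `c` and `v`. -/
theorem sub_eq_sum_integral {C : Type u} {T : Type*} [Fintype T] [DecidableEq T]
    [NormedAddCommGroup C] [NormedSpace ℝ C] {G : C × (T → ℝ) → ℝ} (hG : ContDiff ℝ ∞ G) (c : C)
    (v : T → ℝ) :
    G (c, v) - G (c, 0) =
      ∑ s, v s * ∫ t in (0 : ℝ)..1, fderiv ℝ G (c, t • v) (0, Pi.single s 1) := by
  have hd : ∀ t : ℝ, HasDerivAt (fun t : ℝ => G (c, t • v)) (fderiv ℝ G (c, t • v) (0, v)) t := by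
    intro t
    have h1 : HasDerivAt (fun t : ℝ => ((c, t • v) : C × (T → ℝ))) (0, v) t := by
      simpa using (hasDerivAt_const t c).prodMk ((hasDerivAt_id t).smul_const v)
    exact HasFDerivAt.comp_hasDerivAt t
      ((hG.differentiable (by simp)) (c, t • v)).hasFDerivAt h1
  have hcont : ∀ u : C × (T → ℝ), Continuous fun t : ℝ => fderiv ℝ G (c, t • v) u := fun u =>
    (((hG.continuous_fderiv (by simp)).comp
      (by fun_prop : Continuous fun t : ℝ => ((c, t • v) : C × (T → ℝ)))).clm_apply
        continuous_const)
  have h2 := intervalIntegral.integral_eq_sub_of_hasDerivAt (a := 0) (b := 1) (fun t _ => hd t)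
    ((hcont _).intervalIntegrable _ _)
  simp only [one_smul, zero_smul] at h2
  rw [← h2]
  have h3 : ∀ t : ℝ, fderiv ℝ G (c, t • v) (0, v) =
      ∑ s, v s * fderiv ℝ G (c, t • v) (0, Pi.single s 1) := by
    intro t
    have : ((0 : C), v) = ∑ s, v s • ((0 : C), (Pi.single s 1 : T → ℝ)) := by
      ext1
      · simp [Prod.fst_sum]
      · simp only [Prod.snd_sum, Prod.smul_mk]
        exact pi_eq_sum_univ' v
    conv_lhs => rw [this]
    rw [map_sum]
    exact Finset.sum_congr rfl fun s _ => map_smul _ _ _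
  simp only [h3]
  rw [intervalIntegral.integral_finsetSum fun s _ =>
    ((hcont _).const_mul _ |>.intervalIntegrable _ _)]
  simp

end Hadamard

/-! ### Local representatives of sections -/

section Charts

variable {n : ℕ} {M : Type*} [TopologicalSpace M] [ChartedSpace (EuclideanSpace ℝ (Fin n)) M]

/-- The domain around `p` on which both the preferred chart and the preferred trivialization
are defined. -/
def Dom (α : VBundle n M) (p : M) : Set M :=
  (chartAt (EuclideanSpace ℝ (Fin n)) p).source ∩ (trivializationAt α.Model α.Fib p).baseSet

theorem isOpen_dom (α : VBundle n M) (p : M) : IsOpen (Dom α p) :=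
  (chartAt _ p).open_source.inter (trivializationAt α.Model α.Fib p).open_baseSet

theorem mem_dom (α : VBundle n M) (p : M) : p ∈ Dom α p :=
  ⟨mem_chart_source _ p, FiberBundle.mem_baseSet_trivializationAt' p⟩

theorem dom_mem_nhds (α : VBundle n M) (p : M) : Dom α p ∈ 𝓝 p :=
  (isOpen_dom α p).mem_nhds (mem_dom α p)

/-- The vector in the fibre over `x` with given coordinates in the trivialization around `p`
(zero if `x` is outside of its domain). -/
def trivSymm (α : VBundle n M) (p x : M) : α.Model →ₗ[ℝ] α.Fib x :=
  (trivializationAt α.Model α.Fib p).symmₗ ℝ x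

variable {α : VBundle n M} {p q x y : M}

theorem triv_trivSymm (hy : y ∈ (trivializationAt α.Model α.Fib p).baseSet) (b : α.Model) :
    triv α p y (trivSymm α p y b) = b :=
  (trivializationAt α.Model α.Fib p).linearMapAt_symmₗ hy b

theorem trivSymm_triv (hy : y ∈ (trivializationAt α.Model α.Fib p).baseSet) (v : α.Fib y) :
    trivSymm α p y (triv α p y v) = v :=
  (trivializationAt α.Model α.Fib p).symmₗ_linearMapAt hy v

theorem triv_injective (hy : y ∈ (trivializationAt α.Model α.Fib p).baseSet) :
    Function.Injective (triv α p y) :=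
  Function.LeftInverse.injective (trivSymm_triv hy)

theorem triv_eq (hy : y ∈ (trivializationAt α.Model α.Fib p).baseSet) (v : α.Fib y) :
    triv α p y v = ((trivializationAt α.Model α.Fib p) ⟨y, v⟩).2 := by
  rw [triv, Bundle.Trivialization.linearMapAt_apply, if_pos hy]

theorem triv_lineBundle (p x : M) (v : ℝ) : triv (lineBundle n M) p x v = v := by
  refine (triv_eq ?_ _).trans ?_
  · exact Set.mem_univ _
  · rfl

/-- The change of coordinates in the fibres from the trivialization around `p` to the one
around `q`. It is meaningful only over points where both are defined. -/
def fibChange (α : VBundle n M) (p q y : M) : α.Model →L[ℝ] α.Model :=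
  ((trivializationAt α.Model α.Fib p).coordChangeL ℝ (trivializationAt α.Model α.Fib q) y :
    α.Model →L[ℝ] α.Model)

theorem fibChange_triv (hp : y ∈ (trivializationAt α.Model α.Fib p).baseSet)
    (hq : y ∈ (trivializationAt α.Model α.Fib q).baseSet) (v : α.Fib y) :
    fibChange α p q y (triv α p y v) = triv α q y v := by
  have h1 := (trivializationAt α.Model α.Fib p).coordChangeL_apply (R := ℝ)
    (trivializationAt α.Model α.Fib q) ⟨hp, hq⟩ (triv α p y v)
  refine h1.trans ?_
  rw [triv_eq hq]
  congr 3
  exact (congrFun ((trivializationAt α.Model α.Fib p).coe_symmₗ (R := ℝ) hp) _).symm.trans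
    (trivSymm_triv hp v)

variable [IsManifold 𝓘(ℝ, EuclideanSpace ℝ (Fin n)) ∞ M]

/-- Smooth maps on an open subset of the manifold are smooth in the charts. -/
theorem smoothNear_comp_chart_symm {Y : Type*} [NormedAddCommGroup Y] [NormedSpace ℝ Y] {f : M → Y}
    {O : Set M} (hO : IsOpen O)
    (hf : ContMDiffOn 𝓘(ℝ, EuclideanSpace ℝ (Fin n)) 𝓘(ℝ, Y) ∞ f O)
    (hy : y ∈ O) (hp : y ∈ (chartAt (EuclideanSpace ℝ (Fin n)) p).source) :
    SmoothNear (fun z => f ((chartAt (EuclideanSpace ℝ (Fin n)) p).symm z))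
      (chartAt (EuclideanSpace ℝ (Fin n)) p y) := by
  set χ := chartAt (EuclideanSpace ℝ (Fin n)) p
  have h1 : ContMDiffOn 𝓘(ℝ, EuclideanSpace ℝ (Fin n)) 𝓘(ℝ, Y) ∞ (f ∘ χ.symm)
      (χ.target ∩ χ.symm ⁻¹' O) :=
    hf.comp (contMDiffOn_chart_symm.mono Set.inter_subset_left) Set.inter_subset_right
  refine SmoothNear.of_contDiffOn (contMDiffOn_iff_contDiffOn.1 h1)
    (χ.isOpen_inter_preimage_symm hO) ⟨χ.map_source hp, ?_⟩
  simpa [χ.left_inv hp] using hy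

/-- Maps that are smooth in a chart are smooth on the manifold. -/
theorem contMDiffAt_comp_chart {Y : Type*} [NormedAddCommGroup Y] [NormedSpace ℝ Y]
    {g : EuclideanSpace ℝ (Fin n) → Y} (hg : ContDiff ℝ ∞ g)
    (hp : y ∈ (chartAt (EuclideanSpace ℝ (Fin n)) p).source) :
    ContMDiffAt 𝓘(ℝ, EuclideanSpace ℝ (Fin n)) 𝓘(ℝ, Y) ∞
      (fun y => g (chartAt (EuclideanSpace ℝ (Fin n)) p y)) y :=
  hg.contMDiff.contMDiffAt.comp y
    (contMDiffOn_chart.contMDiffAt ((chartAt _ p).open_source.mem_nhds hp))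

theorem contMDiffOn_triv (s : Sec α) (p : M) :
    ContMDiffOn 𝓘(ℝ, EuclideanSpace ℝ (Fin n)) 𝓘(ℝ, α.Model) ∞ (fun y => triv α p y (s y))
      (trivializationAt α.Model α.Fib p).baseSet := by
  have h := ((trivializationAt α.Model α.Fib p).contMDiffOn_section_baseSet_iff
    (IB := 𝓘(ℝ, EuclideanSpace ℝ (Fin n))) (n := ∞) (s := fun y => s y)).1
    s.contMDiff.contMDiffOn
  exact h.congr fun y hy => triv_eq hy _

theorem smoothNear_localRep (s : Sec α) (hy : y ∈ Dom α p) :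
    SmoothNear (localRep α p s) (chartAt (EuclideanSpace ℝ (Fin n)) p y) :=
  smoothNear_comp_chart_symm (trivializationAt α.Model α.Fib p).open_baseSet
    (contMDiffOn_triv s p) hy.2 hy.1

theorem smoothNear_chart_change
    (hp : y ∈ (chartAt (EuclideanSpace ℝ (Fin n)) p).source)
    (hq : y ∈ (chartAt (EuclideanSpace ℝ (Fin n)) q).source) :
    SmoothNear (fun z => chartAt (EuclideanSpace ℝ (Fin n)) q
        ((chartAt (EuclideanSpace ℝ (Fin n)) p).symm z))
      (chartAt (EuclideanSpace ℝ (Fin n)) p y) :=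
  smoothNear_comp_chart_symm (chartAt _ q).open_source contMDiffOn_chart hq hp

theorem smoothNear_fibChange (hp : y ∈ Dom α p) (hq : y ∈ Dom α q) :
    SmoothNear (fun z => fibChange α p q ((chartAt (EuclideanSpace ℝ (Fin n)) p).symm z))
      (chartAt (EuclideanSpace ℝ (Fin n)) p y) :=
  smoothNear_comp_chart_symm ((trivializationAt α.Model α.Fib p).open_baseSet.inter
    (trivializationAt α.Model α.Fib q).open_baseSet)
    (contMDiffOn_coordChangeL (trivializationAt α.Model α.Fib p)
      (trivializationAt α.Model α.Fib q)) ⟨hp.2, hq.2⟩ hp.1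

theorem eventually_chart_symm {P : M → Prop}
    (hp : y ∈ (chartAt (EuclideanSpace ℝ (Fin n)) p).source) (h : ∀ᶠ y in 𝓝 y, P y) :
    ∀ᶠ z in 𝓝 (chartAt (EuclideanSpace ℝ (Fin n)) p y),
      P ((chartAt (EuclideanSpace ℝ (Fin n)) p).symm z) :=
  ((chartAt _ p).tendsto_symm hp).eventually h

theorem eventually_chart {P : EuclideanSpace ℝ (Fin n) → Prop}
    (hp : y ∈ (chartAt (EuclideanSpace ℝ (Fin n)) p).source)
    (h : ∀ᶠ z in 𝓝 (chartAt (EuclideanSpace ℝ (Fin n)) p y), P z) :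
    ∀ᶠ y in 𝓝 y, P (chartAt (EuclideanSpace ℝ (Fin n)) p y) :=
  ((chartAt _ p).continuousAt hp).eventually h

/-- The transformation law of local representatives, in the source coordinates. -/
theorem localRep_change (hp : y ∈ Dom α p) (hq : y ∈ Dom α q) :
    ∀ᶠ z in 𝓝 (chartAt (EuclideanSpace ℝ (Fin n)) p y), ∀ s : ∀ x, α.Fib x,
      localRep α q s (chartAt (EuclideanSpace ℝ (Fin n)) q
        ((chartAt (EuclideanSpace ℝ (Fin n)) p).symm z)) =
      fibChange α p q ((chartAt (EuclideanSpace ℝ (Fin n)) p).symm z) (localRep α p s z) := by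
  filter_upwards [eventually_chart_symm hp.1 ((isOpen_dom α p).mem_nhds hp),
    eventually_chart_symm hp.1 ((isOpen_dom α q).mem_nhds hq)] with z h1 h2 s
  unfold localRep
  rw [fibChange_triv h1.2 h2.2, (chartAt _ q).left_inv h2.1]

/-- The transformation law of local representatives, in the target coordinates. -/
theorem localRep_change' (hp : y ∈ Dom α p) (hq : y ∈ Dom α q) :
    ∀ᶠ z in 𝓝 (chartAt (EuclideanSpace ℝ (Fin n)) q y), ∀ s : ∀ x, α.Fib x,
      localRep α q s z = fibChange α p q ((chartAt (EuclideanSpace ℝ (Fin n)) q).symm z)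
        (localRep α p s (chartAt (EuclideanSpace ℝ (Fin n)) p
          ((chartAt (EuclideanSpace ℝ (Fin n)) q).symm z))) := by
  filter_upwards [eventually_chart_symm hq.1 ((isOpen_dom α p).mem_nhds hp),
    eventually_chart_symm hq.1 ((isOpen_dom α q).mem_nhds hq)] with z h1 h2 s
  unfold localRep
  rw [(chartAt _ p).left_inv h1.1, fibChange_triv h1.2 h2.2]

theorem smoothNear_fibChange' (hp : y ∈ Dom α p) (hq : y ∈ Dom α q) :
    SmoothNear (fun z => fibChange α p q ((chartAt (EuclideanSpace ℝ (Fin n)) q).symm z))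
      (chartAt (EuclideanSpace ℝ (Fin n)) q y) :=
  smoothNear_comp_chart_symm ((trivializationAt α.Model α.Fib p).open_baseSet.inter
    (trivializationAt α.Model α.Fib q).open_baseSet)
    (contMDiffOn_coordChangeL (trivializationAt α.Model α.Fib p)
      (trivializationAt α.Model α.Fib q)) ⟨hp.2, hq.2⟩ hq.1

theorem SmoothNear.localRep_change {s : ∀ x, α.Fib x} (hp : y ∈ Dom α p) (hq : y ∈ Dom α q)
    (hs : SmoothNear (localRep α p s) (chartAt (EuclideanSpace ℝ (Fin n)) p y)) :
    SmoothNear (localRep α q s) (chartAt (EuclideanSpace ℝ (Fin n)) q y) := by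
  refine SmoothNear.congr (f := fun z =>
    fibChange α p q ((chartAt (EuclideanSpace ℝ (Fin n)) q).symm z)
        (localRep α p s (chartAt (EuclideanSpace ℝ (Fin n)) p
          ((chartAt (EuclideanSpace ℝ (Fin n)) q).symm z)))) ?_
    ((localRep_change' hp hq).mono fun z hz => hz s)
  have h1 : SmoothNear (fun z => localRep α p s (chartAt (EuclideanSpace ℝ (Fin n)) p
      ((chartAt (EuclideanSpace ℝ (Fin n)) q).symm z)))
      (chartAt (EuclideanSpace ℝ (Fin n)) q y) :=
    SmoothNear.comp (g := localRep α p s) (by rwa [(chartAt _ q).left_inv hq.1])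
      (smoothNear_chart_change hq.1 hp.1)
  filter_upwards [h1, smoothNear_fibChange' hp hq] with z h1 h2
  exact h2.clm_apply h1

theorem Flat.localRep_change {s : ∀ x, α.Fib x} {k : ℕ} (hp : y ∈ Dom α p) (hq : y ∈ Dom α q)
    (hs : SmoothNear (localRep α p s) (chartAt (EuclideanSpace ℝ (Fin n)) p y))
    (h : Flat k (localRep α p s) (chartAt (EuclideanSpace ℝ (Fin n)) p y)) :
    Flat k (localRep α q s) (chartAt (EuclideanSpace ℝ (Fin n)) q y) := by
  have e := (chartAt (EuclideanSpace ℝ (Fin n)) q).left_inv hq.1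
  have h0 : SmoothNear (localRep α p s) (chartAt (EuclideanSpace ℝ (Fin n)) p
      ((chartAt (EuclideanSpace ℝ (Fin n)) q).symm (chartAt (EuclideanSpace ℝ (Fin n)) q y))) := by
    rwa [e]
  refine Flat.congr ?_ ((localRep_change' hp hq).mono fun z hz => hz s)
  exact Flat.bilin (ContinuousLinearMap.id ℝ (α.Model →L[ℝ] α.Model)).flip
    (f := fun z => localRep α p s (chartAt (EuclideanSpace ℝ (Fin n)) p
      ((chartAt (EuclideanSpace ℝ (Fin n)) q).symm z)))
    (Flat.comp (g := localRep α p s) (by rwa [e]) h0 (smoothNear_chart_change hq.1 hp.1))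
    (SmoothNear.comp (g := localRep α p s) h0 (smoothNear_chart_change hq.1 hp.1))
    (smoothNear_fibChange' hp hq)

theorem localRep_add (p : M) (s t : ∀ x, α.Fib x) :
    localRep α p (fun x => s x + t x) = fun z => localRep α p s z + localRep α p t z :=
  funext fun _ => map_add _ _ _

theorem localRep_smul (p : M) (c : ℝ) (s : ∀ x, α.Fib x) :
    localRep α p (fun x => c • s x) = fun z => c • localRep α p s z :=
  funext fun _ => map_smul _ _ _

theorem localRep_sub (p : M) (s t : ∀ x, α.Fib x) :
    localRep α p (fun x => s x - t x) = fun z => localRep α p s z - localRep α p t z :=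
  funext fun _ => map_sub _ _ _

/-- The coordinates of the jet of `s` around any `p` are the derivatives of `s`: they do not
depend on the section chosen to represent the jet. -/
theorem coord_jet {π : VBundle n M} (k : ℕ) (s : Sec π) (hy : y ∈ Dom π p) :
    coord p k (jet s y) =
      jetAt k (localRep π p s) (chartAt (EuclideanSpace ℝ (Fin n)) p y) := by
  let s' : Sec π := Quotient.out (jet s y).cls
  have h1 : ∀ i : ℕ, derivRep π y i (fun z => s' z) y = derivRep π y i (fun z => s z) y := by
    have : (jetSetoid π y) s' s := Quotient.mk_out (s := jetSetoid π y) s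
    exact fun i => congrFun this i
  have hd := mem_dom π y
  have h2 : Flat k (localRep π y (fun x => s' x - s x))
      (chartAt (EuclideanSpace ℝ (Fin n)) y y) := by
    rw [← derivs_eq_zero_iff, localRep_sub, derivs_sub
      (smoothNear_localRep s' hd).contDiffAt (smoothNear_localRep s hd).contDiffAt, sub_eq_zero]
    exact funext fun i => h1 i
  have h3 : SmoothNear (localRep π y (fun x => s' x - s x))
      (chartAt (EuclideanSpace ℝ (Fin n)) y y) := by
    rw [localRep_sub]
    filter_upwards [smoothNear_localRep s' hd, smoothNear_localRep s hd] with z h1 h2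
    exact h1.sub h2
  have h4 := Flat.localRep_change hd hy h3 h2
  rw [← derivs_eq_zero_iff, localRep_sub, derivs_sub
      (smoothNear_localRep s' hy).contDiffAt (smoothNear_localRep s hy).contDiffAt,
      sub_eq_zero] at h4
  exact Prod.ext rfl h4

theorem exists_eq_jet {π : VBundle n M} (θ : Jet π) : ∃ s : Sec π, jet s θ.base = θ := by
  obtain ⟨x, c⟩ := θ
  induction c using Quotient.inductionOn with
  | h s => exact ⟨s, rfl⟩

theorem exists_jet_eq {π : VBundle n M} (θ : Jet π) : ∃ (s : Sec π) (x : M), jet s x = θ :=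
  (exists_eq_jet θ).imp fun _ hs => ⟨_, hs⟩

/-! ### Extension of local sections -/

variable [T2Space M]

theorem exists_bump {O : Set M} (hO : O ∈ 𝓝 x) :
    ∃ f : M → ℝ, ContMDiff 𝓘(ℝ, EuclideanSpace ℝ (Fin n)) 𝓘(ℝ) ∞ f ∧ tsupport f ⊆ O ∧
      ∀ᶠ y in 𝓝 x, f y = 1 := by
  obtain ⟨f, -, hf⟩ := (SmoothBumpFunction.nhds_basis_tsupport
    (I := 𝓘(ℝ, EuclideanSpace ℝ (Fin n))) x).mem_iff.1 hO
  exact ⟨f, f.contMDiff, hf, f.eventuallyEq_one⟩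

/-- A model-valued function with support inside a trivializing set gives a section. -/
theorem exists_sec_of_tsupport (c : M) {h : M → α.Model}
    (hh : ContMDiff 𝓘(ℝ, EuclideanSpace ℝ (Fin n)) 𝓘(ℝ, α.Model) ∞ h)
    (hs : tsupport h ⊆ (trivializationAt α.Model α.Fib c).baseSet) :
    ∃ s : Sec α, ∀ y, s y = trivSymm α c y (h y) := by
  refine ⟨⟨fun y => trivSymm α c y (h y), fun y => ?_⟩, fun _ => rfl⟩
  by_cases hy : y ∈ (trivializationAt α.Model α.Fib c).baseSet
  · refine ((trivializationAt α.Model α.Fib c).contMDiffAt_section_iff hy).2 ?_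
    refine (hh y).congr_of_eventuallyEq ?_
    filter_upwards [(trivializationAt α.Model α.Fib c).open_baseSet.mem_nhds hy] with z hz
    rw [← triv_eq hz, triv_trivSymm hz]
  · have h0 := notMem_tsupport_iff_eventuallyEq.1 fun h' => hy (hs h')
    refine (Bundle.contMDiff_zeroSection ℝ α.Fib (IB := 𝓘(ℝ, EuclideanSpace ℝ (Fin n)))
      (n := ∞) (F := α.Model) y).congr_of_eventuallyEq ?_
    filter_upwards [h0] with z hz
    simp only [hz, Pi.zero_apply, map_zero]
    rfl

/-- Every smooth germ is the local representative of a global section. -/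
theorem exists_sec_localRep {g : EuclideanSpace ℝ (Fin n) → α.Model} (hg : ContDiff ℝ ∞ g)
    (hx : x ∈ Dom α p) :
    ∃ s : Sec α, ∀ᶠ y in 𝓝 x,
      triv α p y (s y) = g (chartAt (EuclideanSpace ℝ (Fin n)) p y) := by
  obtain ⟨f, hf, hfs, hf1⟩ := exists_bump (n := n) ((isOpen_dom α p).mem_nhds hx)
  have hsub : tsupport (fun y => f y • g (chartAt (EuclideanSpace ℝ (Fin n)) p y)) ⊆ tsupport f :=
    closure_mono (Function.support_smul_subset_left _ _)
  obtain ⟨s, hs⟩ := exists_sec_of_tsupport (α := α) p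
    (h := fun y => f y • g (chartAt (EuclideanSpace ℝ (Fin n)) p y))
    (contMDiff_of_tsupport fun y hy => (hf y).smul
      (contMDiffAt_comp_chart hg (hfs (hsub hy)).1))
    ((hsub.trans hfs).trans Set.inter_subset_right)
  refine ⟨s, ?_⟩
  filter_upwards [hf1, (isOpen_dom α p).mem_nhds hx] with y hy hyd
  rw [hs, triv_trivSymm hyd.2, hy, one_smul]

theorem exists_sec_localRep' {g : EuclideanSpace ℝ (Fin n) → α.Model} (hg : ContDiff ℝ ∞ g)
    (hx : x ∈ Dom α p) :
    ∃ s : Sec α, localRep α p s =ᶠ[𝓝 (chartAt (EuclideanSpace ℝ (Fin n)) p x)] g := by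
  obtain ⟨s, hs⟩ := exists_sec_localRep hg hx
  refine ⟨s, ?_⟩
  filter_upwards [eventually_chart_symm hx.1 hs,
    (chartAt (EuclideanSpace ℝ (Fin n)) p).open_target.mem_nhds
      ((chartAt (EuclideanSpace ℝ (Fin n)) p).map_source hx.1)] with z hz hzt
  rw [localRep, hz, (chartAt _ p).right_inv hzt]

/-- A section which is smooth near a point coincides there with a global section. -/
theorem exists_sec_eventuallyEq {s : ∀ x, α.Fib x} (hx : x ∈ Dom α p)
    (hs : SmoothNear (localRep α p s) (chartAt (EuclideanSpace ℝ (Fin n)) p x)) :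
    ∃ w : Sec α, ∀ᶠ y in 𝓝 x, w y = s y := by
  obtain ⟨g, hg, hgs⟩ := hs.exists_contDiff
  obtain ⟨w, hw⟩ := exists_sec_localRep hg hx
  refine ⟨w, ?_⟩
  filter_upwards [hw, eventually_chart hx.1 hgs, (isOpen_dom α p).mem_nhds hx] with y h1 h2 h3
  refine triv_injective h3.2 ?_
  rw [h1, h2, localRep, (chartAt _ p).left_inv h3.1]

end Charts

/-! ### Horizontal modules along families of sections -/

section Families

variable {n : ℕ} {M : Type*} [TopologicalSpace M] [ChartedSpace (EuclideanSpace ℝ (Fin n)) M]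
  [IsManifold 𝓘(ℝ, EuclideanSpace ℝ (Fin n)) ∞ M]
  {π α β : VBundle n M} {U : Set (Jet π)} {x y p : M}

theorem coord_jet_add_smul (k : ℕ) (s w : Sec π) (t : ℝ) (hy : y ∈ Dom π p) :
    coord p k (jet (s + t • w) y) =
      (chartAt (EuclideanSpace ℝ (Fin n)) p y,
        derivs k (localRep π p s) (chartAt (EuclideanSpace ℝ (Fin n)) p y) +
          t • derivs k (localRep π p w) (chartAt (EuclideanSpace ℝ (Fin n)) p y)) := by
  rw [coord_jet k _ hy, jetAt]
  congr 1
  rw [← derivs_smul (smoothNear_localRep w hy).contDiffAt,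
    ← derivs_add (smoothNear_localRep s hy).contDiffAt
      ((smoothNear_localRep w hy).contDiffAt.const_smul t)]
  congr 1
  exact (localRep_add p s (fun x => t • w x)).trans (by rw [localRep_smul])

theorem near_self (k : ℕ) {ε : ℝ} (hε : 0 < ε) (θ : Jet π) : Near k ε θ θ :=
  ⟨mem_chart_source _ _, by rwa [dist_self]⟩

/-- The coordinates of the jets of the sections `s + t w` are continuous in `t` and the point. -/
theorem eventually_near {k : ℕ} {ε : ℝ} {θ₀ : Jet π} (s w : Sec π)
    (h : Near k ε θ₀ (jet s y)) (hy : y ∈ Dom π θ₀.base) :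
    ∀ᶠ q : ℝ × M in 𝓝 (0, y), Near k ε θ₀ (jet (s + q.1 • w) q.2) := by
  set χ := chartAt (EuclideanSpace ℝ (Fin n)) θ₀.base with hχ
  have hc : ContinuousAt (fun q : ℝ × M => ((χ q.2,
      derivs k (localRep π θ₀.base s) (χ q.2) +
          q.1 • derivs k (localRep π θ₀.base w) (χ q.2)) : Coord π k)) (0, y) := by
    have h1 : ContinuousAt (fun q : ℝ × M => χ q.2) (0, y) :=
      ContinuousAt.comp (g := χ) (χ.continuousAt hy.1) continuousAt_snd
    have h2 : ∀ v : Sec π, ContinuousAt (fun q : ℝ × M =>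
        derivs k (localRep π θ₀.base v) (χ q.2)) (0, y) := fun v =>
      ContinuousAt.comp (g := derivs k (localRep π θ₀.base v))
        (((smoothNear_localRep v hy).derivs k).contDiffAt.continuousAt) h1
    exact h1.prodMk ((h2 s).add (continuousAt_fst.smul (h2 w)))
  have hd : ∀ᶠ q : ℝ × M in 𝓝 (0, y), q.2 ∈ Dom π θ₀.base :=
    continuousAt_snd.eventually ((isOpen_dom π θ₀.base).mem_nhds hy)
  have h0 := h.2
  rw [coord_jet k s hy] at h0
  have hlt := (hc.dist (continuousAt_const (y := coord θ₀.base k θ₀))).eventually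
    (eventually_lt_nhds (b := ε) (by simpa [jetAt] using h0))
  filter_upwards [hd, hlt] with q hq hq'
  refine ⟨hq.1, ?_⟩
  rw [coord_jet_add_smul k s w q.1 hq]
  exact hq'

theorem eventually_mem (hU : IsOpenJet U) (s w : Sec π) (h : jet s x ∈ U) :
    ∀ᶠ q : ℝ × M in 𝓝 (0, x), jet (s + q.1 • w) q.2 ∈ U := by
  obtain ⟨k, ε, hε, hk⟩ := hU _ h
  filter_upwards [eventually_near s w (near_self k hε (jet s x)) (mem_dom π x)] with q hq
  exact hk _ hq

theorem eventually_mem_jet (hU : IsOpenJet U) (s : Sec π) (h : jet s x ∈ U) :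
    ∀ᶠ y in 𝓝 x, jet s y ∈ U := by
  have h1 := (Continuous.tendsto (by fun_prop : Continuous fun y : M => ((0 : ℝ), y))
    x).eventually (eventually_mem hU s 0 h)
  filter_upwards [h1] with y hy
  simpa using hy

theorem eventually_mem_param (hU : IsOpenJet U) (s w : Sec π) (h : jet s x ∈ U) :
    ∀ᶠ t in 𝓝 (0 : ℝ), jet (s + t • w) x ∈ U :=
  (Continuous.tendsto (by fun_prop : Continuous fun t : ℝ => (t, x))
    0).eventually (eventually_mem hU s w h)

theorem exists_near_base {O : Set M} {θ₀ : Jet π} (hO : O ∈ 𝓝 θ₀.base) :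
    ∃ ε > 0, ∀ (k : ℕ) (θ : Jet π), Near k ε θ₀ θ → θ.base ∈ O := by
  have h1 := eventually_chart_symm (n := n) (mem_chart_source _ θ₀.base) hO
  obtain ⟨ε, hε, h⟩ := Metric.eventually_nhds_iff.1 h1
  refine ⟨ε, hε, fun k θ hθ => ?_⟩
  have h2 := h (y := chartAt (EuclideanSpace ℝ (Fin n)) θ₀.base θ.base)
    ((le_max_left _ _).trans_lt hθ.2)
  rwa [(chartAt _ θ₀.base).left_inv hθ.1] at h2

theorem localRep_self (s : ∀ x, α.Fib x) (hy : y ∈ Dom α p) :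
    localRep α p s (chartAt (EuclideanSpace ℝ (Fin n)) p y) = triv α p y (s y) := by
  rw [localRep, (chartAt _ p).left_inv hy.1]

/-- Elements of horizontal modules are smooth along families of sections. -/
theorem smoothNear_pullback_param (hU : IsOpenJet U) (φ : HSec U α) (s w : Sec π)
    (h : jet s x ∈ U) :
    SmoothNear (fun q : ℝ × EuclideanSpace ℝ (Fin n) =>
      localRep α x (pullback φ (s + q.1 • w)) q.2)
      (0, chartAt (EuclideanSpace ℝ (Fin n)) x x) := by
  obtain ⟨k, hk⟩ := φ.2.1
  obtain ⟨ε, hε, G, hG, hφ⟩ := hk _ h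
  set χ := chartAt (EuclideanSpace ℝ (Fin n)) x with hχ
  have hx := mem_dom π x
  have h1 : SmoothNear (fun q : ℝ × EuclideanSpace ℝ (Fin n) => G (q.2,
      derivs k (localRep π x s) q.2 + q.1 • derivs k (localRep π x w) q.2)) (0, χ x) := by
    have h2 : ∀ v : Sec π, SmoothNear (fun q : ℝ × EuclideanSpace ℝ (Fin n) =>
        derivs k (localRep π x v) q.2) (0, χ x) := fun v =>
      SmoothNear.comp (g := derivs k (localRep π x v)) ((smoothNear_localRep v hx).derivs k)
        (SmoothNear.of_contDiff contDiff_snd _)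
    filter_upwards [h2 s, h2 w] with q hs hw
    exact hG.contDiffAt.comp q
      (contDiffAt_snd.prodMk (hs.add (contDiffAt_fst.smul hw)))
  refine h1.congr ?_
  have hsymm : ∀ᶠ q : ℝ × EuclideanSpace ℝ (Fin n) in 𝓝 (0, χ x), ∀ᶠ _u in 𝓝 q,
      (Near k ε (jet s x) (jet (s + q.1 • w) (χ.symm q.2)) ∧
      jet (s + q.1 • w) (χ.symm q.2) ∈ U ∧ χ.symm q.2 ∈ Dom π x) ∧ q.2 ∈ χ.target := by
    simp only [Filter.eventually_const]
    have ht : Filter.Tendsto (fun q : ℝ × EuclideanSpace ℝ (Fin n) => (q.1, χ.symm q.2))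
        (𝓝 (0, χ x)) (𝓝 (0, x)) := by
      rw [nhds_prod_eq, nhds_prod_eq]
      exact Filter.tendsto_id.prodMap (χ.tendsto_symm hx.1)
    have h3 := ht.eventually ((eventually_near s w (near_self k hε (jet s x)) hx).and
      ((eventually_mem hU s w h).and (continuousAt_snd.eventually (dom_mem_nhds π x))))
    exact h3.and (continuousAt_snd.eventually (χ.open_target.mem_nhds (χ.map_source hx.1)))
  filter_upwards [hsymm] with q hq
  obtain ⟨⟨h3, h4, h5⟩, h6⟩ := hq.self_of_nhds
  have := hφ _ h4 h3
  refine this.trans ?_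
  congr 1
  rw [show (jet s x).base = x from rfl, coord_jet_add_smul k s w q.1 h5, ← hχ, χ.right_inv h6]

theorem smoothNear_pullback (hU : IsOpenJet U) (φ : HSec U α) (s : Sec π) (h : jet s x ∈ U) :
    SmoothNear (localRep α x (pullback φ s)) (chartAt (EuclideanSpace ℝ (Fin n)) x x) := by
  have h1 := SmoothNear.comp (x := chartAt (EuclideanSpace ℝ (Fin n)) x x)
    (f := fun z => ((0 : ℝ), z)) (smoothNear_pullback_param hU φ s 0 h)
    (SmoothNear.of_contDiff (contDiff_const.prodMk contDiff_id) _)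
  simpa using h1

theorem smoothNear_pullback' (hU : IsOpenJet U) (φ : HSec U α) (s : Sec π) (h : jet s y ∈ U)
    (hy : y ∈ Dom α p) :
    SmoothNear (localRep α p (pullback φ s)) (chartAt (EuclideanSpace ℝ (Fin n)) p y) :=
  (smoothNear_pullback hU φ s h).localRep_change (mem_dom α y) hy

theorem continuousAt_pullback_param (hU : IsOpenJet U) (φ : HSec U α) (s w : Sec π)
    (h : jet s x ∈ U) :
    ContinuousAt (fun t : ℝ => triv α x x (pullback φ (s + t • w) x)) 0 := by
  have h1 := (smoothNear_pullback_param hU φ s w h).contDiffAt.continuousAt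
  have h2 : ContinuousAt (fun t : ℝ => (t, chartAt (EuclideanSpace ℝ (Fin n)) x x)) 0 := by
    fun_prop
  have h3 := ContinuousAt.comp (f := fun t : ℝ => (t, chartAt (EuclideanSpace ℝ (Fin n)) x x))
    h1 h2
  refine h3.congr (Filter.Eventually.of_forall fun t => ?_)
  exact localRep_self _ (mem_dom α x)

/-! ### The linearization -/

variable [T2Space M]

theorem exists_sec_eq_pullback (hU : IsOpenJet U) (φ : HSec U α) (s : Sec π) (h : jet s x ∈ U) :
    ∃ w : Sec α, ∀ᶠ y in 𝓝 x, w y = pullback φ s y :=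
  exists_sec_eventuallyEq (mem_dom α x) (smoothNear_pullback hU φ s h)

/-- In coordinates the linearization of `G(u, u', …)` along `w` is
`∂G/∂u · w + ∂G/∂u' · w' + …`. -/
theorem hasDerivAt_family {F : HSec U α} {k : ℕ} {ε : ℝ} {θ₀ : Jet π} {G : Coord π k → α.Model}
    (hU : IsOpenJet U) (hG : ContDiff ℝ ∞ G)
    (hF : ∀ θ ∈ U, Near k ε θ₀ θ → triv α θ₀.base θ.base (F.1 θ) = G (coord θ₀.base k θ))
    (s w : Sec π) (hyU : jet s y ∈ U) (hN : Near k ε θ₀ (jet s y)) (hy : y ∈ Dom π θ₀.base) :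
    HasDerivAt (fun t : ℝ => triv α θ₀.base y (pullback F (s + t • w) y))
      (fderiv ℝ G (coord θ₀.base k (jet s y))
        (0, derivs k (localRep π θ₀.base w)
          (chartAt (EuclideanSpace ℝ (Fin n)) θ₀.base y))) 0 := by
  set χ := chartAt (EuclideanSpace ℝ (Fin n)) θ₀.base
  have h1 : HasDerivAt (fun t : ℝ => ((χ y, derivs k (localRep π θ₀.base s) (χ y) +
      t • derivs k (localRep π θ₀.base w) (χ y)) : Coord π k))
      (0, derivs k (localRep π θ₀.base w) (χ y)) 0 := by
    refine (hasDerivAt_const _ _).prodMk ?_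
    simpa using ((hasDerivAt_id (0 : ℝ)).smul_const
      (derivs k (localRep π θ₀.base w) (χ y))).const_add (derivs k (localRep π θ₀.base s) (χ y))
  have h2 : coord θ₀.base k (jet s y) = (χ y, derivs k (localRep π θ₀.base s) (χ y) +
      (0 : ℝ) • derivs k (localRep π θ₀.base w) (χ y)) := by
    rw [coord_jet k s hy, zero_smul, add_zero]
    rfl
  rw [h2]
  refine (HasFDerivAt.comp_hasDerivAt (0 : ℝ)
    ((hG.differentiable (by simp)) _).hasFDerivAt h1).congr_of_eventuallyEq ?_
  have ht : Filter.Tendsto (fun t : ℝ => (t, y)) (𝓝 0) (𝓝 (0, y)) :=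
    Continuous.tendsto (by fun_prop) _
  filter_upwards [ht.eventually (eventually_near s w hN hy),
    ht.eventually (eventually_mem hU s w hyU)] with t h3 h4
  refine (hF _ h4 h3).trans ?_
  rw [coord_jet_add_smul k s w t hy]
  rfl

/-- The linearization of a section of order `k` along one of order `m` is of order `k + m`. -/
theorem exists_linearization_formula (hU : IsOpenJet U) (F : HSec U α) (φ : HSec U π) :
    ∃ l : ℕ, ∀ θ₀ ∈ U, ∃ ε > 0, ∃ G : Coord π l → α.Model, ContDiff ℝ ∞ G ∧
      ∀ (s w : Sec π) (y : M), jet s y ∈ U → Near l ε θ₀ (jet s y) →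
        (∀ᶠ z in 𝓝 y, w z = pullback φ s z) →
        y ∈ Dom α θ₀.base ∧
        HasDerivAt (fun t : ℝ => triv α θ₀.base y (pullback F (s + t • w) y))
          (G (coord θ₀.base l (jet s y))) 0 := by
  obtain ⟨k, hk⟩ := F.2.1
  obtain ⟨m, hm⟩ := φ.2.1
  refine ⟨k + m, fun θ₀ h₀ => ?_⟩
  obtain ⟨ε, hε, G, hG, hF⟩ := hk θ₀ h₀
  obtain ⟨δ, hδ, H, hH, hφ⟩ := hm θ₀ h₀
  obtain ⟨η, hη, hdom⟩ := exists_near_base (θ₀ := θ₀)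
    (Filter.inter_mem (dom_mem_nhds π θ₀.base) (dom_mem_nhds α θ₀.base))
  -- no change of coordinates is made here: `iterD H B` are the total derivatives of `H`
  let B : EuclideanSpace ℝ (Fin n) → EuclideanSpace ℝ (Fin n) →L[ℝ] EuclideanSpace ℝ (Fin n) :=
    fun _ => ContinuousLinearMap.id ℝ _
  have hB : ContDiff ℝ ∞ B := contDiff_const
  let D : Coord π (k + m) → JetFib (EuclideanSpace ℝ (Fin n)) π.Model k :=
    fun c i => iterD H B i (truncJet (by omega) c)
  have hD : ContDiff ℝ ∞ D := contDiff_pi.2 fun i =>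
    (contDiff_iterD hH hB i).comp (contDiff_truncJet _)
  refine ⟨min η (min ε δ), lt_min hη (lt_min hε hδ),
    fun c => fderiv ℝ G (truncJet (Nat.le_add_right k m) c) (0, D c), ?_, ?_⟩
  · exact ((hG.fderiv_right (by simp)).comp (contDiff_truncJet _)).clm_apply
      (contDiff_const.prodMk hD)
  · intro s w y hyU hN hw
    obtain ⟨hy, hyα⟩ := hdom _ _ (hN.mono le_rfl (min_le_left _ _))
    refine ⟨hyα, ?_⟩
    have hNk : Near k ε θ₀ (jet s y) :=
      hN.mono (Nat.le_add_right k m) ((min_le_right _ _).trans (min_le_left _ _))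
    have hNm : Near m δ θ₀ (jet s y) :=
      hN.mono (Nat.le_add_left m k) ((min_le_right _ _).trans (min_le_right _ _))
    have h1 := hasDerivAt_family hU hG hF s w hyU hNk hy
    refine h1.congr_deriv ?_
    have h2 : coord θ₀.base k (jet s y) =
        truncJet (Nat.le_add_right k m) (coord θ₀.base (k + m) (jet s y)) := rfl
    rw [h2]
    congr 2
    funext i
    change iteratedFDeriv ℝ i (localRep π θ₀.base w) _ = iterD H B i (truncJet _ _)
    rw [coord_jet (y := y) _ s hy, truncJet_jetAt]
    refine iteratedFDeriv_eq_iterD hH hB (σ := fun z => z)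
      (SmoothNear.of_contDiff contDiff_id _) (smoothNear_localRep s hy)
      (smoothNear_localRep w hy) ?_ ?_ i
    · have hev : ∀ᶠ z in 𝓝 y, Near m δ θ₀ (jet s z) := by
        have := (Continuous.tendsto (by fun_prop : Continuous fun z : M => ((0 : ℝ), z))
          y).eventually (eventually_near s 0 hNm hy)
        simpa using this
      filter_upwards [eventually_chart_symm hy.1 (hw.and (hev.and
        ((eventually_mem_jet hU s hyU).and ((isOpen_dom π θ₀.base).mem_nhds hy)))),
        (chartAt _ θ₀.base).open_target.mem_nhds ((chartAt _ θ₀.base).map_source hy.1)]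
        with z ⟨h3, h4, h5, h6⟩ h7
      have h8 := hφ _ h5 h4
      rw [coord_jet m s h6, (chartAt _ θ₀.base).right_inv h7] at h8
      rw [← h8, localRep, h3]
      rfl
    · exact Filter.Eventually.of_forall fun z => by
        rw [show (fun z : EuclideanSpace ℝ (Fin n) => z) = id from rfl, fderiv_id]
        rfl

/-- A derivative in the fibre computed in one trivialization can be computed in another. -/
theorem HasDerivAt.triv_change {f : ℝ → α.Fib y} {q : M} {v : α.Fib y} {t : ℝ}
    (hp : y ∈ Dom α p) (hq : y ∈ Dom α q)
    (h : HasDerivAt (fun t => triv α p y (f t)) (triv α p y v) t) :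
    HasDerivAt (fun t => triv α q y (f t)) (triv α q y v) t := by
  have h1 := (fibChange α p q y).hasFDerivAt.comp_hasDerivAt t h
  rw [fibChange_triv hp.2 hq.2] at h1
  refine h1.congr_of_eventuallyEq (Filter.Eventually.of_forall fun u => ?_)
  exact (fibChange_triv hp.2 hq.2 _).symm

theorem exists_isLinearization (hU : IsOpenJet U) (F : HSec U α) (φ : HSec U π) :
    ∃ P : HSec U α, IsLinearization F φ P := by
  classical
  obtain ⟨l, hl⟩ := exists_linearization_formula hU F φ
  choose S hS using fun θ : Jet π => exists_eq_jet θ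
  have hW : ∀ θ : Jet π, ∃ w : Sec π, θ ∈ U →
      ∀ᶠ y in 𝓝 θ.base, w y = pullback φ (S θ) y := by
    intro θ
    by_cases h : θ ∈ U
    · obtain ⟨w, hw⟩ := exists_sec_eq_pullback (x := θ.base) hU φ (S θ) (by rwa [hS])
      exact ⟨w, fun _ => hw⟩
    · exact ⟨0, fun h' => absurd h' h⟩
  choose W hW using hW
  let P : ∀ θ : Jet π, α.Fib θ.base := fun θ => if θ ∈ U then
    trivSymm α θ.base θ.base
      (deriv (fun t : ℝ => triv α θ.base θ.base (pullback F (S θ + t • W θ) θ.base)) 0) else 0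
  -- in every trivialization, `P` is the derivative of `F` along the chosen family
  have hP : ∀ θ ∈ U, ∀ (p : M) (v : α.Model), θ.base ∈ Dom α p →
      HasDerivAt (fun t : ℝ => triv α p θ.base (pullback F (S θ + t • W θ) θ.base)) v 0 →
      triv α p θ.base (P θ) = v := by
    intro θ hθ p v hp h
    have hb := mem_dom α θ.base
    have h1 : HasDerivAt (fun t : ℝ => triv α p θ.base (pullback F (S θ + t • W θ) θ.base))
        (triv α p θ.base (trivSymm α p θ.base v)) 0 := by rwa [triv_trivSymm hp.2]
    have h2 := (HasDerivAt.triv_change hp hb h1).deriv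
    simp only [P, if_pos hθ]
    rw [h2, trivSymm_triv hb.2, triv_trivSymm hp.2]
  have hPform : ∀ θ₀ ∈ U, ∃ ε > 0, ∃ G : Coord π l → α.Model, ContDiff ℝ ∞ G ∧
      (∀ θ ∈ U, Near l ε θ₀ θ → triv α θ₀.base θ.base (P θ) = G (coord θ₀.base l θ)) ∧
      ∀ (s w : Sec π) (y : M), jet s y ∈ U → Near l ε θ₀ (jet s y) →
        (∀ᶠ z in 𝓝 y, w z = pullback φ s z) →
        HasDerivAt (fun t : ℝ => triv α θ₀.base y (pullback F (s + t • w) y))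
          (G (coord θ₀.base l (jet s y))) 0 := by
    intro θ₀ h₀
    obtain ⟨ε, hε, G, hG, h⟩ := hl θ₀ h₀
    refine ⟨ε, hε, G, hG, fun θ hθ hN => ?_, fun s w y h1 h2 h3 => (h s w y h1 h2 h3).2⟩
    have h1 := h (S θ) (W θ) θ.base (by rwa [hS]) (by rwa [hS]) (hW θ hθ)
    rw [hS] at h1
    exact hP θ hθ _ _ h1.1 h1.2
  refine ⟨⟨P, ⟨l, fun θ₀ h₀ => ?_⟩, fun θ hθ => if_neg hθ⟩, fun s w x hx hw => ?_⟩
  · obtain ⟨ε, hε, G, hG, h, -⟩ := hPform θ₀ h₀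
    exact ⟨ε, hε, G, hG, h⟩
  · obtain ⟨ε, hε, G, hG, h1, h2⟩ := hPform (jet s x) hx
    have h3 := h1 _ hx (near_self l hε _)
    have h4 := h2 s w x hx (near_self l hε _) hw
    rw [← h3] at h4
    exact h4

theorem IsLinearization.unique (hU : IsOpenJet U) {F : HSec U α} {φ : HSec U π} {P Q : HSec U α}
    (hP : IsLinearization F φ P) (hQ : IsLinearization F φ Q) : P = Q := by
  refine Subtype.ext (funext fun θ => ?_)
  by_cases h : θ ∈ U
  · obtain ⟨s, x, rfl⟩ := exists_jet_eq θ
    obtain ⟨w, hw⟩ := exists_sec_eq_pullback hU φ s h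
    exact triv_injective (mem_dom α x).2 ((hP s w _ h hw).unique (hQ s w _ h hw))
  · rw [P.2.2 θ h, Q.2.2 θ h]

theorem isLinearization_lin (hU : IsOpenJet U) (F : HSec U α) (φ : HSec U π) :
    IsLinearization F φ (lin F φ) :=
  Classical.epsilon_spec (exists_isLinearization hU F φ)

theorem isLinearization_iff (hU : IsOpenJet U) (F : HSec U α) (φ : HSec U π) (P : HSec U α) :
    IsLinearization F φ P ↔ P = lin F φ :=
  ⟨fun h => h.unique hU (isLinearization_lin hU F φ), fun h => h ▸ isLinearization_lin hU F φ⟩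

end Families

/-! ### Operations on horizontal modules -/

section Operators

variable {n : ℕ} {M : Type*} [TopologicalSpace M] [ChartedSpace (EuclideanSpace ℝ (Fin n)) M]
  [IsManifold 𝓘(ℝ, EuclideanSpace ℝ (Fin n)) ∞ M]
  {π α β : VBundle n M} {U : Set (Jet π)} {x y p : M}

theorem exists_near_chart {P : EuclideanSpace ℝ (Fin n) → Prop} {θ₀ : Jet π}
    (h : ∀ᶠ z in 𝓝 (chartAt (EuclideanSpace ℝ (Fin n)) θ₀.base θ₀.base), P z) :
    ∃ ε > 0, ∀ (k : ℕ) (θ : Jet π), Near k ε θ₀ θ →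
      P (chartAt (EuclideanSpace ℝ (Fin n)) θ₀.base θ.base) := by
  obtain ⟨ε, hε, h⟩ := Metric.eventually_nhds_iff.1 h
  exact ⟨ε, hε, fun k θ hθ => h ((le_max_left _ _).trans_lt hθ.2)⟩

theorem SmoothOrd.congr {k : ℕ} {φ ψ : ∀ θ : Jet π, α.Fib θ.base} (h : SmoothOrd α U k φ)
    (hψ : ∀ θ ∈ U, ψ θ = φ θ) : SmoothOrd α U k ψ := by
  intro θ₀ h₀
  obtain ⟨ε, hε, G, hG, hφ⟩ := h θ₀ h₀
  exact ⟨ε, hε, G, hG, fun θ hθ hN => by rw [hψ θ hθ, hφ θ hθ hN]⟩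

theorem SmoothOrd.smul {k : ℕ} {f : Jet π → ℝ} {φ : ∀ θ : Jet π, α.Fib θ.base}
    (hf : SmoothOrd (lineBundle n M) U k f) (hφ : SmoothOrd α U k φ) :
    SmoothOrd α U k (fun θ => f θ • φ θ) := by
  intro θ₀ h₀
  obtain ⟨ε, hε, G, hG, hφ⟩ := hφ θ₀ h₀
  obtain ⟨δ, hδ, H', hH', hf⟩ := hf θ₀ h₀
  let H : Coord π k → ℝ := H'
  have hH : ContDiff ℝ ∞ H := hH'
  refine ⟨min ε δ, lt_min hε hδ, fun c => H c • G c, hH.smul hG, fun θ hθ hN => ?_⟩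
  have h1 := hf θ hθ (hN.mono le_rfl (min_le_right _ _))
  rw [triv_lineBundle] at h1
  rw [map_smul, hφ θ hθ (hN.mono le_rfl (min_le_left _ _))]
  exact congrArg (fun r : ℝ => r • G (coord θ₀.base k θ)) h1

theorem SmoothOrd.of_sec (σ : Sec α) (U : Set (Jet π)) :
    SmoothOrd α U 0 (fun θ : Jet π => σ θ.base) := by
  intro θ₀ h₀
  obtain ⟨g, hg, hgs⟩ := (smoothNear_localRep σ (mem_dom α θ₀.base)).exists_contDiff
  obtain ⟨ε, hε, h⟩ := exists_near_chart hgs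
  refine ⟨ε, hε, fun c => g c.1, hg.comp contDiff_fst, fun θ hθ hN => ?_⟩
  change _ = g (chartAt (EuclideanSpace ℝ (Fin n)) θ₀.base θ.base)
  rw [h 0 θ hN, localRep, (chartAt _ θ₀.base).left_inv hN.1]

theorem SmoothOrd.zero (α : VBundle n M) (U : Set (Jet π)) (k : ℕ) :
    SmoothOrd α U k (fun _ : Jet π => 0) :=
  fun _ _ => ⟨1, one_pos, fun _ => 0, contDiff_const, fun θ _ _ => by simp⟩

theorem SmoothOrd.add {k : ℕ} {φ ψ : ∀ θ : Jet π, α.Fib θ.base} (hφ : SmoothOrd α U k φ)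
    (hψ : SmoothOrd α U k ψ) : SmoothOrd α U k (fun θ => φ θ + ψ θ) := by
  intro θ₀ h₀
  obtain ⟨ε, hε, G, hG, hφ⟩ := hφ θ₀ h₀
  obtain ⟨δ, hδ, H, hH, hψ⟩ := hψ θ₀ h₀
  refine ⟨min ε δ, lt_min hε hδ, fun c => G c + H c, hG.add hH, fun θ hθ hN => ?_⟩
  rw [map_add, hφ θ hθ (hN.mono le_rfl (min_le_left _ _)),
    hψ θ hθ (hN.mono le_rfl (min_le_right _ _))]

theorem SmoothOrd.sum {k : ℕ} {ι : Type*} (t : Finset ι) {φ : ι → ∀ θ : Jet π, α.Fib θ.base}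
    (hφ : ∀ i ∈ t, SmoothOrd α U k (φ i)) : SmoothOrd α U k (fun θ => ∑ i ∈ t, φ i θ) := by
  classical
  induction t using Finset.induction_on with
  | empty => simpa using SmoothOrd.zero α U k
  | insert i t hi ih =>
    simp only [Finset.sum_insert hi]
    exact (hφ i (by simp)).add (ih fun j hj => hφ j (by simp [hj]))

open scoped Classical in
/-- A section over `U`, extended by zero, as an element of the horizontal module. -/
def HSec.mk' {k : ℕ} (φ : ∀ θ : Jet π, α.Fib θ.base) (h : SmoothOrd α U k φ) : HSec U α :=
  ⟨fun θ => if θ ∈ U then φ θ else 0, ⟨k, h.congr fun _ hθ => if_pos hθ⟩, fun _ hθ => if_neg hθ⟩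

theorem HSec.mk'_apply {k : ℕ} {φ : ∀ θ : Jet π, α.Fib θ.base} (h : SmoothOrd α U k φ)
    {θ : Jet π} (hθ : θ ∈ U) : (HSec.mk' φ h).1 θ = φ θ := if_pos hθ

/-- The pullback to infinite jets of a section over the base. -/
def HSec.ofSec (U : Set (Jet π)) (σ : Sec α) : HSec U α :=
  HSec.mk' (fun θ => σ θ.base) (SmoothOrd.of_sec σ U)

theorem pullback_ofSec (σ : Sec α) (s : Sec π) (h : jet s x ∈ U) :
    pullback (HSec.ofSec U σ) s x = σ x := HSec.mk'_apply _ h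

/-- An element of the module of functions, as a function. -/
def HSec.fn (f : HSec U (lineBundle n M)) : Jet π → ℝ := f.1

/-- Multiplication of functions by an element of a horizontal module. -/
def HSec.smulLin (g : HSec U α) : HSec U (lineBundle n M) →ₗ[ℝ] HSec U α where
  toFun f := ⟨fun θ => HSec.fn f θ • g.1 θ, by
    obtain ⟨k, hk⟩ := f.2.1
    obtain ⟨l, hl⟩ := g.2.1
    refine ⟨⟨max k l, ?_⟩, fun θ hθ => ?_⟩
    · exact SmoothOrd.smul (hk.mono (le_max_left k l)) (hl.mono (le_max_right k l))
    · exact (congrArg (HSec.fn f θ • ·) (g.2.2 θ hθ)).trans (smul_zero _)⟩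
  map_add' f f' := Subtype.ext (funext fun θ => add_smul (HSec.fn f θ) (HSec.fn f' θ) (g.1 θ))
  map_smul' c f := Subtype.ext (funext fun θ => mul_smul c (HSec.fn f θ) (g.1 θ))

theorem HSec.smulLin_apply (g : HSec U α) (f : HSec U (lineBundle n M)) (θ : Jet π) :
    (HSec.smulLin g f).1 θ = HSec.fn f θ • g.1 θ := rfl

theorem FlatAt.mono {k l : ℕ} (h : k ≤ l) {s : ∀ x, α.Fib x} (hs : FlatAt α l s x) :
    FlatAt α k s x := fun i hi => hs i (hi.trans h)

theorem IsCDiff.sub {D D' : HSec U α →ₗ[ℝ] HSec U β} (h : IsCDiff D) (h' : IsCDiff D') :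
    IsCDiff (D - D') := by
  obtain ⟨k, hk⟩ := h
  obtain ⟨l, hl⟩ := h'
  refine ⟨max k l, fun φ s x hx hf => ?_⟩
  have h1 := hk φ s x hx (hf.mono (le_max_left k l))
  have h2 := hl φ s x hx (hf.mono (le_max_right k l))
  exact (congrArg₂ (· - ·) h1 h2).trans (sub_zero _)

theorem IsCDiff.zero : IsCDiff (0 : HSec U α →ₗ[ℝ] HSec U β) :=
  ⟨0, fun _ _ _ _ _ => rfl⟩

theorem IsCDiff.add {D D' : HSec U α →ₗ[ℝ] HSec U β} (h : IsCDiff D) (h' : IsCDiff D') :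
    IsCDiff (D + D') := by
  obtain ⟨k, hk⟩ := h
  obtain ⟨l, hl⟩ := h'
  refine ⟨max k l, fun φ s x hx hf => ?_⟩
  have h1 := hk φ s x hx (hf.mono (le_max_left k l))
  have h2 := hl φ s x hx (hf.mono (le_max_right k l))
  exact (congrArg₂ (· + ·) h1 h2).trans (add_zero _)

theorem IsCDiff.sum {ι : Type*} (t : Finset ι) {D : ι → HSec U α →ₗ[ℝ] HSec U β}
    (h : ∀ i ∈ t, IsCDiff (D i)) : IsCDiff (∑ i ∈ t, D i) := by
  classical
  induction t using Finset.induction_on with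
  | empty => simpa using IsCDiff.zero
  | insert i t hi ih =>
    rw [Finset.sum_insert hi]
    exact (h i (by simp)).add (ih fun j hj => h j (by simp [hj]))

theorem IsCDiff.smulLin_comp (g : HSec U β) {D : HSec U α →ₗ[ℝ] HSec U (lineBundle n M)}
    (h : IsCDiff D) : IsCDiff (HSec.smulLin g ∘ₗ D) := by
  obtain ⟨k, hk⟩ := h
  refine ⟨k, fun φ s x hx hf => ?_⟩
  have h1 := hk φ s x hx hf
  exact (congrArg (fun r : ℝ => r • g.1 (jet s x)) h1).trans (zero_smul ℝ _)

/-! ### The local form of `𝓒`-differential operators -/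

variable [T2Space M]

/-- Near every point of the base a `𝓒`-differential operator is a combination of its values on
finitely many sections over the base, with coefficients depending on the jets of the argument:
in coordinates these sections are monomials, and the formula is `∑ a_σ D_σ`. -/
theorem IsCDiff.exists_local_form (hU : IsOpenJet U) {N : HSec U α →ₗ[ℝ] HSec U β}
    (hN : IsCDiff N) (x : M) :
    ∃ (k m : ℕ) (f : Fin m → HSec U α)
      (c : Fin m → EuclideanSpace ℝ (Fin n) →
        (JetFib (EuclideanSpace ℝ (Fin n)) α.Model k →L[ℝ] ℝ)),
      (∀ b, SmoothNear (c b) (chartAt (EuclideanSpace ℝ (Fin n)) x x)) ∧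
      ∀ᶠ y in 𝓝 x, ∀ (φ : HSec U α) (s : Sec π), jet s y ∈ U →
        pullback (N φ) s y = ∑ b, c b (chartAt (EuclideanSpace ℝ (Fin n)) x y)
          (derivs k (localRep α x (pullback φ s)) (chartAt (EuclideanSpace ℝ (Fin n)) x y)) •
            pullback (N (f b)) s y := by
  obtain ⟨k, hk⟩ := hN
  have hx := mem_dom α x
  obtain ⟨m, f, c, hf, hc, hfr⟩ := exists_jet_frame (W := α.Model) k
    (chartAt (EuclideanSpace ℝ (Fin n)) x x)
  choose σ hσ using fun b => exists_sec_localRep' (hf b) hx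
  refine ⟨k, m, fun b => HSec.ofSec U (σ b), c, hc, ?_⟩
  have hσ' : ∀ᶠ z in 𝓝 (chartAt (EuclideanSpace ℝ (Fin n)) x x), ∀ b,
      localRep α x (σ b) =ᶠ[𝓝 z] f b := by
    rw [Filter.eventually_all]
    exact fun b => (hσ b).eventuallyEq_nhds
  filter_upwards [eventually_chart hx.1 hfr, eventually_chart hx.1 hσ', dom_mem_nhds α x]
    with y h1 h2 hy φ s hs
  set χ := chartAt (EuclideanSpace ℝ (Fin n)) x
  set a : Fin m → ℝ := fun b => c b (χ y) (derivs k (localRep α x (pullback φ s)) (χ y)) with ha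
  have hφ := smoothNear_pullback' hU φ s hs hy
  -- subtract from `φ` the combination of the frame with the same jet
  let ψ : HSec U α := φ - ∑ b, a b • HSec.ofSec U (σ b)
  have hψ1 : ∀ᶠ z in 𝓝 y, pullback ψ s z =
      pullback φ s z - ∑ b, a b • (σ b) z := by
    filter_upwards [eventually_mem_jet hU s hs] with z hz
    have h3 : ∀ b, (HSec.ofSec U (σ b)).1 (jet s z) = σ b z := fun b => pullback_ofSec (σ b) s hz
    change φ.1 (jet s z) - ((∑ b, a b • HSec.ofSec U (σ b) : HSec U α) :
      ∀ θ : Jet π, α.Fib θ.base) (jet s z) = _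
    rw [Submodule.coe_sum, Finset.sum_apply]
    simp only [Submodule.coe_smul, Pi.smul_apply, h3]
    rfl
  have hψ2 : localRep α x (pullback ψ s) =ᶠ[𝓝 (χ y)]
      fun z => localRep α x (pullback φ s) z - ∑ b, a b • f b z := by
    filter_upwards [eventually_chart_symm hy.1 hψ1,
      (Filter.eventually_all.2 h2 : ∀ᶠ z in 𝓝 (χ y), ∀ b, localRep α x (σ b) z = f b z)]
      with z h3 h4
    rw [localRep, h3, map_sub, map_sum]
    congr 1
    refine Finset.sum_congr rfl fun b _ => ?_
    rw [map_smul, ← h4 b]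
    rfl
  have hψ3 : Flat k (localRep α x (pullback ψ s)) (χ y) := by
    rw [← derivs_eq_zero_iff, derivs_congr hψ2, derivs_sub (g := fun z => ∑ b, a b • f b z)
      hφ.contDiffAt (ContDiffAt.sum fun b _ => contDiffAt_const.smul (hf b).contDiffAt),
      derivs_sum (f := fun b z => a b • f b z) _ fun b _ =>
        contDiffAt_const.smul (hf b).contDiffAt, sub_eq_zero]
    refine (h1 _ hφ).trans (Finset.sum_congr rfl fun b _ => ?_)
    exact (derivs_smul (hf b).contDiffAt _).symm
  have hψ4 : FlatAt α k (pullback ψ s) y :=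
    Flat.localRep_change hy (mem_dom α y) (smoothNear_pullback' hU ψ s hs hy) hψ3
  have h5 := hk ψ s y hs hψ4
  have h6 : N ψ = N φ - ∑ b, a b • N (HSec.ofSec U (σ b)) := by
    simp only [ψ, map_sub, map_sum, map_smul]
  rw [h6] at h5
  have h7 := sub_eq_zero.1 (show (N φ).1 (jet s y) -
    ((∑ b, a b • N (HSec.ofSec U (σ b)) : HSec U β) :
      ∀ θ : Jet π, β.Fib θ.base) (jet s y) = 0 from h5)
  rw [Submodule.coe_sum, Finset.sum_apply] at h7
  exact h7

theorem Flat.of_proj {X : Type*} [NormedAddCommGroup X] [NormedSpace ℝ X] {ι : Type*} [Fintype ι]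
    {Y : ι → Type*} [∀ i, NormedAddCommGroup (Y i)] [∀ i, NormedSpace ℝ (Y i)]
    {f : X → ∀ i, Y i} {z : X} {k : ℕ} (hf : ContDiffAt ℝ ∞ f z)
    (h : ∀ i, Flat k (fun y => f y i) z) : Flat k f z := by
  intro j hj
  ext v i
  have h1 := ContinuousLinearMap.iteratedFDeriv_comp_left (ContinuousLinearMap.proj (R := ℝ) i)
    (hf.of_le (n := ∞) (m := j) (by exact_mod_cast le_top)) le_rfl
  have h2 := h i j hj
  have h3 := congrArg (fun A => A v) (h1.symm.trans h2)
  simpa using h3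

theorem Flat.derivs {E W : Type*} [NormedAddCommGroup E] [NormedSpace ℝ E]
    [FiniteDimensional ℝ E] [NormedAddCommGroup W] [NormedSpace ℝ W] {f : E → W} {z : E}
    (hf : SmoothNear f z) (h : ∀ k, Flat k f z) (k l : ℕ) : Flat l (derivs k f) z :=
  Flat.of_proj (hf.derivs k).contDiffAt fun i => Flat.iteratedFDeriv h i l

/-- At points of the infinite prolongation of `F = 0`, all total derivatives of `N F` vanish
for every `𝓒`-differential operator `N`. -/
theorem IsCDiff.flat_of_mem_prolongation (hU : IsOpenJet U) {N : HSec U α →ₗ[ℝ] HSec U β}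
    (hN : IsCDiff N) {F : HSec U α} {s : Sec π} (h : jet s x ∈ Prolongation F) (k : ℕ) :
    FlatAt β k (pullback (N F) s) x := by
  obtain ⟨l, m, f, c, hc, hloc⟩ := hN.exists_local_form hU x
  have hxα := mem_dom α x
  have hxβ := mem_dom β x
  set χ := chartAt (EuclideanSpace ℝ (Fin n)) x
  have hF : ∀ k, Flat k (localRep α x (pullback F s)) (χ x) := h.2 s x rfl
  have hFs := smoothNear_pullback hU F s h.1
  have h1 : localRep β x (pullback (N F) s) =ᶠ[𝓝 (χ x)] fun z =>
      ∑ b, c b z (derivs l (localRep α x (pullback F s)) z) •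
        localRep β x (pullback (N (f b)) s) z := by
    filter_upwards [eventually_chart_symm hxα.1 hloc,
      eventually_chart_symm hxα.1 (eventually_mem_jet hU s h.1),
      χ.open_target.mem_nhds (χ.map_source hxα.1)] with z h1 h2 h3
    have h4 := h1 F s h2
    rw [χ.right_inv h3] at h4
    rw [localRep, h4, map_sum]
    exact Finset.sum_congr rfl fun b _ => map_smul _ _ _
  change Flat k (localRep β x (pullback (N F) s)) (χ x)
  have hG : ∀ b, SmoothNear (localRep β x (pullback (N (f b)) s)) (χ x) := fun b =>
    smoothNear_pullback hU _ s h.1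
  have hcF : ∀ b, SmoothNear (fun z => c b z (derivs l (localRep α x (pullback F s)) z)) (χ x) := by
    intro b
    filter_upwards [hc b, hFs.derivs l] with z h1 h2
    exact h1.clm_apply h2
  have hflat : ∀ b, Flat k (fun z => c b z (derivs l (localRep α x (pullback F s)) z) •
        localRep β x (pullback (N (f b)) s) z) (χ x) := by
    intro b
    refine Flat.bilin (ContinuousLinearMap.lsmul ℝ ℝ)
      (f := fun z => c b z (derivs l (localRep α x (pullback F s)) z)) ?_ (hcF b) (hG b)
    exact Flat.bilin (ContinuousLinearMap.id ℝ (_ →L[ℝ] ℝ)).flip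
      (Flat.derivs hFs hF l k) (hFs.derivs l) (hc b)
  refine Flat.congr ?_ h1
  rw [← derivs_eq_zero_iff, derivs_sum (f := fun b z =>
    c b z (derivs l (localRep α x (pullback F s)) z) •
      localRep β x (pullback (N (f b)) s) z) _ fun b _ =>
        ((hcF b).contDiffAt.smul (hG b).contDiffAt), Finset.sum_eq_zero]
  exact fun b _ => derivs_eq_zero_iff.2 (hflat b)

theorem IsCDiff.apply_eq_zero_of_mem {N : HSec U α →ₗ[ℝ] HSec U β}
    (hN : IsCDiff N) {F : HSec U α} {θ : Jet π} (h : θ ∈ Prolongation F) : (N F).1 θ = 0 := by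
  obtain ⟨s, x, rfl⟩ := exists_jet_eq θ
  obtain ⟨k, hk⟩ := hN
  exact hk F s x h.1 (h.2 s x rfl k)

/-- At points of the infinite prolongation of `F = 0`, the linearization of `N F` is the
composition of `N` with the linearization of `F`: the derivatives of the coefficients of `N` are
multiplied by total derivatives of `F`, which vanish. -/
theorem IsCDiff.hasDerivAt_apply (hU : IsOpenJet U) {N : HSec U α →ₗ[ℝ] HSec U β}
    (hN : IsCDiff N) {F : HSec U α} {s w : Sec π} {φ : HSec U π} (h : jet s x ∈ Prolongation F)
    (hw : ∀ᶠ y in 𝓝 x, w y = pullback φ s y) :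
    HasDerivAt (fun t : ℝ => triv β x x (pullback (N F) (s + t • w) x))
      (triv β x x (pullback (N (lin F φ)) s x)) 0 := by
  obtain ⟨l, m, f, c, -, hloc⟩ := hN.exists_local_form hU x
  have hxα := mem_dom α x
  set χ := chartAt (EuclideanSpace ℝ (Fin n)) x
  let Φ : ℝ × EuclideanSpace ℝ (Fin n) → α.Model := fun q =>
    localRep α x (pullback F (s + q.1 • w)) q.2
  have ha := hasDerivAt_derivs_param (smoothNear_pullback_param hU F s w h.1) l
  have h1 : (fun y => deriv (fun t : ℝ => localRep α x (pullback F (s + t • w)) y) 0) =ᶠ[𝓝 (χ x)]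
      localRep α x (pullback (lin F φ) s) := by
    filter_upwards [eventually_chart_symm hxα.1 (hw.eventually_nhds),
      eventually_chart_symm hxα.1 (eventually_mem_jet hU s h.1),
      eventually_chart_symm hxα.1 (dom_mem_nhds α x)] with z h1 h2 h3
    exact (HasDerivAt.triv_change (mem_dom α _) h3
      (isLinearization_lin hU F φ s w _ h2 h1)).deriv
  rw [derivs_congr h1] at ha
  -- `F` is flat along `s`, so that the coefficient of each `N (f b)` vanishes at `t = 0` and
  -- the values of `N (f b)` need not be differentiated
  have h0 : derivs l (localRep α x (pullback F (s + (0 : ℝ) • w))) (χ x) = 0 := by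
    rw [zero_smul, add_zero]
    exact derivs_eq_zero_iff.2 (h.2 s x rfl l)
  have h2 : ∀ b, HasDerivAt (fun t : ℝ =>
      c b (χ x) (derivs l (localRep α x (pullback F (s + t • w))) (χ x)) •
        triv β x x (pullback (N (f b)) (s + t • w) x))
      (c b (χ x) (derivs l (localRep α x (pullback (lin F φ) s)) (χ x)) •
        triv β x x (pullback (N (f b)) s x)) 0 := by
    intro b
    have h3 := hasDerivAt_smul_of_eq_zero
      ((c b (χ x)).hasFDerivAt.comp_hasDerivAt (0 : ℝ) ha)
      (by simp only [Function.comp_apply]; rw [h0, map_zero])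
      (continuousAt_pullback_param hU (N (f b)) s w h.1)
    simpa using h3
  have h3 := HasDerivAt.sum (u := Finset.univ) fun b _ => h2 b
  have h4 : triv β x x (pullback (N (lin F φ)) s x) = ∑ b,
      c b (χ x) (derivs l (localRep α x (pullback (lin F φ) s)) (χ x)) •
        triv β x x (pullback (N (f b)) s x) := by
    rw [hloc.self_of_nhds (lin F φ) s h.1, map_sum]
    exact Finset.sum_congr rfl fun b _ => map_smul _ _ _
  rw [h4]
  refine h3.congr_of_eventuallyEq ?_
  filter_upwards [eventually_mem_param hU s w h.1] with t ht
  rw [hloc.self_of_nhds F (s + t • w) ht, map_sum, Finset.sum_apply]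
  exact Finset.sum_congr rfl fun b _ => map_smul _ _ _

end Operators

/-! ### Division of functions by the transversal coordinates -/

section Division

variable {n : ℕ} {M : Type*} [TopologicalSpace M] [ChartedSpace (EuclideanSpace ℝ (Fin n)) M]
  [IsManifold 𝓘(ℝ, EuclideanSpace ℝ (Fin n)) ∞ M]
  {π α : VBundle n M} {U : Set (Jet π)} {F : HSec U α} {ι : Type}

open scoped Classical in
/-- The derivative of `g` in the direction of the coordinate `v_s`. The point `v` lies in the open
set `V`, so that the value assigned outside of `V` does not matter. -/
def derivV {V : Set (ι → ℝ)} (g : Prolongation F × V → ℝ) (s : ι) (θ : Prolongation F)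
    (v : ι → ℝ) : ℝ :=
  deriv (fun τ : ℝ => if h : v + τ • Pi.single s 1 ∈ V then g (θ, ⟨_, h⟩) else 0) 0

/-- The average of `∂g/∂v_s` over the segment from `(θ, 0)` to `(θ, v)`: the coefficient of `v_s` in
Hadamard's lemma. It is defined without reference to local expressions of `g`, so that it makes
sense globally. -/
def avgDerivV {V : Set (ι → ℝ)} (g : Prolongation F × V → ℝ) (s : ι)
    (q : Prolongation F × V) : ℝ :=
  ∫ t in (0 : ℝ)..1, derivV g s q.1 (t • q.2.1)

/-- Along a segment `{(θ₀, t v₀)}`, the function `g` is given by one smooth function of finitely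
many coordinates. -/
theorem SmoothProd.exists_near_segment {V : Set (ι → ℝ)} (hstar : StarConvex ℝ 0 V) {l : ℕ}
    {T : Finset ι} {g : Prolongation F × V → ℝ} (hg : SmoothProd F V l T g)
    (q₀ : Prolongation F × V) :
    ∃ G : Coord π l × (T → ℝ) → ℝ, ContDiff ℝ ∞ G ∧ ∃ O, IsOpen O ∧
      (∀ q : Prolongation F × V,
        q.1.1.base ∈ (chartAt (EuclideanSpace ℝ (Fin n)) q₀.1.1.base).source →
        (coord q₀.1.1.base l q.1.1, fun s : T => q.2.1 s) ∈ O →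
        g q = G (coord q₀.1.1.base l q.1.1, fun s => q.2.1 s)) ∧
      ∃ ε > 0, ∀ q : Prolongation F × V, Near l ε q₀.1.1 q.1.1 →
        (∀ s ∈ T, |q.2.1 s - q₀.2.1 s| < ε) → ∀ t ∈ Set.Icc (0 : ℝ) 1,
        (coord q₀.1.1.base l q.1.1, fun s : T => t * q.2.1 s) ∈ O := by
  set p := q₀.1.1.base with hp
  set c₀ := coord p l q₀.1.1 with hc₀
  let Q := {q : Prolongation F × V //
    q.1.1.base ∈ (chartAt (EuclideanSpace ℝ (Fin n)) p).source}
  let κ : Q → Coord π l × (T → ℝ) := fun q => (coord p l q.1.1.1, fun s => q.1.2.1 s)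
  let seg : ℝ → Coord π l × (T → ℝ) := fun t => (c₀, fun s => t * q₀.2.1 s)
  have hseg : Continuous seg :=
    continuous_const.prodMk (continuous_pi fun s => continuous_id.mul continuous_const)
  have hK : IsCompact (seg '' Set.Icc 0 1) := isCompact_Icc.image hseg
  obtain ⟨G, hG, O, hO, hKO, hgO⟩ := exists_contDiff_near_compact κ (fun q => g q.1) hK (by
    rintro _ ⟨t, ht, rfl⟩
    obtain ⟨ε, hε, G, hG, h⟩ := hg (q₀.1, ⟨t • q₀.2.1, hstar.smul_mem q₀.2.2 ht.1 ht.2⟩)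
    refine ⟨Metric.ball (seg t) ε, Metric.ball_mem_nhds _ hε, G, hG, fun q hq => ?_⟩
    have hq' : max (dist (coord p l q.1.1.1) c₀)
        (dist (fun s : T => q.1.2.1 s) (fun s : T => t * q₀.2.1 s)) < ε := hq
    refine h q.1 ⟨q.2, (le_max_left _ _).trans_lt hq'⟩ fun s hs => ?_
    have h1 := (dist_pi_lt_iff hε).1 ((le_max_right _ _).trans_lt hq') ⟨s, hs⟩
    exact h1)
  refine ⟨G, hG, O, hO, fun q hq hqO => hgO ⟨q, hq⟩ hqO, ?_⟩
  obtain ⟨δ, hδ, hsub⟩ := hK.exists_thickening_subset_open hO hKO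
  refine ⟨δ, hδ, fun q hq hqs t ht => hsub ?_⟩
  refine Metric.mem_thickening_iff.2 ⟨seg t, ⟨t, ht, rfl⟩, max_lt hq.2 ?_⟩
  refine (dist_pi_lt_iff hδ).2 fun s => ?_
  change |t * q.2.1 s - t * q₀.2.1 s| < δ
  rw [← mul_sub, abs_mul, abs_of_nonneg ht.1]
  exact (mul_le_of_le_one_left (abs_nonneg _) ht.2).trans_lt (hqs s s.2)

/-- The derivative `∂g/∂v_s` can be computed from a local expression `G` of `g`. -/
theorem derivV_eq {V : Set (ι → ℝ)} (hV : IsOpen V) {l : ℕ} {T : Finset ι} [DecidableEq T]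
    {g : Prolongation F × V → ℝ} {p : M} {G : Coord π l × (T → ℝ) → ℝ} (hG : ContDiff ℝ ∞ G)
    {O : Set (Coord π l × (T → ℝ))} (hO : IsOpen O)
    (hgO : ∀ q : Prolongation F × V,
        q.1.1.base ∈ (chartAt (EuclideanSpace ℝ (Fin n)) p).source →
        (coord p l q.1.1, fun s : T => q.2.1 s) ∈ O →
        g q = G (coord p l q.1.1, fun s => q.2.1 s))
    {θ : Prolongation F} (hθ : θ.1.base ∈ (chartAt (EuclideanSpace ℝ (Fin n)) p).source)
    {v : ι → ℝ} (hv : v ∈ V) (hvO : (coord p l θ.1, fun s : T => v s) ∈ O) (s : T) :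
    derivV g s θ v = fderiv ℝ G (coord p l θ.1, fun s : T => v s) (0, Pi.single s 1) := by
  classical
  have hline : Continuous fun τ : ℝ => v + τ • (Pi.single s.1 1 : ι → ℝ) := by fun_prop
  have hlineT : Continuous fun τ : ℝ =>
      ((coord p l θ.1, fun r : T => v r + τ * (Pi.single s 1 : T → ℝ) r) :
        Coord π l × (T → ℝ)) := by fun_prop
  have h1 : ∀ᶠ τ in 𝓝 (0 : ℝ), v + τ • (Pi.single s.1 1 : ι → ℝ) ∈ V :=
    hline.continuousAt.eventually (hV.mem_nhds (by simpa using hv))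
  have h2 : ∀ᶠ τ in 𝓝 (0 : ℝ),
      ((coord p l θ.1, fun r : T => v r + τ * (Pi.single s 1 : T → ℝ) r) :
        Coord π l × (T → ℝ)) ∈ O :=
    hlineT.continuousAt.eventually (hO.mem_nhds (by simpa using hvO))
  have hsingle : ∀ r : T, (Pi.single s.1 1 : ι → ℝ) r.1 = (Pi.single s 1 : T → ℝ) r := by
    intro r
    simp only [Pi.single_apply, Subtype.ext_iff]
  unfold derivV
  have h3 : (fun τ : ℝ => if h : v + τ • Pi.single s.1 1 ∈ V then g (θ, ⟨_, h⟩) else 0) =ᶠ[𝓝 0]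
      fun τ => G (coord p l θ.1, fun r : T => v r + τ * (Pi.single s 1 : T → ℝ) r) := by
    filter_upwards [h1, h2] with τ hτ hτO
    have he : (fun r : T => (v + τ • (Pi.single s.1 1 : ι → ℝ)) r.1) =
        fun r : T => v r + τ * (Pi.single s 1 : T → ℝ) r := by
      funext r
      rw [← hsingle r]
      rfl
    rw [dif_pos hτ, hgO _ hθ (by rw [he]; exact hτO)]
    simp only [he]
  have h4 : HasDerivAt (fun τ : ℝ =>
      ((coord p l θ.1, fun r : T => v r + τ * (Pi.single s 1 : T → ℝ) r) :
        Coord π l × (T → ℝ))) (0, Pi.single s 1) 0 := by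
    refine (hasDerivAt_const _ _).prodMk (hasDerivAt_pi.2 fun r => ?_)
    simpa using ((hasDerivAt_id (0 : ℝ)).mul_const ((Pi.single s 1 : T → ℝ) r)).const_add (v r)
  convert h3.deriv_eq.trans (HasFDerivAt.comp_hasDerivAt (0 : ℝ)
    ((hG.differentiable (by simp)) _).hasFDerivAt h4).deriv using 2
  simp

/-- A smooth function on the product which vanishes for `v = 0` is a combination of the
coordinates `v_s` with smooth coefficients of the same order. -/
theorem SmoothProd.exists_division {V : Set (ι → ℝ)} (hV : IsOpen V) (h0 : (0 : ι → ℝ) ∈ V)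
    (hstar : StarConvex ℝ 0 V) {l : ℕ}
    {T : Finset ι} {g : Prolongation F × V → ℝ} (hg : SmoothProd F V l T g)
    (hg0 : ∀ θ, g (θ, ⟨0, h0⟩) = 0) :
    ∃ u : ι → Prolongation F × V → ℝ, (∀ s ∈ T, SmoothProd F V l T (u s)) ∧
      ∀ q, g q = ∑ s ∈ T, q.2.1 s * u s q := by
  classical
  have key : ∀ q₀ : Prolongation F × V, ∃ ε > 0, ∃ G : Coord π l × (T → ℝ) → ℝ,
      ContDiff ℝ ∞ G ∧ ∀ q : Prolongation F × V, Near l ε q₀.1.1 q.1.1 →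
        (∀ s ∈ T, |q.2.1 s - q₀.2.1 s| < ε) →
        g q = G (coord q₀.1.1.base l q.1.1, fun s => q.2.1 s) -
          G (coord q₀.1.1.base l q.1.1, 0) ∧
        ∀ s : T, avgDerivV g s q = ∫ t in (0 : ℝ)..1,
          fderiv ℝ G (coord q₀.1.1.base l q.1.1, t • fun s : T => q.2.1 s)
            (0, Pi.single s 1) := by
    intro q₀
    obtain ⟨G, hG, O, hO, hgO, ε, hε, hseg⟩ := hg.exists_near_segment hstar q₀
    refine ⟨ε, hε, G, hG, fun q hq hqs => ⟨?_, fun s => ?_⟩⟩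
    · have h1 := hgO q hq.1 (by simpa using hseg q hq hqs 1 (by simp))
      have h2 := hgO (q.1, ⟨0, h0⟩) hq.1 (by simpa using hseg q hq hqs 0 (by simp))
      rw [hg0] at h2
      rw [h1]
      have h3 : G (coord q₀.1.1.base l q.1.1, 0) = 0 := h2.symm
      rw [h3, sub_zero]
    · refine intervalIntegral.integral_congr fun t ht => ?_
      rw [Set.uIcc_of_le zero_le_one] at ht
      exact derivV_eq hV hG hO hgO hq.1 (hstar.smul_mem q.2.2 ht.1 ht.2) (hseg q hq hqs t ht) s
  refine ⟨fun s => avgDerivV g s, fun s hs q₀ => ?_, fun q => ?_⟩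
  · obtain ⟨ε, hε, G, hG, h⟩ := key q₀
    refine ⟨ε, hε, fun c => ∫ t in (0 : ℝ)..1,
      fderiv ℝ G (c.1, t • c.2) (0, Pi.single ⟨s, hs⟩ 1), ?_,
      fun q hq hqs => (h q hq hqs).2 ⟨s, hs⟩⟩
    refine contDiff_integral_param (A := fun a : ℝ × (Coord π l × (T → ℝ)) =>
      fderiv ℝ G (a.2.1, a.1 • a.2.2) (0, Pi.single ⟨s, hs⟩ 1)) ?_
    exact ((hG.fderiv_right (m := ∞) (by simp)).comp
      ((contDiff_fst.comp contDiff_snd).prodMk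
        (contDiff_fst.smul (contDiff_snd.comp contDiff_snd)))).clm_apply contDiff_const
  · obtain ⟨ε, hε, G, hG, h⟩ := key q
    obtain ⟨h1, h2⟩ := h q (near_self l hε _) (by simpa using fun _ _ => hε)
    rw [h1, sub_eq_sum_integral hG, ← Finset.sum_coe_sort T]
    exact Finset.sum_congr rfl fun s _ => congrArg (q.2.1 s * ·) (h2 s).symm

/-! ### Splittings of the jet space along the prolongation -/

/-- The data of the regularity condition: a product structure on `U` whose second
component `v` consists of functions `D_s F`. -/
structure Splitting (F : HSec U α) where
  /-- the index set of the transversal coordinates -/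
  ι : Type
  /-- the range of the transversal coordinates -/
  V : Set (ι → ℝ)
  /-- the isomorphism -/
  ν : U ≃ Prolongation F × V
  /-- the operators giving the transversal coordinates -/
  D : ι → HSec U α →ₗ[ℝ] HSec U (lineBundle n M)
  isOpen : IsOpen V
  zero_mem : (0 : ι → ℝ) ∈ V
  star : StarConvex ℝ 0 V
  ν_zero : ∀ θ : Prolongation F, (ν ⟨θ.1, θ.2.1⟩).1 = θ ∧ (ν ⟨θ.1, θ.2.1⟩).2.1 = 0
  isCDiff : ∀ s, IsCDiff (D s)
  ν_snd : ∀ (θ : U) (s : ι), (ν θ).2.1 s = HSec.fn (D s F) θ.1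
  smooth_symm : ∀ k : ℕ, ∃ (l : ℕ) (T : Finset ι), ∀ f : Jet π → ℝ,
    SmoothOrd (lineBundle n M) U k f → SmoothProd F V l T fun q => f (ν.symm q).1
  smooth : ∀ (k : ℕ) (T : Finset ι), ∃ l : ℕ, ∀ f : Jet π → ℝ,
    (SmoothProd F V k T fun q => f (ν.symm q).1) → SmoothOrd (lineBundle n M) U l f

theorem Regular.exists_splitting (hF : Regular F) : Nonempty (Splitting F) := by
  obtain ⟨ι, -, V, ν, D, h1, h2, h3, h4, h5, h6, h7, h8⟩ := hF
  exact ⟨⟨ι, V, ν, D, h1, h2, h3, h4, h5, h6, h7, h8⟩⟩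

namespace Splitting

variable (R : Splitting F)

theorem symm_zero (θ : Prolongation F) :
    R.ν.symm (θ, ⟨0, R.zero_mem⟩) = ⟨θ.1, θ.2.1⟩ := by
  rw [Equiv.symm_apply_eq]
  exact Prod.ext (R.ν_zero θ).1.symm (Subtype.ext (R.ν_zero θ).2.symm)

/-- Functions of order at most `k` vanishing on the prolongation are combinations of finitely
many transversal coordinates. These, and the order of the coefficients, depend only on `k`. -/
theorem exists_division_fun (k : ℕ) : ∃ (l : ℕ) (T : Finset R.ι), ∀ f : Jet π → ℝ,
    SmoothOrd (lineBundle n M) U k f → (∀ θ ∈ Prolongation F, f θ = 0) →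
    ∃ u : R.ι → Jet π → ℝ, (∀ s ∈ T, SmoothOrd (lineBundle n M) U l (u s)) ∧
      ∀ θ ∈ U, f θ = ∑ s ∈ T, HSec.fn (R.D s F) θ * u s θ := by
  classical
  obtain ⟨m, T, h1⟩ := R.smooth_symm k
  obtain ⟨l, h2⟩ := R.smooth m T
  refine ⟨l, T, fun f hf hf0 => ?_⟩
  obtain ⟨u, hu, hfu⟩ := (h1 f hf).exists_division R.isOpen R.zero_mem R.star fun θ => by
    rw [R.symm_zero]
    exact hf0 _ θ.2
  refine ⟨fun s θ => if h : θ ∈ U then u s (R.ν ⟨θ, h⟩) else 0, fun s hs => h2 _ ?_,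
    fun θ hθ => ?_⟩
  · convert hu s hs using 2 with q
    beta_reduce
    rw [dif_pos (R.ν.symm q).2, Subtype.coe_eta, Equiv.apply_symm_apply]
  · have h3 := hfu (R.ν ⟨θ, hθ⟩)
    simp only [Equiv.symm_apply_apply] at h3
    rw [h3]
    refine Finset.sum_congr rfl fun s _ => ?_
    beta_reduce
    rw [R.ν_snd, dif_pos hθ]

end Splitting

end Division

/-! ### Division of sections of horizontal modules -/

section SectionDivision

variable {n : ℕ} {M : Type*} [TopologicalSpace M] [ChartedSpace (EuclideanSpace ℝ (Fin n)) M]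
  [IsManifold 𝓘(ℝ, EuclideanSpace ℝ (Fin n)) ∞ M]
  {π α β : VBundle n M} {U : Set (Jet π)} {F : HSec U α}

theorem SmoothOrd.of_local {k : ℕ} {φ : ∀ θ : Jet π, β.Fib θ.base}
    (h : ∀ θ₀ ∈ U, ∃ ψ : ∀ θ : Jet π, β.Fib θ.base, SmoothOrd β U k ψ ∧
      ∃ ε > 0, ∀ θ ∈ U, Near k ε θ₀ θ → φ θ = ψ θ) : SmoothOrd β U k φ := by
  intro θ₀ h₀
  obtain ⟨ψ, hψ, ε, hε, he⟩ := h θ₀ h₀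
  obtain ⟨δ, hδ, G, hG, hψ⟩ := hψ θ₀ h₀
  exact ⟨min ε δ, lt_min hε hδ, G, hG, fun θ hθ hN => by
    rw [he θ hθ (hN.mono le_rfl (min_le_left _ _)), hψ θ hθ (hN.mono le_rfl (min_le_right _ _))]⟩

/-- The components of a section in the trivialization around `c`, cut off outside of the domain of
this trivialization, are functions of the same order. -/
theorem SmoothOrd.component {k : ℕ} {φ : ∀ θ : Jet π, β.Fib θ.base} (hφ : SmoothOrd β U k φ)
    {c : M} {ρ : M → ℝ} (hρ : ContMDiff 𝓘(ℝ, EuclideanSpace ℝ (Fin n)) 𝓘(ℝ) ∞ ρ)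
    (hρs : tsupport ρ ⊆ Dom β c) (ℓ : β.Model →L[ℝ] ℝ) :
    SmoothOrd (lineBundle n M) U k fun θ => ρ θ.base * ℓ (triv β c θ.base (φ θ)) := by
  intro θ₀ h₀
  obtain ⟨ε, hε, G, hG, hφ⟩ := hφ θ₀ h₀
  set p := θ₀.base with hp
  have hd := mem_dom β p
  have hA : SmoothNear (fun z => ρ ((chartAt (EuclideanSpace ℝ (Fin n)) p).symm z) •
      ℓ.comp (fibChange β p c ((chartAt (EuclideanSpace ℝ (Fin n)) p).symm z)))
      (chartAt (EuclideanSpace ℝ (Fin n)) p p) := by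
    by_cases hs : p ∈ tsupport ρ
    · filter_upwards [smoothNear_comp_chart_symm isOpen_univ hρ.contMDiffOn (Set.mem_univ p) hd.1,
        smoothNear_fibChange hd (hρs hs)] with z h1 h2
      exact h1.smul (contDiffAt_const.clm_comp h2)
    · refine (SmoothNear.of_contDiff (contDiff_const (c := (0 : β.Model →L[ℝ] ℝ))) _).congr ?_
      filter_upwards [eventually_chart_symm hd.1 (notMem_tsupport_iff_eventuallyEq.1 hs)] with z hz
      simp [hz]
  obtain ⟨A, hA, hAe⟩ := hA.exists_contDiff
  obtain ⟨δ, hδ, h1⟩ := exists_near_chart hAe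
  obtain ⟨η, hη, h2⟩ := exists_near_base (θ₀ := θ₀) (dom_mem_nhds β θ₀.base)
  refine ⟨min η (min ε δ), lt_min hη (lt_min hε hδ), fun z => A z.1 (G z),
    (hA.comp contDiff_fst).clm_apply hG, fun θ hθ hN => ?_⟩
  refine (triv_lineBundle _ _ _).trans ?_
  have hyd := h2 k θ (hN.mono le_rfl (min_le_left _ _))
  have h3 : A (chartAt (EuclideanSpace ℝ (Fin n)) p θ.base) =
      ρ θ.base • ℓ.comp (fibChange β p c θ.base) := by
    refine (h1 k θ (hN.mono le_rfl ((min_le_right _ _).trans (min_le_right _ _)))).trans ?_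
    beta_reduce
    rw [(chartAt (EuclideanSpace ℝ (Fin n)) p).left_inv hN.1]
  have h4 := hφ θ hθ (hN.mono le_rfl ((min_le_right _ _).trans (min_le_left _ _)))
  change _ = A (chartAt (EuclideanSpace ℝ (Fin n)) p θ.base) (G (coord p k θ))
  rw [h3, ← h4]
  change _ = ρ θ.base * ℓ (fibChange β p c θ.base (triv β p θ.base (φ θ)))
  by_cases hs : θ.base ∈ tsupport ρ
  · rw [fibChange_triv hyd.2 (hρs hs).2]
  · change ρ θ.base * _ = _
    rw [image_eq_zero_of_notMem_tsupport hs, zero_mul, zero_mul]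

theorem Finset.sum_repr_smul {ι V W : Type*} [Fintype ι] [AddCommGroup V] [Module ℝ V]
    [AddCommGroup W] [Module ℝ W] (e : Module.Basis ι ℝ V) (A : V →ₗ[ℝ] W) (v : V) :
    ∑ j, e.repr v j • A (e j) = A v := by
  conv_rhs => rw [← e.sum_repr v, map_sum]
  exact Finset.sum_congr rfl fun j _ => (map_smul _ _ _).symm

variable [T2Space M] [SigmaCompactSpace M]

/-- An element of a horizontal module that vanishes on the prolongation is a combination
of the transversal coordinates `D_s F`. The components in local trivializations are divided
one by one, and the results are added up with a partition of unity on the base. -/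
theorem Splitting.exists_division (R : Splitting F) (h : HSec U β)
    (h0 : ∀ θ ∈ Prolongation F, h.1 θ = 0) :
    ∃ (T : Finset R.ι) (g : R.ι → HSec U β), h = ∑ s ∈ T, HSec.smulLin (g s) (R.D s F) := by
  classical
  obtain ⟨k, hk⟩ := h.2.1
  obtain ⟨l, T, hdiv⟩ := R.exists_division_fun k
  obtain ⟨ρ, hρ⟩ := SmoothPartitionOfUnity.exists_isSubordinate
    𝓘(ℝ, EuclideanSpace ℝ (Fin n)) (s := (Set.univ : Set M)) isClosed_univ
    (fun c : M => Dom β c) (fun c => isOpen_dom β c)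
    (fun y _ => Set.mem_iUnion.2 ⟨y, mem_dom β y⟩)
  let e := Module.finBasis ℝ β.Model
  let ℓ : ∀ j, β.Model →L[ℝ] ℝ := fun j => LinearMap.toContinuousLinearMap (e.coord j)
  have hdiv' : ∀ (c : M) (j : Fin _), ∃ u : R.ι → Jet π → ℝ,
      (∀ s ∈ T, SmoothOrd (lineBundle n M) U l (u s)) ∧
      ∀ θ ∈ U, ρ c θ.base * ℓ j (triv β c θ.base (h.1 θ)) =
        ∑ s ∈ T, HSec.fn (R.D s F) θ * u s θ := fun c j =>
    hdiv _ (hk.component (ρ c).contMDiff (hρ c) (ℓ j)) fun θ hθ => by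
      rw [h0 θ hθ, map_zero, map_zero, mul_zero]
  choose u hu hfu using hdiv'
  -- each piece is multiplied by `ρ c` twice, once to cut off the components and once to cut off
  -- the frame, so that the pieces add up to `h` times the sum of the squares
  let Δ : M → ℝ := fun y => ∑ᶠ c, ρ c y • ρ c y
  have hΔs : ContMDiff 𝓘(ℝ, EuclideanSpace ℝ (Fin n)) 𝓘(ℝ) ∞ Δ :=
    ρ.contMDiff_finsum_smul (n := ⊤) fun c y _ => (ρ c).contMDiff y
  have hfin : ∀ y, ((fun c => ρ c y • ρ c y).support).Finite := fun y =>
    (ρ.locallyFinite.point_finite y).subset fun c hc => by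
      simpa using hc
  have hΔ : ∀ y, Δ y ≠ 0 := by
    intro y
    obtain ⟨c, hc⟩ := ρ.exists_pos_of_mem (Set.mem_univ y)
    have h1 : 0 < Δ y := finsum_pos (fun c => mul_self_nonneg _)
      ⟨c, mul_pos hc hc⟩ (hfin y)
    exact h1.ne'
  have hσ : ∀ (c : M) (j : Fin _), ∃ σ : Sec β, ∀ y, σ y =
      trivSymm β c y ((ρ c y * (Δ y)⁻¹) • e j) := fun c j => by
    refine exists_sec_of_tsupport c (h := fun y => (ρ c y * (Δ y)⁻¹) • e j) ?_ ?_
    · exact (((ρ c).contMDiff).mul (hΔs.inv₀ hΔ)).smul contMDiff_const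
    · refine subset_trans (closure_mono ?_) ((hρ c).trans Set.inter_subset_right)
      intro y hy hy'
      simp [hy'] at hy
  choose σ hσ using hσ
  have hσ0 : ∀ c j y, ρ c y = 0 → σ c j y = 0 := fun c j y hy => by
    rw [hσ, hy, zero_mul, zero_smul, map_zero]
  let g : R.ι → ∀ θ : Jet π, β.Fib θ.base := fun s θ =>
    ∑ᶠ c, ∑ j, u c j s θ • σ c j θ.base
  have hgsum : ∀ s θ (I : Finset M), (Function.support fun c => ρ c θ.base) ⊆ I →
      g s θ = ∑ c ∈ I, ∑ j, u c j s θ • σ c j θ.base := by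
    intro s θ I hI
    refine finsum_eq_sum_of_support_subset _ fun c hc => hI fun hc' => hc ?_
    exact Finset.sum_eq_zero fun j _ => by rw [hσ0 c j _ hc', smul_zero]
  have hg : ∀ s ∈ T, SmoothOrd β U l (g s) := by
    intro s hs
    refine SmoothOrd.of_local fun θ₀ h₀ => ?_
    obtain ⟨O, hO, hOf⟩ := ρ.locallyFinite θ₀.base
    obtain ⟨ε, hε, hb⟩ := exists_near_base hO
    refine ⟨fun θ => ∑ c ∈ hOf.toFinset, ∑ j, u c j s θ • σ c j θ.base,
      SmoothOrd.sum _ fun c _ => SmoothOrd.sum _ fun j _ =>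
        (hu c j s hs).smul ((SmoothOrd.of_sec (σ c j) U).mono (Nat.zero_le l)),
      ε, hε, fun θ _ hN => hgsum s θ _ fun c hc => ?_⟩
    rw [Set.Finite.coe_toFinset]
    exact ⟨θ.base, hc, hb l θ hN⟩
  refine ⟨T, fun s => if hs : s ∈ T then HSec.mk' (g s) (hg s hs) else 0, ?_⟩
  refine Subtype.ext (funext fun θ => ?_)
  rw [Submodule.coe_sum, Finset.sum_apply]
  by_cases hθ : θ ∈ U
  · set y := θ.base with hy
    let I : Finset M := (ρ.locallyFinite.point_finite y).toFinset
    have hI : (Function.support fun c => ρ c y) ⊆ I := fun c hc => by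
      rw [Set.Finite.coe_toFinset]
      exact hc
    have h1 : ∀ s ∈ T, (HSec.smulLin (if hs : s ∈ T then HSec.mk' (g s) (hg s hs) else 0)
        (R.D s F)).1 θ = ∑ c ∈ I, ∑ j, (HSec.fn (R.D s F) θ * u c j s θ) • σ c j y := by
      intro s hs
      rw [HSec.smulLin_apply, dif_pos hs, HSec.mk'_apply (hg s hs) hθ, hgsum s θ I hI,
        Finset.smul_sum]
      refine Finset.sum_congr rfl fun c _ => ?_
      rw [Finset.smul_sum]
      exact Finset.sum_congr rfl fun j _ => (mul_smul _ _ _).symm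
    rw [Finset.sum_congr rfl h1, Finset.sum_comm]
    have h2 : ∀ c ∈ I, (∑ s ∈ T, ∑ j, (HSec.fn (R.D s F) θ * u c j s θ) • σ c j y) =
        (ρ c y * ρ c y * (Δ y)⁻¹) • h.1 θ := by
      intro c hc
      have hcy : y ∈ Dom β c := hρ c (subset_tsupport _ (by simpa [I] using hc))
      rw [Finset.sum_comm]
      have h3 : ∀ j, (∑ s ∈ T, (HSec.fn (R.D s F) θ * u c j s θ) • σ c j y) =
          (ρ c y * ρ c y * (Δ y)⁻¹) •
            (e.repr (triv β c y (h.1 θ)) j • trivSymm β c y (e j)) := by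
        intro j
        rw [← Finset.sum_smul, ← hfu c j θ hθ, hσ, map_smul, smul_smul, smul_smul]
        congr 1
        change ρ c y * e.repr (triv β c y (h.1 θ)) j * _ = _
        ring
      rw [Finset.sum_congr rfl fun j _ => h3 j, ← Finset.smul_sum, Finset.sum_repr_smul,
        trivSymm_triv hcy.2]
    rw [Finset.sum_congr rfl h2, ← Finset.sum_smul, ← Finset.sum_mul]
    have h4 : ∑ c ∈ I, ρ c y * ρ c y = Δ y :=
      (finsum_eq_sum_of_support_subset _ fun c hc => hI (by
        simpa using hc)).symm
    rw [h4, mul_inv_cancel₀ (hΔ y), one_smul]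
  · rw [h.2.2 θ hθ, Finset.sum_eq_zero]
    intro s _
    exact (HSec.smulLin _ _).2.2 θ hθ

end SectionDivision

/-! ### Coordinate changes on jets -/

section CoordinateChange

variable {n : ℕ} {M : Type*} [TopologicalSpace M] [ChartedSpace (EuclideanSpace ℝ (Fin n)) M]
  [IsManifold 𝓘(ℝ, EuclideanSpace ℝ (Fin n)) ∞ M]
  {π α β : VBundle n M} {U : Set (Jet π)} {F : HSec U α} {x y p q : M}

/-- The coordinates of order at most `k` around `q` are smooth functions of those around `p`. -/
theorem exists_coord_change (k : ℕ) (hp : y ∈ Dom π p) (hq : y ∈ Dom π q) :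
    ∃ T : Coord π k → Coord π k, ContDiff ℝ ∞ T ∧
      ∀ᶠ z in 𝓝 (chartAt (EuclideanSpace ℝ (Fin n)) p y), ∀ θ : Jet π, θ.base ∈ Dom π p →
        chartAt (EuclideanSpace ℝ (Fin n)) p θ.base = z → coord q k θ = T (coord p k θ) := by
  set χp := chartAt (EuclideanSpace ℝ (Fin n)) p
  set χq := chartAt (EuclideanSpace ℝ (Fin n)) q
  have hσ : SmoothNear (fun z => χq (χp.symm z)) (χp y) := smoothNear_chart_change hp.1 hq.1
  have hτ : SmoothNear (fun z => χp (χq.symm z)) (χq y) := smoothNear_chart_change hq.1 hp.1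
  have e : χq (χp.symm (χp y)) = χq y := by rw [χp.left_inv hp.1]
  have hB : SmoothNear (fun z => fderiv ℝ (fun v => χp (χq.symm v)) (χq (χp.symm z))) (χp y) := by
    have h1 : SmoothNear (fderiv ℝ (fun v => χp (χq.symm v))) (χq (χp.symm (χp y))) := by
      rw [e]
      filter_upwards [hτ] with v hv
      exact hv.fderiv_right (by simp)
    exact SmoothNear.comp h1 hσ
  obtain ⟨σ, hσs, hσe⟩ := hσ.exists_contDiff
  obtain ⟨A, hA, hAe⟩ := (smoothNear_fibChange hp hq).exists_contDiff
  obtain ⟨B, hB, hBe⟩ := hB.exists_contDiff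
  let H : JetSp (EuclideanSpace ℝ (Fin n)) π.Model 0 → π.Model := fun c => A c.1 (c.2 0 0)
  have hH : ContDiff ℝ ∞ H := by
    refine (hA.comp contDiff_fst).clm_apply ?_
    have h1 : ContDiff ℝ ∞ fun c : JetSp (EuclideanSpace ℝ (Fin n)) π.Model 0 => c.2 0 :=
      contDiff_pi.1 contDiff_snd 0
    exact (continuousMultilinearCurryFin0 ℝ (EuclideanSpace ℝ (Fin n)) π.Model).contDiff.comp h1
  refine ⟨fun c => (σ c.1, fun i => iterD H B i (truncJet (l := k) (by omega) c)),
    (hσs.comp contDiff_fst).prodMk (contDiff_pi.2 fun i =>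
      (contDiff_iterD hH hB i).comp (contDiff_truncJet (l := k) (by omega))), ?_⟩
  have hAB : ∀ᶠ z in 𝓝 (χp y), (fderiv ℝ (fun v => χq (χp.symm v)) z).comp (B z) =
      ContinuousLinearMap.id ℝ _ := by
    have hτ' : ∀ᶠ z in 𝓝 (χp y), SmoothNear (fun v => χp (χq.symm v)) (χq (χp.symm z)) := by
      refine hσ.contDiffAt.continuousAt.eventually ?_
      beta_reduce
      rw [e]
      exact hτ.eventually
    filter_upwards [hσ, hτ', hBe, eventually_chart_symm hp.1 ((isOpen_dom π q).mem_nhds hq),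
      eventually_chart_symm hp.1 ((isOpen_dom π p).mem_nhds hp),
      χp.open_target.mem_nhds (χp.map_source hp.1)] with z h1 h2 h3 h4 h5 h6
    have e1 : χp (χq.symm (χq (χp.symm z))) = z := by
      rw [χq.left_inv h4.1, χp.right_inv h6]
    rw [h3]
    have h7 : HasFDerivAt (fun v => χq (χp.symm v)) (fderiv ℝ (fun v => χq (χp.symm v)) z)
        (χp (χq.symm (χq (χp.symm z)))) := by
      rw [e1]
      exact (h1.differentiableAt (by simp)).hasFDerivAt
    have h8 := h7.comp (χq (χp.symm z)) ((h2.contDiffAt.differentiableAt (by simp)).hasFDerivAt)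
    refine h8.unique ((hasFDerivAt_id _).congr_of_eventuallyEq ?_)
    have h9 : χp.symm z = χq.symm (χq (χp.symm z)) := (χq.left_inv h4.1).symm
    filter_upwards [χq.open_target.mem_nhds (χq.map_source h4.1),
      eventually_chart_symm h4.1 ((isOpen_dom π p).mem_nhds h5)] with v h10 h11
    change χq (χp.symm (χp (χq.symm v))) = v
    rw [χp.left_inv h11.1, χq.right_inv h10]
  filter_upwards [hσ.eventually, hσe, hAB.eventually_nhds,
    (localRep_change hp hq).eventually_nhds, Filter.Eventually.eventually_nhds hAe,
    eventually_chart_symm hp.1 ((isOpen_dom π q).mem_nhds hq)]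
    with z h1 h2 h3 h4 h5 h6 θ hθ hz
  obtain ⟨s, y', rfl⟩ := exists_jet_eq θ
  replace hθ : y' ∈ Dom π p := hθ
  replace hz : χp y' = z := hz
  have hy' : χp.symm z = y' := by rw [← hz, χp.left_inv hθ.1]
  rw [hy'] at h6
  rw [coord_jet k s hθ, coord_jet k s h6]
  change (χq y', derivs k (localRep π q s) (χq y')) = (σ (χp y'), _)
  rw [hz, h2, hy']
  refine Prod.ext rfl (funext fun i => ?_)
  have h7 : SmoothNear (localRep π p s) z := hz ▸ smoothNear_localRep s hθ
  have h8 : SmoothNear (localRep π q s) (χq (χp.symm z)) := by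
    rw [hy']
    exact smoothNear_localRep s h6
  have h9 := iteratedFDeriv_eq_iterD hH hB h1 h7 h8 (by
    filter_upwards [h4, h5] with v hv hv'
    refine (hv s).trans ?_
    rw [← hv']
    rfl) h3 i
  rw [hy'] at h9
  exact h9.trans (congrArg _ (by rw [truncJet_jetAt]))

/-- Functions of the coordinates around `c`, cut off outside of the domain of these
coordinates, are smooth on the jet space. -/
theorem smoothOrd_coord (U : Set (Jet π)) {c : M} {ρ : M → ℝ}
    (hρ : ContMDiff 𝓘(ℝ, EuclideanSpace ℝ (Fin n)) 𝓘(ℝ) ∞ ρ) (hρs : tsupport ρ ⊆ Dom π c)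
    {k : ℕ} {Φ : Coord π k → ℝ} (hΦ : ContDiff ℝ ∞ Φ) :
    SmoothOrd (lineBundle n M) U k fun θ => ρ θ.base * Φ (coord c k θ) := by
  intro θ₀ h₀
  set p := θ₀.base with hp
  have hd := mem_dom π p
  by_cases hs : p ∈ tsupport ρ
  · obtain ⟨T, hT, hTe⟩ := exists_coord_change k hd (hρs hs)
    obtain ⟨ρ', hρ', hρe⟩ := (smoothNear_comp_chart_symm isOpen_univ hρ.contMDiffOn
      (Set.mem_univ p) hd.1).exists_contDiff
    obtain ⟨ε, hε, h1⟩ := exists_near_chart (hTe.and hρe)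
    obtain ⟨η, hη, h2⟩ := exists_near_base (θ₀ := θ₀) (dom_mem_nhds π θ₀.base)
    refine ⟨min ε η, lt_min hε hη, fun z => ρ' z.1 * Φ (T z),
      (hρ'.comp contDiff_fst).mul (hΦ.comp hT), fun θ hθ hN => ?_⟩
    refine (triv_lineBundle _ _ _).trans ?_
    obtain ⟨h3, h4⟩ := h1 k θ (hN.mono le_rfl (min_le_left _ _))
    have h5 := h2 k θ (hN.mono le_rfl (min_le_right _ _))
    change ρ θ.base * Φ (coord c k θ) =
      ρ' (chartAt (EuclideanSpace ℝ (Fin n)) p θ.base) * Φ (T (coord p k θ))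
    rw [h3 θ h5 rfl]
    refine congrArg (· * _) ?_
    refine Eq.trans ?_ h4.symm
    beta_reduce
    rw [(chartAt (EuclideanSpace ℝ (Fin n)) p).left_inv hN.1]
  · obtain ⟨ε, hε, h1⟩ := exists_near_base (θ₀ := θ₀) (notMem_tsupport_iff_eventuallyEq.1 hs)
    refine ⟨ε, hε, fun _ => 0, contDiff_const, fun θ hθ hN => ?_⟩
    refine (triv_lineBundle _ _ _).trans ?_
    have h2 : ρ θ.base = 0 := h1 k θ hN
    change ρ θ.base * _ = 0
    rw [h2, zero_mul]

end CoordinateChange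

/-! ### Curves through the prolongation -/

section Curves

variable {n : ℕ} {M : Type*} [TopologicalSpace M] [ChartedSpace (EuclideanSpace ℝ (Fin n)) M]
  [IsManifold 𝓘(ℝ, EuclideanSpace ℝ (Fin n)) ∞ M]
  {π α β : VBundle n M} {U : Set (Jet π)} {F : HSec U α} {x : M}

/-- A differentiable curve in a finite-dimensional subspace has its velocity there. -/
theorem HasDerivAt.mem_submodule {K : Type*} [NormedAddCommGroup K] [NormedSpace ℝ K]
    [FiniteDimensional ℝ K] {S : Submodule ℝ K} {f : ℝ → K} {f' : K} {t : ℝ}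
    (h : HasDerivAt f f' t) (hS : ∀ᶠ u in 𝓝 t, f u ∈ S) : f' ∈ S := by
  refine S.closed_of_finiteDimensional.mem_of_tendsto (hasDerivAt_iff_tendsto_slope.1 h) ?_
  filter_upwards [nhdsWithin_le_nhds hS] with u hu
  exact S.smul_mem _ (S.sub_mem hu hS.self_of_nhds)

theorem hasDerivAt_snd {A B : Type*} [NormedAddCommGroup A] [NormedSpace ℝ A]
    [NormedAddCommGroup B] [NormedSpace ℝ B] {f : ℝ → A × B} {f' : A × B} {t : ℝ}
    (h : HasDerivAt f f' t) : HasDerivAt (fun u => (f u).2) f'.2 t :=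
  (ContinuousLinearMap.snd ℝ A B).hasFDerivAt.comp_hasDerivAt t h

theorem shiftJet_snd_mem_jetSub {E W : Type*} [NormedAddCommGroup E] [NormedSpace ℝ E]
    [FiniteDimensional ℝ E] [NormedAddCommGroup W] [NormedSpace ℝ W] [FiniteDimensional ℝ W]
    {k : ℕ} {g : E → W} {z : E} (hg : SmoothNear g z) (u : E) :
    (shiftJet k (jetAt (k + 1) g z) u).2 ∈ jetSub E W k := by
  have hline : HasDerivAt (fun t : ℝ => z + t • u) u 0 := by
    simpa using ((hasDerivAt_id (0 : ℝ)).smul_const u).const_add z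
  have hline0 : z + (0 : ℝ) • u = z := by rw [zero_smul, add_zero]
  have h1 : HasFDerivAt (jetAt k g) (shiftJet k (jetAt (k + 1) g z)) (z + (0 : ℝ) • u) := by
    rw [hline0]
    exact hasFDerivAt_jetAt hg.contDiffAt
  have h3 : HasDerivAt (fun t : ℝ => derivs k g (z + t • u))
      (shiftJet k (jetAt (k + 1) g z) u).2 0 :=
    hasDerivAt_snd (HasFDerivAt.comp_hasDerivAt (0 : ℝ) h1 hline)
  refine HasDerivAt.mem_submodule h3 ?_
  have h2 : Filter.Tendsto (fun t : ℝ => z + t • u) (𝓝 0) (𝓝 z) := by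
    have := hline.continuousAt.tendsto
    rwa [hline0] at this
  filter_upwards [h2.eventually hg.eventually] with t ht
  exact derivs_mem_jetSub ht

/-- The local expression of a section of a horizontal module is valid along every curve of jets
whose coordinates are continuous. -/
theorem HSec.eventually_curve (φ : HSec U β) {s : Sec π} (hs : jet s x ∈ U) :
    ∃ (k : ℕ) (ε : ℝ) (G : Coord π k → β.Model), 0 < ε ∧ ContDiff ℝ ∞ G ∧
      (∀ θ ∈ U, Near k ε (jet s x) θ → triv β x θ.base (φ.1 θ) = G (coord x k θ)) ∧
      ∀ c : ℝ → Jet π, c 0 = jet s x → (∀ᶠ τ in 𝓝 0, c τ ∈ U) →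
        (∀ᶠ τ in 𝓝 0, (c τ).base ∈ Dom π x) →
        ContinuousAt (fun τ => coord x k (c τ)) 0 →
        ∀ᶠ τ in 𝓝 0, triv β x (c τ).base (φ.1 (c τ)) = G (coord x k (c τ)) := by
  obtain ⟨k, hk⟩ := φ.2.1
  obtain ⟨ε, hε, G, hG, h⟩ := hk _ hs
  refine ⟨k, ε, G, hε, hG, h, fun c hc0 hcU hcD hc => ?_⟩
  have h1 := Metric.tendsto_nhds.1 hc ε hε
  filter_upwards [hcU, hcD, h1] with τ h2 h3 h4
  refine h _ h2 ⟨h3.1, ?_⟩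
  rw [hc0] at h4
  exact h4

variable [T2Space M]

/-- Along a section prolonged inside of the equation to infinite order, `∇ F` is
constant to first order. -/
theorem fderiv_shiftJet_eq_zero (hU : IsOpenJet U) {N : HSec U α →ₗ[ℝ] HSec U β}
    (hN : IsCDiff N) {s : Sec π} (h : jet s x ∈ Prolongation F) {k : ℕ} {ε : ℝ} (hε : 0 < ε)
    {G : Coord π k → β.Model} (hG : ContDiff ℝ ∞ G)
    (hGe : ∀ θ ∈ U, Near k ε (jet s x) θ → triv β x θ.base ((N F).1 θ) = G (coord x k θ))
    (u : EuclideanSpace ℝ (Fin n)) :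
    fderiv ℝ G (coord x k (jet s x)) (shiftJet k (jetAt (k + 1) (localRep π x s)
      (chartAt (EuclideanSpace ℝ (Fin n)) x x)) u) = 0 := by
  set χ := chartAt (EuclideanSpace ℝ (Fin n)) x with hχ
  have hd := mem_dom π x
  have hs := smoothNear_localRep s hd
  have h1 := fderiv_comp_jetAt hG hs.contDiffAt
  have h2 : Flat 0 (fderiv ℝ (localRep β x (pullback (N F) s))) (χ x) :=
    Flat.fderiv (hN.flat_of_mem_prolongation hU h 1)
  have h3 : fderiv ℝ (localRep β x (pullback (N F) s)) (χ x) = 0 := by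
    have h4 := congrArg (fun m => m 0) (h2 0 le_rfl)
    simpa using h4
  have h7 : (fun z => G (jetAt k (localRep π x s) z)) =ᶠ[𝓝 (χ x)]
      localRep β x (pullback (N F) s) := by
    have h8 : ∀ᶠ y in 𝓝 x, Near k ε (jet s x) (jet s y) := by
      have h9 : Filter.Tendsto (fun y : M => ((0 : ℝ), y)) (𝓝 x) (𝓝 (0, x)) :=
        Continuous.tendsto (by fun_prop) _
      filter_upwards [h9.eventually (eventually_near s 0 (near_self k hε (jet s x)) hd)] with y hy
      rwa [zero_smul, add_zero] at hy
    have h10 : ∀ᶠ y in 𝓝 x, localRep β x (pullback (N F) s) (χ y) =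
        G (jetAt k (localRep π x s) (χ y)) := by
      filter_upwards [h8, eventually_mem_jet hU s h.1, dom_mem_nhds β x,
        dom_mem_nhds π x] with y h11 h12 h13 h14
      rw [localRep_self _ h13, ← coord_jet k s h14]
      exact hGe _ h12 h11
    filter_upwards [eventually_chart_symm hd.1 h10,
      χ.open_target.mem_nhds (χ.map_source hd.1)] with z h15 h16
    rw [χ.right_inv h16] at h15
    exact h15.symm
  rw [Filter.EventuallyEq.fderiv_eq (𝕜 := ℝ) h7, h3] at h1
  have h5 := DFunLike.congr_fun h1 u
  rw [coord_jet k s hd]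
  exact h5.symm

set_option maxHeartbeats 1000000 in
/-- Let `∇ ∘ ℓ_F` vanish on the prolongation. A tangent vector at a point of the prolongation is
the sum of one tangent to a prolonged section, along which `∇ F` is constant to first order because
it is flat there, and a vertical one, along which the derivative of `∇ F` is a
value of `∇ ∘ ℓ_F`. -/
theorem IsCDiff.hasDerivAt_curve (hU : IsOpenJet U) {N : HSec U α →ₗ[ℝ] HSec U β}
    (hN : IsCDiff N) {s : Sec π} (h : jet s x ∈ Prolongation F)
    (hl : ∀ φ : HSec U π, ∀ θ ∈ Prolongation F, (N (lin F φ)).1 θ = 0)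
    {c : ℝ → Jet π} (hc0 : c 0 = jet s x) (hcU : ∀ᶠ τ in 𝓝 0, c τ ∈ U)
    (hcD : ∀ᶠ τ in 𝓝 0, (c τ).base ∈ Dom π x)
    (hc : ∀ k, DifferentiableAt ℝ (fun τ => coord x k (c τ)) 0) :
    HasDerivAt (fun τ => triv β x (c τ).base ((N F).1 (c τ))) 0 0 := by
  obtain ⟨k, ε, G, hε, hG, hGe, hcurve⟩ := HSec.eventually_curve (N F) h.1
  have hGc := hcurve c hc0 hcU hcD (hc k).continuousAt
  set χ := chartAt (EuclideanSpace ℝ (Fin n)) x with hχ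
  have hd := mem_dom π x
  have hs := smoothNear_localRep s hd
  obtain ⟨⟨u, v⟩, hcX⟩ : ∃ X, HasDerivAt (fun τ => coord x k (c τ)) X 0 :=
    ⟨_, (hc k).hasDerivAt⟩
  -- the vertical part of the velocity is a jet
  have hXS : v ∈ jetSub (EuclideanSpace ℝ (Fin n)) π.Model k := by
    refine HasDerivAt.mem_submodule (hasDerivAt_snd hcX) ?_
    filter_upwards [hcD] with τ hτ
    obtain ⟨s', y, hs'⟩ := exists_jet_eq (c τ)
    rw [← hs'] at hτ ⊢
    replace hτ : y ∈ Dom π x := hτ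
    rw [coord_jet k s' hτ]
    exact derivs_mem_jetSub (smoothNear_localRep s' hτ)
  set J := shiftJet k (jetAt (k + 1) (localRep π x s) (χ x)) with hJ
  have hJS : (J u).2 ∈ jetSub (EuclideanSpace ℝ (Fin n)) π.Model k :=
    shiftJet_snd_mem_jetSub hs u
  obtain ⟨f, hf, hfX⟩ := exists_of_mem_jetSub (Submodule.sub_mem _ hXS hJS) (χ x)
  -- `w` is a section whose derivatives at `x` are the difference of the velocities of the curve
  -- and of `jet s` in the direction `u`
  obtain ⟨w, hw⟩ := exists_sec_localRep' hf hd
  have hJu : J u = (u, (J u).2) := rfl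
  have hsum : ((u, v) : Coord π k) = J u + (0, derivs k (localRep π x w) (χ x)) := by
    rw [derivs_congr hw, hfX, hJu, Prod.mk_add_mk, add_zero, add_sub_cancel]
  have hDG := ((hG.differentiable (by simp)) (coord x k (jet s x))).hasFDerivAt
  -- the derivative along the prolonged section
  have hA : fderiv ℝ G (coord x k (jet s x)) (J u) = 0 :=
    fderiv_shiftJet_eq_zero hU hN h hε hG hGe u
  -- the derivative along the vertical direction
  have hB : fderiv ℝ G (coord x k (jet s x)) (0, derivs k (localRep π x w) (χ x)) = 0 := by
    have h1 := hasDerivAt_family (θ₀ := jet s x) hU hG hGe s w h.1 (near_self k hε _) hd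
    have h2 := hN.hasDerivAt_apply hU h (w := w) (φ := HSec.ofSec U w) (by
      filter_upwards [eventually_mem_jet hU s h.1] with y hy
      exact (pullback_ofSec w s hy).symm)
    refine (h1.unique h2).trans ?_
    have h3 : pullback (N (lin F (HSec.ofSec U w))) s x = 0 := hl _ _ h
    rw [h3, map_zero]
  have hfin : HasDerivAt (fun τ => G (coord x k (c τ)))
      (fderiv ℝ G (coord x k (jet s x)) (u, v)) 0 := by
    refine HasFDerivAt.comp_hasDerivAt (0 : ℝ) ?_ hcX
    rw [hc0]
    exact hDG
  rw [hsum, map_add, hA, hB, add_zero] at hfin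
  exact hfin.congr_of_eventuallyEq hGc

end Curves

/-! ### The transversal curves of a splitting -/

section Splitting

variable {n : ℕ} {M : Type*} [TopologicalSpace M] [ChartedSpace (EuclideanSpace ℝ (Fin n)) M]
  [IsManifold 𝓘(ℝ, EuclideanSpace ℝ (Fin n)) ∞ M]
  {π α β : VBundle n M} {U : Set (Jet π)} {F : HSec U α} (R : Splitting F)

namespace Splitting

open Classical in
/-- The coordinate line of the `r`-th transversal coordinate through a point of the
prolongation. It is only meaningful for small parameters, and constant where it would leave
the range of the coordinates. -/
def curve (θ : Prolongation F) (r : R.ι) (τ : ℝ) : Jet π :=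
  if h : τ • (Pi.single r 1 : R.ι → ℝ) ∈ R.V then (R.ν.symm (θ, ⟨_, h⟩)).1 else θ.1

variable (θ : Prolongation F) (r : R.ι)

theorem curve_zero : R.curve θ r 0 = θ.1 := by
  classical
  have h : (0 : ℝ) • (Pi.single r 1 : R.ι → ℝ) ∈ R.V := by
    rw [zero_smul]
    exact R.zero_mem
  have h2 : (⟨_, h⟩ : R.V) = ⟨0, R.zero_mem⟩ := Subtype.ext (zero_smul _ _)
  rw [curve, dif_pos h, h2, R.symm_zero]

theorem curve_mem (τ : ℝ) : R.curve θ r τ ∈ U := by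
  unfold curve
  split_ifs with h
  · exact (R.ν.symm _).2
  · exact θ.2.1

open Classical in
theorem eventually_curve : ∀ᶠ τ in 𝓝 (0 : ℝ), ∃ h : τ • (Pi.single r 1 : R.ι → ℝ) ∈ R.V,
    R.curve θ r τ = (R.ν.symm (θ, ⟨_, h⟩)).1 := by
  have h1 : ContinuousAt (fun τ : ℝ => τ • (Pi.single r 1 : R.ι → ℝ)) 0 := by fun_prop
  have h2 := h1.eventually (R.isOpen.mem_nhds (by
    beta_reduce
    rw [zero_smul]
    exact R.zero_mem))
  filter_upwards [h2] with τ hτ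
  exact ⟨hτ, dif_pos hτ⟩

open Classical in
theorem eventually_fn_curve : ∀ᶠ τ in 𝓝 (0 : ℝ), ∀ i,
    HSec.fn (R.D i F) (R.curve θ r τ) = τ * (Pi.single r 1 : R.ι → ℝ) i := by
  filter_upwards [R.eventually_curve θ r] with τ ⟨h, hτ⟩ i
  rw [hτ, ← R.ν_snd, Equiv.apply_symm_apply]
  rfl

theorem differentiableAt_comp_curve {k : ℕ} {f : Jet π → ℝ}
    (hf : SmoothOrd (lineBundle n M) U k f) :
    DifferentiableAt ℝ (fun τ => f (R.curve θ r τ)) 0 := by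
  classical
  obtain ⟨l, T, h⟩ := R.smooth_symm k
  obtain ⟨ε, hε, G, hG, hfG⟩ := h f hf (θ, ⟨0, R.zero_mem⟩)
  have hd : DifferentiableAt ℝ (fun τ : ℝ => G (coord θ.1.base l θ.1,
      fun s : T => τ * (Pi.single r 1 : R.ι → ℝ) s)) 0 := by
    refine ((hG.differentiable (by simp)) _).comp (0 : ℝ) ?_
    fun_prop
  refine hd.congr_of_eventuallyEq ?_
  filter_upwards [R.eventually_curve θ r, Metric.ball_mem_nhds (0 : ℝ) hε] with τ ⟨h2, h3⟩ h4
  rw [h3]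
  refine hfG (θ, ⟨_, h2⟩) (near_self l hε _) fun s _ => ?_
  change |τ * (Pi.single r 1 : R.ι → ℝ) s - 0| < ε
  rw [mem_ball_zero_iff, Real.norm_eq_abs] at h4
  by_cases hs : s = r
  · subst hs
    simpa using h4
  · simpa [Pi.single_eq_of_ne hs] using hε

variable [T2Space M]

theorem eventually_curve_base {O : Set M} (hO : O ∈ 𝓝 θ.1.base) :
    ∀ᶠ τ in 𝓝 (0 : ℝ), (R.curve θ r τ).base ∈ O := by
  obtain ⟨ρ, hρ, hρs, hρ1⟩ := exists_bump (n := n) (Filter.inter_mem hO (dom_mem_nhds π θ.1.base))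
  have h1 := (R.differentiableAt_comp_curve θ r (smoothOrd_coord U hρ
    (hρs.trans Set.inter_subset_right)
    (contDiff_const (c := (1 : ℝ)) (E := Coord π 0)))).continuousAt
  have h2 := h1.eventually_ne (y := 0) (by
    rw [R.curve_zero, mul_one, hρ1.self_of_nhds]
    exact one_ne_zero)
  filter_upwards [h2] with τ hτ
  exact (hρs (subset_tsupport _ (left_ne_zero_of_mul hτ))).1

/-- The jet coordinates are differentiable along the transversal curves. -/
theorem differentiableAt_coord_curve (k : ℕ) :
    DifferentiableAt ℝ (fun τ => coord θ.1.base k (R.curve θ r τ)) 0 := by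
  obtain ⟨ρ, hρ, hρs, hρ1⟩ := exists_bump (n := n) (dom_mem_nhds π θ.1.base)
  obtain ⟨O, hO, hOo, hθO⟩ := eventually_nhds_iff.1 hρ1
  let e := (Module.finBasis ℝ (Coord π k)).equivFunL
  refine e.comp_differentiableAt_iff.1 (differentiableAt_pi.2 fun i => ?_)
  have h1 : ContDiff ℝ ∞ fun c : Coord π k => e c i := contDiff_pi.1 e.contDiff i
  refine (R.differentiableAt_comp_curve θ r
    (smoothOrd_coord U hρ hρs h1)).congr_of_eventuallyEq ?_
  filter_upwards [R.eventually_curve_base θ r (hOo.mem_nhds hθO)] with τ hτ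
  beta_reduce
  rw [hO _ hτ, one_mul]
  rfl

/-- If `∇ ∘ ℓ_F` vanishes on the prolongation, so do the coefficients `g_s` of
`∇ F = ∑ D_s F • g_s`: along the `r`-th transversal curve `∇ F` is `τ • g_r`, and
its derivative at the prolongation is zero. -/
theorem coeff_eq_zero (hU : IsOpenJet U) {N : HSec U α →ₗ[ℝ] HSec U β} (hN : IsCDiff N)
    (hl : ∀ φ : HSec U π, ∀ θ ∈ Prolongation F, (N (lin F φ)).1 θ = 0)
    {T : Finset R.ι} {g : R.ι → HSec U β}
    (h : N F = ∑ s ∈ T, HSec.smulLin (g s) (R.D s F)) (hr : r ∈ T) : (g r).1 θ.1 = 0 := by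
  classical
  obtain ⟨θ, hθ⟩ := θ
  obtain ⟨s, x, rfl⟩ := exists_jet_eq θ
  set c := R.curve ⟨jet s x, hθ⟩ r with hc
  have hc0 : c 0 = jet s x := R.curve_zero _ r
  have hcU : ∀ᶠ τ in 𝓝 0, c τ ∈ U := Filter.Eventually.of_forall (R.curve_mem _ r)
  have hcD : ∀ᶠ τ in 𝓝 0, (c τ).base ∈ Dom π x :=
    R.eventually_curve_base ⟨jet s x, hθ⟩ r (dom_mem_nhds π x)
  have hcd : ∀ k, DifferentiableAt ℝ (fun τ => coord x k (c τ)) 0 :=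
    R.differentiableAt_coord_curve ⟨jet s x, hθ⟩ r
  have h1 := hN.hasDerivAt_curve hU hθ hl hc0 hcU hcD hcd
  obtain ⟨k, ε, G, hε, hG, -, hgc⟩ := HSec.eventually_curve (g r) hθ.1
  have h2 := hgc c hc0 hcU hcD (hcd k).continuousAt
  have h3 : ContinuousAt (fun τ => G (coord x k (c τ))) 0 :=
    ContinuousAt.comp (g := G) hG.continuous.continuousAt (hcd k).continuousAt
  have h4 := hasDerivAt_smul_of_eq_zero (hasDerivAt_id (0 : ℝ)) rfl h3
  have h5 : (fun τ => triv β x (c τ).base ((N F).1 (c τ))) =ᶠ[𝓝 0]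
      fun τ => id τ • G (coord x k (c τ)) := by
    filter_upwards [h2, R.eventually_fn_curve ⟨jet s x, hθ⟩ r] with τ h6 h7
    rw [← h6, id, ← map_smul, h, Submodule.coe_sum, Finset.sum_apply]
    refine congrArg _ ((Finset.sum_eq_single_of_mem r hr fun i _ hi => ?_).trans ?_)
    · rw [HSec.smulLin_apply, h7, Pi.single_eq_of_ne hi, mul_zero, zero_smul]
    · rw [HSec.smulLin_apply, h7, Pi.single_eq_same, mul_one]
  have h6 := (h4.congr_of_eventuallyEq h5).unique h1
  rw [one_smul, ← h2.self_of_nhds, hc0] at h6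
  exact triv_injective (mem_dom β x).2 (h6.trans (map_zero _).symm)

end Splitting

end Splitting

/-! ### Operators and the prolongation -/

section Operators

variable {n : ℕ} {M : Type*} [TopologicalSpace M] [ChartedSpace (EuclideanSpace ℝ (Fin n)) M]
  [IsManifold 𝓘(ℝ, EuclideanSpace ℝ (Fin n)) ∞ M] [T2Space M]
  {π α β γ : VBundle n M} {U : Set (Jet π)} {F : HSec U α}

/-- Multiples of transversal coordinates are flat along sections prolonged inside of the
equation. -/
theorem IsCDiff.flatAt_smulLin (hU : IsOpenJet U) {D : HSec U α →ₗ[ℝ] HSec U (lineBundle n M)}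
    (hD : IsCDiff D) (g : HSec U β) {s : Sec π} {x : M} (h : jet s x ∈ Prolongation F) (k : ℕ) :
    FlatAt β k (pullback (HSec.smulLin g (D F)) s) x := by
  have h1 : Flat k (localRep (lineBundle n M) x (pullback (D F) s))
    (chartAt (EuclideanSpace ℝ (Fin n)) x x) := hD.flat_of_mem_prolongation hU h k
  have h2 := Flat.bilin (Y := ℝ) (ContinuousLinearMap.lsmul ℝ ℝ) h1
    (smoothNear_pullback hU (D F) s h.1) (smoothNear_pullback hU g s h.1)
  refine Flat.congr h2 (Filter.Eventually.of_forall fun z => ?_)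
  exact (map_smul (triv β x _) _ _).trans
    (congrArg (fun a : ℝ => a • _) (triv_lineBundle _ _ _).symm)

theorem res_surjective (F : HSec U α) (β : VBundle n M) : Function.Surjective (res F β) :=
  LinearMap.surjective_rangeRestrict _

theorem res_eq_zero_iff {φ : HSec U β} :
    res F β φ = 0 ↔ ∀ θ ∈ Prolongation F, φ.1 θ = 0 :=
  ⟨fun h θ hθ => congrFun (congrArg Subtype.val h) ⟨θ, hθ⟩,
    fun h => Subtype.ext (funext fun θ => h θ.1 θ.2)⟩

/-- If `∇ F = 0`, then `∇ ∘ ℓ_F` vanishes on the prolongation. -/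
theorem IsCDiff.apply_lin_eq_zero (hU : IsOpenJet U) {N : HSec U α →ₗ[ℝ] HSec U β}
    (hN : IsCDiff N) (h0 : N F = 0) (φ : HSec U π) : res F β (N (lin F φ)) = 0 := by
  refine res_eq_zero_iff.2 fun θ hθ => ?_
  obtain ⟨s, x, rfl⟩ := exists_jet_eq θ
  obtain ⟨w, hw⟩ := exists_sec_eq_pullback hU φ s hθ.1
  have h1 := hN.hasDerivAt_apply hU hθ hw
  have h2 : (fun t : ℝ => triv β x x (pullback (N F) (s + t • w) x)) = fun _ => 0 := by
    funext t
    rw [h0]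
    exact map_zero _
  rw [h2] at h1
  exact triv_injective (mem_dom β x).2 ((h1.unique (hasDerivAt_const _ _)).trans (map_zero _).symm)

variable [SigmaCompactSpace M]

/-- The restriction of `∇ φ` to the prolongation depends only on the restriction of `φ`. -/
theorem IsCDiff.res_eq_zero (hU : IsOpenJet U) (hF : Regular F) {N : HSec U β →ₗ[ℝ] HSec U γ}
    (hN : IsCDiff N) {φ : HSec U β} (h : res F β φ = 0) : res F γ (N φ) = 0 := by
  obtain ⟨R⟩ := hF.exists_splitting
  obtain ⟨T, g, rfl⟩ := R.exists_division φ (res_eq_zero_iff.1 h)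
  rw [map_sum, map_sum]
  refine Finset.sum_eq_zero fun r _ => res_eq_zero_iff.2 fun θ hθ => ?_
  obtain ⟨s, x, rfl⟩ := exists_jet_eq θ
  obtain ⟨k, hk⟩ := hN
  exact hk _ s x hθ.1 ((R.isCDiff r).flatAt_smulLin hU (g r) hθ k)

theorem IsCDiff.exists_restrictsTo (hU : IsOpenJet U) (hF : Regular F)
    {N : HSec U β →ₗ[ℝ] HSec U γ} (hN : IsCDiff N) :
    ∃ N' : ESec F β →ₗ[ℝ] ESec F γ, RestrictsTo F N N' := by
  obtain ⟨e, he⟩ := (res F β).exists_rightInverse_of_surjective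
    (LinearMap.range_eq_top.2 (res_surjective F β))
  refine ⟨res F γ ∘ₗ N ∘ₗ e, fun φ => ?_⟩
  have h1 : res F β (e (res F β φ) - φ) = 0 := by
    rw [map_sub, sub_eq_zero]
    exact LinearMap.congr_fun he _
  have h2 := hN.res_eq_zero hU hF h1
  rw [map_sub, map_sub, sub_eq_zero] at h2
  exact h2

/-- An operator with `∇ ∘ ℓ_F = 0` on the prolongation can be changed outside of the
prolongation so as to annihilate `F`: with `∇ F = ∑ D_s F • g_s`, one subtracts
`∑ g_s D_s`. -/
theorem IsCDiff.exists_apply_eq_zero (hU : IsOpenJet U) (hF : Regular F)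
    {N : HSec U α →ₗ[ℝ] HSec U β} (hN : IsCDiff N)
    (hl : ∀ φ : HSec U π, res F β (N (lin F φ)) = 0) :
    ∃ N' : HSec U α →ₗ[ℝ] HSec U β, IsCDiff N' ∧ N' F = 0 ∧
      ∀ φ, res F β (N' φ) = res F β (N φ) := by
  obtain ⟨R⟩ := hF.exists_splitting
  obtain ⟨T, g, hT⟩ := R.exists_division (N F) fun θ hθ => hN.apply_eq_zero_of_mem hθ
  refine ⟨N - ∑ s ∈ T, HSec.smulLin (g s) ∘ₗ R.D s,
    hN.sub (IsCDiff.sum T fun s _ => (R.isCDiff s).smulLin_comp (g s)), ?_, fun φ => ?_⟩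
  · rw [LinearMap.sub_apply, LinearMap.sum_apply, sub_eq_zero]
    exact hT
  · rw [LinearMap.sub_apply, map_sub, LinearMap.sum_apply, map_sum, sub_eq_self]
    refine Finset.sum_eq_zero fun s hs => res_eq_zero_iff.2 fun θ hθ => ?_
    rw [LinearMap.comp_apply, HSec.smulLin_apply,
      R.coeff_eq_zero ⟨θ, hθ⟩ s hU hN (fun φ => res_eq_zero_iff.1 (hl φ)) hT hs, smul_zero]

theorem IsCDiffE.exists_apply_eq_zero (hU : IsOpenJet U) (hF : Regular F)
    {Δ : ESec F α →ₗ[ℝ] ESec F β} (hΔ : IsCDiffE F Δ) (hl : KillsLin F Δ) :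
    ∃ D : HSec U α →ₗ[ℝ] HSec U β, IsCDiff D ∧ RestrictsTo F D Δ ∧ D F = 0 := by
  obtain ⟨D, hD, hr⟩ := hΔ
  obtain ⟨D', h1, h2, h3⟩ := hD.exists_apply_eq_zero hU hF fun φ => by rw [← hr, hl φ]
  exact ⟨D', h1, fun φ => (hr φ).trans (h3 φ).symm, h2⟩

theorem IsCDiff.exists_killsLin (hU : IsOpenJet U) (hF : Regular F)
    {N : HSec U α →ₗ[ℝ] HSec U β} (hN : IsCDiff N) (h0 : N F = 0) :
    ∃ N' : ESec F α →ₗ[ℝ] ESec F β, RestrictsTo F N N' ∧ IsCDiffE F N' ∧ KillsLin F N' := by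
  obtain ⟨N', h⟩ := hN.exists_restrictsTo hU hF
  exact ⟨N', h, ⟨N, hN, h⟩, fun φ => by rw [h, hN.apply_lin_eq_zero hU h0]⟩

theorem RestrictsTo.unique {N : HSec U β →ₗ[ℝ] HSec U γ} {Δ Δ' : ESec F β →ₗ[ℝ] ESec F γ}
    (h : RestrictsTo F N Δ) (h' : RestrictsTo F N Δ') : Δ = Δ' := by
  refine LinearMap.ext fun p => ?_
  obtain ⟨φ, rfl⟩ := res_surjective F β p
  rw [h, h']

theorem isCDiffE_zero (F : HSec U α) : IsCDiffE F (0 : ESec F β →ₗ[ℝ] ESec F γ) :=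
  ⟨0, IsCDiff.zero, fun φ => by simp⟩

theorem isCompatibility_iff (hU : IsOpenJet U) (hF : Regular F)
    {Δ : ESec F α →ₗ[ℝ] ESec F β} (hΔ : IsCDiffE F Δ) :
    IsCompatibility F Δ ↔ KillsLin F Δ ∧
      ∀ (γ : VBundle n M) (N : HSec U α →ₗ[ℝ] HSec U γ), IsCDiff N → N F = 0 →
        ∃ B : ESec F β →ₗ[ℝ] ESec F γ, IsCDiffE F B ∧ RestrictsTo F N (B ∘ₗ Δ) := by
  constructor
  · rintro ⟨-, hk, hu⟩
    refine ⟨hk, fun γ N hN h0 => ?_⟩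
    obtain ⟨N', h1, h2, h3⟩ := hN.exists_killsLin hU hF h0
    obtain ⟨B, hB, rfl⟩ := hu γ N' h2 h3
    exact ⟨B, hB, h1⟩
  · rintro ⟨hk, hu⟩
    refine ⟨hΔ, hk, fun γ N hN hl => ?_⟩
    obtain ⟨D, h1, h2, h3⟩ := hN.exists_apply_eq_zero hU hF hl
    obtain ⟨B, hB, h4⟩ := hu γ D h1 h3
    exact ⟨B, hB, h2.unique h4⟩

theorem isNormal_iff (hU : IsOpenJet U) (hF : Regular F) :
    IsNormal F ↔ ∀ (γ : VBundle n M) (N : HSec U α →ₗ[ℝ] HSec U γ), IsCDiff N → N F = 0 →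
      RestrictsTo F N 0 := by
  constructor
  · rintro ⟨β, h⟩ γ N hN h0
    obtain ⟨B, -, hB⟩ := ((isCompatibility_iff hU hF h.1).1 h).2 γ N hN h0
    rwa [LinearMap.comp_zero] at hB
  · intro h
    refine ⟨α, (isCompatibility_iff hU hF (isCDiffE_zero F)).2 ⟨fun _ => rfl,
      fun γ N hN h0 => ⟨0, isCDiffE_zero F, ?_⟩⟩⟩
    rw [LinearMap.comp_zero]
    exact h γ N hN h0

end Operators

end JetGeom

end

open JetGeom in
theorem mainTheorem7 {n : ℕ} {M : Type*} [TopologicalSpace M] [T2Space M] [SigmaCompactSpace M]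
    [ChartedSpace (EuclideanSpace ℝ (Fin n)) M]
    [IsManifold 𝓘(ℝ, EuclideanSpace ℝ (Fin n)) ∞ M]
    (π α₁ : VBundle n M) (U : Set (Jet π)) (hU : IsOpenJet U)
    (F : HSec U α₁) (hF : Regular F) :
    (∀ φ p, IsLinearization F φ p ↔ p = lin F φ) ∧
    (∀ (α₂ : VBundle n M) (Δ : ESec F α₁ →ₗ[ℝ] ESec F α₂), IsCDiffE F Δ →
      (IsCompatibility F Δ ↔ KillsLin F Δ ∧
        ∀ (α : VBundle n M) (N : HSec U α₁ →ₗ[ℝ] HSec U α), IsCDiff N → N F = 0 →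
          ∃ B : ESec F α₂ →ₗ[ℝ] ESec F α, IsCDiffE F B ∧ RestrictsTo F N (B ∘ₗ Δ))) ∧
    (IsNormal F ↔
      ∀ (α : VBundle n M) (N : HSec U α₁ →ₗ[ℝ] HSec U α), IsCDiff N → N F = 0 →
        RestrictsTo F N 0) ∧
    (∀ (α₂ : VBundle n M) (Δ : ESec F α₁ →ₗ[ℝ] ESec F α₂), IsCompatibility F Δ →
      ∃ D : HSec U α₁ →ₗ[ℝ] HSec U α₂, IsCDiff D ∧ RestrictsTo F D Δ ∧ D F = 0) := by
  refine ⟨fun φ p => isLinearization_iff hU F φ p,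
    fun _ _ hΔ => isCompatibility_iff hU hF hΔ, isNormal_iff hU hF,
    fun _ _ hΔ => hΔ.1.exists_apply_eq_zero hU hF hΔ.2.1⟩
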